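/- Let $\Delta$ be a triangulation of a polygonal domain in $\mathbb{R}^2$ (the compact region bounded by a simple closed polygon): a finite collection of triangles, any two of which are disjoint or meet in a common vertex or a common edge. An edge is interior if it lies in two triangles and a boundary edge if it lies in only one; a vertex is interior if it lies on no boundary edge. Write $\Delta^\circ_0,\Delta^\circ_1$ for the sets of interior vertices and interior edges and $\Delta_2$ for the set of triangles. Assume that $\Delta$ has exactly two interior vertices $v_1,v_2$, that they are joined by an edge $\tau$, and that no other edge containing $v_1$ or $v_2$ has the same slope as $\tau$. Let $s$ (respectively $t$) be the number of different slopes of the edges other than $\tau$ that contain $v_1$ (respectively $v_2$), let $r\ge 0$ be an integer, and assume $2\le s\le t\le r+1$. Let $R=\mathbb{R}[x,y,z]$. For an interior edge $\varepsilon$ let $J(\varepsilon)=\langle \ell_\varepsilon^{\,r+1}\rangle$, where $\ell_\varepsilon$ is a nonzero linear form vanishing at $(a,b,1)$ for all $(a,b)\in\varepsilon$, and for an interior vertex $\gamma$ let $J(\gamma)=\sum_{\gamma\in\varepsilon\in\Delta^\circ_1}J(\varepsilon)$. Let $\mathcal{R}_\bullet/\mathcal{J}_\bullet$ be the complex of graded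 $R$-modules $$\bigoplus_{\sigma\in\Delta_2}R\to\bigoplus_{\varepsilon\in\Delta^\circ_1}R/J(\varepsilon)\to\bigoplus_{\gamma\in\Delta^\circ_0}R/J(\gamma)$$ induced by the simplicial chain complex of $\Delta$ relative to its boundary with coefficients in $R$. Then $H_1(\mathcal{R}_\bullet/\mathcal{J}_\bullet)$ is a nonzero module of finite length, and its regularity $\mathrm{reg}\,H_1=\max\{d : H_1(\mathcal{R}_\bullet/\mathcal{J}_\bullet)_d\ne 0\}$ satisfies $$\left\lfloor\tfrac{r+1}{s}\right\rfloor+\left\lfloor\tfrac{r+1}{t}\right\rfloor+r-1\ \le\ \mathrm{reg}\,H_1\ \le\ \left\lfloor\tfrac{r+1}{s}+\tfrac{r+1}{t}\right\rfloor+r-1 .$$ More precisely, $$\mathrm{reg}\,H_1=\begin{cases}\left\lfloor\frac{r+1}{s}\right\rfloor+\left\lfloor\frac{r+1}{t}\right\rfloor+r&\text{if } r+1\equiv s-1 \ (\mathrm{mod}\ s)\text{ and } r+1\equiv t-1\ (\mathrm{mod}\ t),\\[2pt]\left\lfloor\frac{r+1}{s}\right\rfloor+\left\lfloor\frac{r+1}{t}\right\rfloor+r-1&\text{otherwise.}\end{cases}$$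 Moreover, for every integer $d\ge 0$ with $d>\frac{r+1}{s}+\frac{r+1}{t}+r-1$ the real vector space $C^r_d(\Delta)$ of functions on $|\Delta|$ that are continuously differentiable of order $r$ and restrict on every triangle to a polynomial of degree at most $d$ is finite dimensional, of dimension Schumaker's lower bound $$L(\Delta,d,r)=\binom{d+2}{2}+\Bigl(|\Delta^\circ_1|-\sum_{\gamma\in\Delta^\circ_0}s_\gamma\Bigr)\binom{d+1-r}{2}+\sum_{\gamma\in\Delta^\circ_0}\left(\mu_\gamma\binom{d+2-\alpha_\gamma}{2}+\nu_\gamma\binom{d+1-\alpha_\gamma}{2}\right),$$ where $s_\gamma$ is the number of different slopes of the edges containing $\gamma$, $s_\gamma(r+1)=\alpha_\gamma(s_\gamma-1)+\nu_\gamma$ with integers $\alpha_\gamma,\nu_\gamma$ and $0\le\nu_\gamma<s_\gamma-1$, $\mu_\gamma=s_\gamma-1-\nu_\gamma$, and $\binom{A}{2}=0$ for $A<2$. -/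

import Mathlib

open scoped Classical

noncomputable section

namespace SplineTriangulation

/-! ### Triangulations of polygonal domains -/

/-- The plane `ℝ²`, with coordinates `v 0`, `v 1`. -/
abbrev Plane : Type := Fin 2 → ℝ

/-- `P 0, …, P (n-1)` are the consecutive vertices of a simple closed polygon: the vertices are
distinct, and the relative interior of a side meets no other side. -/
def IsSimplePolygon {n : ℕ} (P : ZMod n → Plane) : Prop :=
  3 ≤ n ∧ Function.Injective P ∧
    ∀ i j, i ≠ j → Disjoint (openSegment ℝ (P i) (P (i + 1))) (segment ℝ (P j) (P (j + 1)))

/-- A polygonal domain: the compact region bounded by a simple closed polygon. By the Jordan curve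
theorem, a compact set with connected (in particular nonempty) interior whose topological boundary
is a simple closed polygon consists exactly of that polygon and the bounded component of its
complement. -/
def IsPolygonalDomain (Ω : Set Plane) : Prop :=
  IsCompact Ω ∧ IsConnected (interior Ω) ∧
    ∃ (n : ℕ) (P : ZMod n → Plane), IsSimplePolygon P ∧
      frontier Ω = ⋃ i, segment ℝ (P i) (P (i + 1))

/-- A triangulation of a polygonal domain: a finite geometric simplicial complex in the plane (faces
are given by their vertex sets; two faces meet in the convex hull of their common vertices) in which
every face lies in a triangle, and whose underlying space is a polygonal domain. -/
structure PlanarTriangulation extends Geometry.SimplicialComplex ℝ Plane where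
  finite_faces : faces.Finite
  pure : ∀ e ∈ faces, ∃ σ ∈ faces, e ⊆ σ ∧ σ.card = 3
  polygonal : IsPolygonalDomain toSimplicialComplex.space

namespace PlanarTriangulation

variable (Δ : PlanarTriangulation)

/-- The set `|Δ|`. -/
def domain : Set Plane := Δ.toSimplicialComplex.space

/-- The triangles. -/
def triangles : Finset (Finset Plane) := Δ.finite_faces.toFinset.filter fun σ => σ.card = 3

/-- The edges. -/
def edges : Finset (Finset Plane) := Δ.finite_faces.toFinset.filter fun τ => τ.card = 2

/-- The vertices. -/
def vertexSet : Finset Plane := Δ.finite_faces.toFinset.biUnion id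

/-- An interior edge is a common edge of two triangles. -/
def interiorEdges : Finset (Finset Plane) :=
  Δ.edges.filter fun τ =>
    ∃ σ ∈ Δ.triangles, ∃ σ' ∈ Δ.triangles, σ ≠ σ' ∧ τ ⊆ σ ∧ τ ⊆ σ'

/-- A boundary edge is an edge of a single triangle. -/
def boundaryEdges : Finset (Finset Plane) :=
  Δ.edges.filter fun τ => ∃! σ, σ ∈ Δ.triangles ∧ τ ⊆ σ

/-- An interior vertex is a vertex that lies on no boundary edge. -/
def interiorVertices : Finset Plane :=
  Δ.vertexSet.filter fun v => ∀ τ ∈ Δ.boundaryEdges, v ∉ τ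

end PlanarTriangulation

/-- The slope of the segment from `v` to `w ≠ v`, as a point of the projective line of directions
(so vertical edges have a slope as well). -/
def slope (v w : Plane) : Submodule ℝ Plane := Submodule.span ℝ {w - v}

/-- The set of slopes of the edges in `E` that contain `v`. -/
def slopes (E : Finset (Finset Plane)) (v : Plane) : Set (Submodule ℝ Plane) :=
  {L | ∃ w, {v, w} ∈ E ∧ L = slope v w}

namespace PlanarTriangulation

variable (Δ : PlanarTriangulation) (r d : ℕ)

/-! ### Splines and Schumaker's lower bound -/

/-- The space `C^r_d(Δ)` of functions on `|Δ|` that are continuously differentiable of order `r` and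
are given on each triangle by a polynomial of degree at most `d`. -/
def splines : Submodule ℝ (Δ.domain → ℝ) where
  carrier := {F |
    (∃ G : Plane → ℝ, (∀ x : Δ.domain, G x = F x) ∧ ContDiffOn ℝ r G Δ.domain) ∧
    ∀ σ ∈ Δ.triangles, ∃ p : MvPolynomial (Fin 2) ℝ, p.totalDegree ≤ d ∧
      ∀ x : Δ.domain, (x : Plane) ∈ convexHull ℝ (σ : Set Plane) →
        F x = MvPolynomial.eval (x : Plane) p}
  zero_mem' := by
    refine ⟨⟨0, fun _ => rfl, contDiffOn_const⟩, fun σ _ => ⟨0, by simp, fun x _ => by simp⟩⟩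
  add_mem' := by
    rintro F F' ⟨⟨G, hG, hG'⟩, h⟩ ⟨⟨K, hK, hK'⟩, h'⟩
    refine ⟨⟨G + K, fun x => by simp [hG, hK], hG'.add hK'⟩, fun σ hσ => ?_⟩
    obtain ⟨p, hp, hp'⟩ := h σ hσ
    obtain ⟨q, hq, hq'⟩ := h' σ hσ
    exact ⟨p + q, (MvPolynomial.totalDegree_add p q).trans (max_le hp hq),
      fun x hx => by simp [hp' x hx, hq' x hx]⟩
  smul_mem' := by
    rintro c F ⟨⟨G, hG, hG'⟩, h⟩
    refine ⟨⟨c • G, fun x => by simp [hG], contDiffOn_const.smul hG'⟩, fun σ hσ => ?_⟩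
    obtain ⟨p, hp, hp'⟩ := h σ hσ
    exact ⟨c • p, (MvPolynomial.totalDegree_smul_le c p).trans hp,
      fun x hx => by simp [hp' x hx, MvPolynomial.smul_eval]⟩

/-- The number `s_γ` of slopes of the edges containing the vertex `γ`. -/
def numSlopes (γ : Plane) : ℕ := (slopes Δ.edges γ).ncard

/-- The quotient `α_γ` of `s_γ (r+1)` by `s_γ - 1`. -/
def alpha (γ : Plane) : ℕ := Δ.numSlopes γ * (r + 1) / (Δ.numSlopes γ - 1)

/-- The remainder `ν_γ` of `s_γ (r+1)` by `s_γ - 1`. -/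
def nu (γ : Plane) : ℕ := Δ.numSlopes γ * (r + 1) % (Δ.numSlopes γ - 1)

/-- `μ_γ = s_γ - 1 - ν_γ`. -/
def mu (γ : Plane) : ℕ := Δ.numSlopes γ - 1 - Δ.nu r γ

/-- Schumaker's lower bound `L(Δ,d,r)`. Truncated subtraction in the upper entries of the binomial
coefficients agrees with the convention that `binom A 2 = 0` for every integer `A < 2`. -/
def schumakerBound : ℤ :=
  ((d + 2).choose 2 : ℤ)
    + ((Δ.interiorEdges.card : ℤ) - ∑ γ ∈ Δ.interiorVertices, (Δ.numSlopes γ : ℤ))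
        * ((d + 1 - r).choose 2 : ℤ)
    + ∑ γ ∈ Δ.interiorVertices,
        ((Δ.mu r γ : ℤ) * ((d + 2 - Δ.alpha r γ).choose 2 : ℤ)
          + (Δ.nu r γ : ℤ) * ((d + 1 - Δ.alpha r γ).choose 2 : ℤ))

end PlanarTriangulation

/-! ### The Billera–Schenck–Stillman complex -/

/-- The polynomial ring `R = ℝ[x, y, z]`. -/
abbrev R : Type := MvPolynomial (Fin 3) ℝ

/-- `J(τ)`, generated by `ℓ_τ ^ (r+1)`, where `ℓ_τ` is a linear form vanishing on the cone over the
edge `τ`, that is, at the points `(v, 1)` for the two endpoints `v` of `τ`. Such forms are all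
multiples of one nonzero form, so that no choice has to be made. -/
def edgeIdeal (r : ℕ) (τ : Finset Plane) : Ideal R :=
  Ideal.span {f | ∃ ℓ : R, ℓ.IsHomogeneous 1 ∧
    (∀ v ∈ τ, MvPolynomial.eval ![v 0, v 1, 1] ℓ = 0) ∧ f = ℓ ^ (r + 1)}

/-- The lexicographic order on the plane. -/
def LexLT (v w : Plane) : Prop := v 0 < w 0 ∨ (v 0 = w 0 ∧ v 1 < w 1)

theorem lexLT_irrefl (v : Plane) : ¬ LexLT v v := by simp [LexLT]

theorem lexLT_trichotomy {v w : Plane} (h : v ≠ w) :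
    (LexLT v w ∧ ¬ LexLT w v) ∨ (LexLT w v ∧ ¬ LexLT v w) := by
  have h' : ¬ (v 0 = w 0 ∧ v 1 = w 1) := fun hh => h (by
    ext i; fin_cases i; exacts [hh.1, hh.2])
  simp only [LexLT]
  grind

/-- The coefficient of the face `τ` in the simplicial boundary of the face `σ`, where the vertices
of every face are listed in lexicographic order: it is `(-1) ^ i` if `τ` arises from `σ` by deleting
the `i`-th vertex (counted from `0`), and zero if `τ` is not a facet of `σ`. -/
def incidence (σ τ : Finset Plane) : ℤ :=
  ∑ u ∈ σ, if σ.erase u = τ then (-1) ^ (σ.filter fun w => LexLT w u).card else 0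

namespace PlanarTriangulation

variable (Δ : PlanarTriangulation) (r d : ℕ)

/-- `J(γ)`, the sum of the ideals `J(τ)` over the interior edges `τ` containing `γ`. -/
def vertexIdeal (γ : Plane) : Ideal R :=
  ⨆ τ ∈ Δ.interiorEdges.filter fun τ => γ ∈ τ, edgeIdeal r τ

/-- The differential `∂₂` from triangles to interior edges of the complex `𝓡`. -/
def boundary₂ : (Δ.triangles → R) →ₗ[R] (Δ.interiorEdges → R) :=
  LinearMap.pi fun τ => ∑ σ : Δ.triangles,
    (incidence σ.1 τ.1) • (LinearMap.proj σ : (Δ.triangles → R) →ₗ[R] R)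

/-- The differential `∂₁` from interior edges to interior vertices of the complex `𝓡`. -/
def boundary₁ : (Δ.interiorEdges → R) →ₗ[R] (Δ.interiorVertices → R) :=
  LinearMap.pi fun γ => ∑ τ : Δ.interiorEdges,
    (incidence τ.1 {γ.1}) • (LinearMap.proj τ : (Δ.interiorEdges → R) →ₗ[R] R)

/-- The term `⨁ J(τ)` of the subcomplex `𝓙`. -/
def edgeSub : Submodule R (Δ.interiorEdges → R) :=
  Submodule.pi Set.univ fun τ => edgeIdeal r τ.1

/-- The term `⨁ J(γ)` of the subcomplex `𝓙`. -/
def vertexSub : Submodule R (Δ.interiorVertices → R) :=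
  Submodule.pi Set.univ fun γ => Δ.vertexIdeal r γ.1

theorem incidence_eq_zero_of_notMem {τ : Finset Plane} {γ : Plane} (h : γ ∉ τ) :
    incidence τ {γ} = 0 := by
  refine Finset.sum_eq_zero fun u _ => if_neg fun hu => h ?_
  exact Finset.mem_of_mem_erase (hu ▸ Finset.mem_singleton_self γ)

theorem edgeSub_le : Δ.edgeSub r ≤ (Δ.vertexSub r).comap Δ.boundary₁ := by
  intro c hc γ _
  simp only [boundary₁, LinearMap.pi_apply, LinearMap.sum_apply, LinearMap.smul_apply,
    LinearMap.proj_apply]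
  refine Submodule.sum_mem _ fun τ _ => ?_
  by_cases h : γ.1 ∈ τ.1
  · refine zsmul_mem ?_ _
    exact Submodule.mem_iSup_of_mem τ.1 (Submodule.mem_iSup_of_mem
      (Finset.mem_filter.2 ⟨τ.2, h⟩) (hc τ trivial))
  · rw [incidence_eq_zero_of_notMem h, zero_smul]
    exact Submodule.zero_mem _

/-- The differential of `𝓡/𝓙` from triangles to interior edges (`𝓙` is zero on triangles). -/
def quotBoundary₂ : (Δ.triangles → R) →ₗ[R] ((Δ.interiorEdges → R) ⧸ Δ.edgeSub r) :=
  (Δ.edgeSub r).mkQ ∘ₗ Δ.boundary₂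

/-- The differential of `𝓡/𝓙` from interior edges to interior vertices. -/
def quotBoundary₁ :
    ((Δ.interiorEdges → R) ⧸ Δ.edgeSub r) →ₗ[R] ((Δ.interiorVertices → R) ⧸ Δ.vertexSub r) :=
  Submodule.mapQ _ _ Δ.boundary₁ (Δ.edgeSub_le r)

/-- The homology module `H₁(𝓡/𝓙)`. -/
abbrev H1 : Type :=
  LinearMap.ker (Δ.quotBoundary₁ r) ⧸
    (LinearMap.range (Δ.quotBoundary₂ r)).submoduleOf (LinearMap.ker (Δ.quotBoundary₁ r))

/-- The degree `d` part of `⨁ R` over the interior edges. -/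
def edgeDegree : Submodule ℝ (Δ.interiorEdges → R) :=
  Submodule.pi Set.univ fun _ => MvPolynomial.homogeneousSubmodule (Fin 3) ℝ d

/-- The degree `d` part of `H₁(𝓡/𝓙)`: the homology classes of the cycles that are represented by
families of homogeneous polynomials of degree `d`. -/
def H1Degree : Submodule ℝ (Δ.H1 r) :=
  (((Δ.edgeDegree d).map ((Δ.edgeSub r).mkQ.restrictScalars ℝ)).comap
    ((LinearMap.ker (Δ.quotBoundary₁ r)).subtype.restrictScalars ℝ)).map
      (((LinearMap.range (Δ.quotBoundary₂ r)).submoduleOf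
        (LinearMap.ker (Δ.quotBoundary₁ r))).mkQ.restrictScalars ℝ)

/-- `m` is the regularity of `H₁(𝓡/𝓙)`: the module has finite length, and `m` is the largest degree
in which it is nonzero. -/
def HasRegularityH1 (m : ℕ) : Prop :=
  IsFiniteLength R (Δ.H1 r) ∧ IsGreatest {d | Δ.H1Degree r d ≠ ⊥} m

theorem mem_interiorEdges_of_mem {τ σ : Finset Plane} {γ : Plane} (hγ : γ ∈ Δ.interiorVertices)
    (hσ : σ ∈ Δ.triangles) (hτσ : τ ⊆ σ) (hτ : τ.card = 2) (hγτ : γ ∈ τ) :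
    τ ∈ Δ.interiorEdges := by
  have hσf : σ ∈ Δ.faces := by simpa using (Finset.mem_filter.1 hσ).1
  have hτe : τ ∈ Δ.edges := Finset.mem_filter.2 ⟨by
    simpa using Δ.toSimplicialComplex.down_closed hσf hτσ ⟨γ, hγτ⟩, hτ⟩
  refine Finset.mem_filter.2 ⟨hτe, ?_⟩
  by_contra hcon
  push Not at hcon
  refine (Finset.mem_filter.1 hγ).2 τ (Finset.mem_filter.2 ⟨hτe, σ, ⟨hσ, hτσ⟩, ?_⟩) hγτ
  rintro σ' ⟨hσ', hτσ'⟩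
  by_contra hne
  exact hcon σ hσ σ' hσ' (Ne.symm hne) hτσ hτσ'

theorem incidence_pair {a b : Plane} (h : a ≠ b) :
    incidence {a, b} {a} = if LexLT a b then -1 else 1 := by
  have h1 : ({a, b} : Finset Plane).erase b = {a} := by ext x; simp; grind
  have h2 : ({a, b} : Finset Plane).erase a ≠ {a} := by
    intro hh; have := hh ▸ Finset.mem_singleton_self a; simp at this
  rw [incidence, Finset.sum_pair h, if_neg h2, if_pos h1, zero_add, Finset.filter_insert,
    Finset.filter_singleton]
  split_ifs <;> simp_all [lexLT_irrefl]

theorem incidence_triple {a b c : Plane} (hab : a ≠ b) (hac : a ≠ c) (hbc : b ≠ c) :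
    incidence {a, b, c} {a, b} =
      (if LexLT a c then -1 else 1) * (if LexLT b c then -1 else 1) := by
  have h1 : ({a, b, c} : Finset Plane).erase c = {a, b} := by ext x; simp; grind
  have h2 : ({a, b, c} : Finset Plane).erase a ≠ {a, b} := by
    intro hh; have : a ∈ ({a, b} : Finset Plane) := by simp
    rw [← hh] at this; simp at this
  have h3 : ({a, b, c} : Finset Plane).erase b ≠ {a, b} := by
    intro hh; have : b ∈ ({a, b} : Finset Plane) := by simp
    rw [← hh] at this; simp at this
  rw [incidence, Finset.sum_insert (by simp [hab, hac]), Finset.sum_pair hbc, if_neg h2, if_neg h3,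
    if_pos h1, zero_add, zero_add, Finset.filter_insert, Finset.filter_insert,
    Finset.filter_singleton]
  split_ifs <;> simp_all [lexLT_irrefl]

theorem sum_incidence {σ : Finset Plane} {γ : Plane} (hσ : σ ∈ Δ.triangles)
    (hγ : γ ∈ Δ.interiorVertices) :
    ∑ τ ∈ Δ.interiorEdges, incidence τ {γ} * incidence σ τ = 0 := by
  by_cases hγσ : γ ∈ σ
  swap
  · refine Finset.sum_eq_zero fun τ _ => ?_
    by_cases hτ : γ ∈ τ
    · have : incidence σ τ = 0 := Finset.sum_eq_zero fun u _ => if_neg fun hu =>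
        hγσ (Finset.mem_of_mem_erase (hu ▸ hτ))
      rw [this, mul_zero]
    · rw [incidence_eq_zero_of_notMem hτ, zero_mul]
  have hcard : (σ.erase γ).card = 2 := by
    rw [Finset.card_erase_of_mem hγσ, (Finset.mem_filter.1 hσ).2]
  obtain ⟨a, b, hab, hσab⟩ := Finset.card_eq_two.1 hcard
  have hσe : σ = {γ, a, b} := by rw [← hσab, Finset.insert_erase hγσ]
  have hγa : γ ≠ a := by
    rintro rfl; have : γ ∈ σ.erase γ := by simp [hσab]
    simp at this
  have hγb : γ ≠ b := by
    rintro rfl; have : γ ∈ σ.erase γ := by simp [hσab]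
    simp at this
  have hne : ({γ, a} : Finset Plane) ≠ {γ, b} := by
    intro h; have : a ∈ ({γ, b} : Finset Plane) := by rw [← h]; simp
    simp [hab, hγa.symm] at this
  have hsub : ({{γ, a}, {γ, b}} : Finset (Finset Plane)) ⊆ Δ.interiorEdges := by
    intro τ hτ
    rcases Finset.mem_insert.1 hτ with rfl | hτ
    · exact Δ.mem_interiorEdges_of_mem hγ hσ (by rw [hσe]; intro x; simp; tauto)
        (Finset.card_pair hγa) (by simp)
    · rw [Finset.mem_singleton.1 hτ]
      exact Δ.mem_interiorEdges_of_mem hγ hσ (by rw [hσe]; intro x; simp; tauto)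
        (Finset.card_pair hγb) (by simp)
  rw [← Finset.sum_subset hsub]
  · have e1 := incidence_triple hγa hγb hab
    have e2 := incidence_triple hγb hγa hab.symm
    have hperm : ({γ, b, a} : Finset Plane) = {γ, a, b} := by rw [Finset.pair_comm]
    rw [hperm] at e2
    rw [Finset.sum_pair hne, hσe, e1, e2, incidence_pair hγa, incidence_pair hγb]
    rcases lexLT_trichotomy hab with h | h
    · rw [if_pos h.1, if_neg h.2]; ring
    · rw [if_pos h.1, if_neg h.2]; ring
  · intro τ hτ hτ'
    by_cases hγτ : γ ∈ τ
    · have : incidence σ τ = 0 := by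
        refine Finset.sum_eq_zero fun u hu => if_neg fun hu' => hτ' ?_
        subst hu'
        have huγ : u ≠ γ := by rintro rfl; simp at hγτ
        rw [hσe] at hu
        simp only [Finset.mem_insert, Finset.mem_singleton] at hu
        rcases hu with rfl | rfl | rfl
        · exact absurd rfl huγ
        · simp only [Finset.mem_insert, Finset.mem_singleton]
          right; rw [hσe]; ext x; simp; grind
        · simp only [Finset.mem_insert, Finset.mem_singleton]
          left; rw [hσe]; ext x; simp; grind
      rw [this, mul_zero]
    · rw [incidence_eq_zero_of_notMem hγτ, zero_mul]

/-- `𝓡` is a chain complex. -/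
theorem boundary₁_comp_boundary₂ : Δ.boundary₁ ∘ₗ Δ.boundary₂ = 0 := by
  refine LinearMap.ext fun c => funext fun γ => ?_
  simp only [boundary₁, boundary₂, LinearMap.comp_apply, LinearMap.pi_apply, LinearMap.sum_apply,
    LinearMap.smul_apply, LinearMap.proj_apply, LinearMap.zero_apply, Pi.zero_apply,
    Finset.smul_sum, smul_smul]
  rw [Finset.sum_comm]
  refine Finset.sum_eq_zero fun σ _ => ?_
  rw [← Finset.sum_smul,
    Finset.sum_coe_sort Δ.interiorEdges (fun τ => incidence τ {γ.1} * incidence σ.1 τ),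
    Δ.sum_incidence σ.2 γ.2, zero_smul]

/-- `𝓡/𝓙` is a chain complex. -/
theorem range_quotBoundary₂_le :
    LinearMap.range (Δ.quotBoundary₂ r) ≤ LinearMap.ker (Δ.quotBoundary₁ r) := by
  rintro _ ⟨c, rfl⟩
  have := LinearMap.congr_fun Δ.boundary₁_comp_boundary₂ c
  simp only [LinearMap.comp_apply, LinearMap.zero_apply] at this
  simp [quotBoundary₁, quotBoundary₂, this]

end PlanarTriangulation

end SplineTriangulation

end

section

open Polynomial

namespace SplineTriangulation

/-- The polynomials of degree less than `D` that vanish to order `D - n` at the point `i` of the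
projective line (`none` is the point at infinity). -/
noncomputable def jet (D : ℕ) : Option ℝ → ℕ → Submodule ℝ ℝ[X]
  | none, n => degreeLT ℝ (min n D)
  | some a, n => degreeLT ℝ D ⊓ (Ideal.span {(X - C a) ^ (D - n)}).restrictScalars ℝ

theorem mem_jet_some {D n : ℕ} {a : ℝ} {f : ℝ[X]} :
    f ∈ jet D (some a) n ↔ f ∈ degreeLT ℝ D ∧ (X - C a) ^ (D - n) ∣ f := by
  simp [jet, Ideal.mem_span_singleton]

theorem jet_le_degreeLT (D : ℕ) (i : Option ℝ) (n : ℕ) : jet D i n ≤ degreeLT ℝ D := by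
  cases i with
  | none => exact degreeLT_mono (min_le_right _ _)
  | some a => exact inf_le_left

theorem eq_zero_of_dvd_of_mem_degreeLT {D : ℕ} {a : ℝ} {f : ℝ[X]} (hf : f ∈ degreeLT ℝ D)
    (h : (X - C a) ^ D ∣ f) : f = 0 := by
  rw [mem_degreeLT] at hf
  refine eq_zero_of_dvd_of_degree_lt h ?_
  rwa [degree_pow, degree_X_sub_C, nsmul_eq_mul, mul_one]

theorem jet_zero {D : ℕ} {i : Option ℝ} {f : ℝ[X]} (hf : f ∈ jet D i 0) : f = 0 := by
  cases i with
  | none => simpa [jet, mem_degreeLT] using hf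
  | some a =>
    rw [mem_jet_some] at hf
    exact eq_zero_of_dvd_of_mem_degreeLT hf.1 hf.2

/-- The polarization operator at the point `i` of the projective line. -/
noncomputable def polar (D : ℕ) : Option ℝ → ℝ[X] →ₗ[ℝ] ℝ[X]
  | none => derivative
  | some a => (D : ℝ) • LinearMap.id - LinearMap.mulLeft ℝ (X - C a) ∘ₗ derivative

theorem polar_some (D : ℕ) (a : ℝ) (f : ℝ[X]) :
    polar D (some a) f = C (D : ℝ) * f - (X - C a) * derivative f := by
  simp [polar, smul_eq_C_mul]

theorem coeff_polar_some (D : ℕ) (a : ℝ) (f : ℝ[X]) (k : ℕ) :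
    (polar D (some a) f).coeff k = (D - k) * f.coeff k + a * (k + 1) * f.coeff (k + 1) := by
  rw [polar_some, sub_mul, coeff_sub, coeff_sub, coeff_C_mul, coeff_C_mul, coeff_derivative]
  cases k with
  | zero => simp
  | succ k => rw [coeff_X_mul, coeff_derivative]; push_cast; ring

theorem mem_degreeLT_iff_coeff {D : ℕ} {f : ℝ[X]} :
    f ∈ degreeLT ℝ D ↔ ∀ k, D ≤ k → f.coeff k = 0 := by
  rw [mem_degreeLT, degree_lt_iff_coeff_zero]

theorem polar_mem_degreeLT {D : ℕ} {i : Option ℝ} {f : ℝ[X]} (hf : f ∈ degreeLT ℝ (D + 1)) :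
    polar D i f ∈ degreeLT ℝ D := by
  rw [mem_degreeLT_iff_coeff] at hf ⊢
  intro k hk
  cases i with
  | none => simp [polar, coeff_derivative, hf (k + 1) (by omega)]
  | some a =>
    rw [coeff_polar_some, hf (k + 1) (by omega)]
    rcases hk.eq_or_lt with rfl | hk
    · simp
    · rw [hf k (by omega)]; simp

theorem dvd_derivative {a : ℝ} {k : ℕ} {f : ℝ[X]} (h : (X - C a) ^ k ∣ f) :
    (X - C a) ^ (k - 1) ∣ derivative f := by
  obtain ⟨g, rfl⟩ := h
  cases k with
  | zero => simp
  | succ k =>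
    rw [derivative_mul, derivative_X_sub_C_pow]
    refine dvd_add ?_ ?_
    · exact Dvd.intro (C ((k + 1 : ℕ) : ℝ) * g) (by push_cast; simp; ring)
    · exact Dvd.intro ((X - C a) * derivative g) (by simp; ring)

theorem polar_mem_jet_of_ne {D n : ℕ} {i j : Option ℝ} {f : ℝ[X]} (hij : i ≠ j)
    (hf : f ∈ jet (D + 1) j n) (hj : i = none ∨ j ≠ none) (hn : n ≤ D) : polar D i f ∈ jet D j n := by
  cases j with
  | none => simp_all
  | some b =>
    rw [mem_jet_some] at hf ⊢
    refine ⟨polar_mem_degreeLT hf.1, ?_⟩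
    have h1 : (X - C b) ^ (D - n) ∣ derivative f := by
      have := dvd_derivative hf.2
      rwa [show D + 1 - n - 1 = D - n by omega] at this
    have h2 : (X - C b) ^ (D - n) ∣ f := (pow_dvd_pow _ (by omega)).trans hf.2
    cases i with
    | none => exact h1
    | some a =>
      rw [polar_some]
      exact dvd_sub (h2.mul_left _) (h1.mul_left _)

theorem polar_mem_jet_self {D n : ℕ} {i : Option ℝ} {f : ℝ[X]} (hn : n ≤ D)
    (hf : f ∈ jet (D + 1) i (n + 1)) : polar D i f ∈ jet D i n := by
  cases i with
  | none =>
    rw [jet, mem_degreeLT_iff_coeff] at hf ⊢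
    intro k hk
    simp only [polar, coeff_derivative]
    rw [hf (k + 1) (by omega), zero_mul]
  | some a =>
    rw [mem_jet_some] at hf ⊢
    refine ⟨polar_mem_degreeLT hf.1, ?_⟩
    obtain ⟨g, hg⟩ := hf.2
    rw [show D + 1 - (n + 1) = D - n by omega] at hg
    rw [polar_some]
    refine dvd_sub (Dvd.dvd.mul_left ⟨g, hg⟩ _) ?_
    rcases Nat.eq_zero_or_pos (D - n) with h0 | h0
    · rw [h0]; simp
    · have := mul_dvd_mul_left (X - C a) (dvd_derivative (a := a) (k := D - n) ⟨g, hg⟩)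
      rwa [← pow_succ', Nat.sub_add_cancel h0] at this

theorem eq_zero_of_polar_eq_zero {D n : ℕ} {i j : Option ℝ} {f : ℝ[X]} (hij : i ≠ j)
    (hf : f ∈ jet (D + 1) j n) (hn : n ≤ D) (h : polar D i f = 0) : f = 0 := by
  have hroot : ∀ b, j = some b → (X - C b) ∣ f := by
    rintro b rfl
    rw [mem_jet_some] at hf
    exact (dvd_pow_self _ (by omega)).trans hf.2
  cases i with
  | none =>
    obtain ⟨b, rfl⟩ := Option.ne_none_iff_exists'.1 hij.symm
    have hc := eq_C_of_derivative_eq_zero (p := f) h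
    have := dvd_iff_isRoot.1 (hroot b rfl)
    rw [hc] at this ⊢
    simpa using this
  | some a =>
    by_contra hf0
    cases j with
    | none =>
      rw [jet, mem_degreeLT, min_eq_left (by omega)] at hf
      have h1 := congrArg (fun p => coeff p f.natDegree) h
      simp only [coeff_polar_some, coeff_zero, coeff_natDegree,
        coeff_eq_zero_of_natDegree_lt (Nat.lt_succ_self f.natDegree), mul_zero, add_zero,
        mul_eq_zero, leadingCoeff_eq_zero, hf0, or_false] at h1
      rw [degree_eq_natDegree hf0, Nat.cast_lt] at hf
      have : D = f.natDegree := by exact_mod_cast sub_eq_zero.1 h1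
      omega
    | some b =>
      obtain ⟨g, hg, hb⟩ := exists_eq_pow_rootMultiplicity_mul_and_not_dvd f hf0 b
      have hm : 0 < f.rootMultiplicity b :=
        (rootMultiplicity_pos hf0).2 (dvd_iff_isRoot.1 (hroot b rfl))
      obtain ⟨k, hk⟩ := Nat.exists_eq_succ_of_ne_zero hm.ne'
      rw [hk] at hg
      rw [polar_some, hg, derivative_mul, derivative_X_sub_C_pow] at h
      have h2 : (X - C b) ^ k * (C (D : ℝ) * (X - C b) * g -
          (X - C a) * (C ((k : ℝ) + 1) * g + (X - C b) * derivative g)) = 0 := by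
        rw [← h]; simp only [Nat.succ_eq_add_one, pow_succ, Nat.cast_add, Nat.cast_one,
          Nat.add_sub_cancel]; ring
      have h3 := (mul_eq_zero.1 h2).resolve_left (pow_ne_zero _ (X_sub_C_ne_zero b))
      have h4 := congrArg (eval b) h3
      simp only [eval_sub, eval_mul, eval_C, eval_X, sub_self, mul_zero, zero_mul, eval_add,
        add_zero, zero_sub, eval_zero, neg_eq_zero, mul_eq_zero] at h4
      rcases h4 with h4 | h4 | h4
      · exact hij (by rw [sub_eq_zero.1 h4])
      · have : (0 : ℝ) < (k : ℝ) + 1 := by positivity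
        exact this.ne' h4
      · exact hb (dvd_iff_isRoot.2 h4)

/-- Polynomials vanishing to high order at distinct points of the projective line are
independent. -/
theorem jet_independent (T : Finset (Option ℝ)) :
    ∀ (K D : ℕ) (n : Option ℝ → ℕ) (f : Option ℝ → ℝ[X]), (∑ i ∈ T, n i = K) → K ≤ D →
      (∀ i ∈ T, f i ∈ jet D i (n i)) → ∑ i ∈ T, f i = 0 → ∀ i ∈ T, f i = 0 := by
  intro K
  induction K with
  | zero =>
    intro D n f hK _ hf _ i hi
    have := hf i hi
    rw [Finset.sum_eq_zero_iff.1 hK i hi] at this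
    exact jet_zero this
  | succ K ih =>
    intro D n f hK hD hf hsum
    obtain ⟨D, rfl⟩ := Nat.exists_eq_succ_of_ne_zero (show D ≠ 0 by omega)
    simp only [Nat.succ_eq_add_one] at *
    have hle : ∀ i ∈ T, ∀ j ∈ T, i ≠ j → n i + n j ≤ K + 1 := by
      intro i hi j hj hij
      rw [← hK, ← Finset.sum_pair hij]
      exact Finset.sum_le_sum_of_subset (by
        intro x hx; simp only [Finset.mem_insert, Finset.mem_singleton] at hx
        rcases hx with rfl | rfl <;> assumption)
    have hle1 : ∀ i ∈ T, n i ≤ K + 1 := fun i hi => hK ▸ Finset.single_le_sum (f := n)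
      (fun _ _ => Nat.zero_le _) hi
    obtain ⟨i, hi, hni, hnone⟩ : ∃ i ∈ T, n i ≠ 0 ∧ (i = none ∨ ∀ j ∈ T, n j ≠ 0 → j ≠ none) := by
      by_cases h : none ∈ T ∧ n none ≠ 0
      · exact ⟨none, h.1, h.2, Or.inl rfl⟩
      · obtain ⟨i, hi, hni⟩ := Finset.exists_ne_zero_of_sum_ne_zero (show ∑ i ∈ T, n i ≠ 0 by omega)
        exact ⟨i, hi, hni, Or.inr fun j hj hnj hjn => h (by subst hjn; exact ⟨hj, hnj⟩)⟩
    have hz : ∀ j ∈ T, n j = 0 → f j = 0 := fun j hj h0 => jet_zero (h0 ▸ hf j hj)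
    have key : ∀ j ∈ T, polar D i (f j) = 0 := by
      refine ih D (Function.update n i (n i - 1)) (fun j => polar D i (f j)) ?_ (by omega) ?_ ?_
      · rw [Finset.sum_update_of_mem hi, ← Finset.erase_eq]
        have := Finset.add_sum_erase T n hi
        omega
      · intro j hj
        by_cases hji : j = i
        · subst hji
          rw [Function.update_self]
          have := hf j hj
          obtain ⟨m, hm⟩ := Nat.exists_eq_succ_of_ne_zero hni
          rw [hm] at this
          have := hle1 j hj
          exact polar_mem_jet_self (by omega) (by rw [hm, Nat.succ_eq_add_one, Nat.add_sub_cancel]; assumption)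
        · rw [Function.update_of_ne hji]
          by_cases h0 : n j = 0
          · rw [hz j hj h0, map_zero]; exact Submodule.zero_mem _
          · have := hle i hi j hj (Ne.symm hji)
            exact polar_mem_jet_of_ne (Ne.symm hji) (hf j hj)
              (hnone.imp id fun h => h j hj h0) (by omega)
      · rw [← map_sum, hsum, map_zero]
    have hne : ∀ j ∈ T, j ≠ i → f j = 0 := by
      intro j hj hji
      by_cases h0 : n j = 0
      · exact hz j hj h0
      · have := hle i hi j hj (Ne.symm hji)
        exact eq_zero_of_polar_eq_zero (Ne.symm hji) (hf j hj) (by omega) (key j hj)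
    intro j hj
    by_cases hji : j = i
    · subst hji
      rw [← hsum, Finset.sum_eq_single_of_mem j hj fun k hk hkj => hne k hk hkj]
    · exact hne j hj hji

theorem jet_mono {D : ℕ} {i : Option ℝ} {m n : ℕ} (h : m ≤ n) : jet D i m ≤ jet D i n := by
  cases i with
  | none => exact degreeLT_mono (min_le_min_right _ h)
  | some a =>
    intro f hf
    rw [mem_jet_some] at hf ⊢
    exact ⟨hf.1, (pow_dvd_pow _ (by omega)).trans hf.2⟩

/-- The `N`-th power of the linear form vanishing at the point `i` of the projective line. -/
noncomputable def pointPow (N : ℕ) : Option ℝ → ℝ[X]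
  | none => 1
  | some a => (X - C a) ^ N

theorem pointPow_ne_zero (N : ℕ) (i : Option ℝ) : pointPow N i ≠ 0 := by
  cases i with
  | none => exact one_ne_zero
  | some a => exact pow_ne_zero _ (X_sub_C_ne_zero a)

theorem pow_mul_mem_degreeLT {N n : ℕ} {a : ℝ} {q : ℝ[X]} (hq : q ∈ degreeLT ℝ n) :
    (X - C a) ^ N * q ∈ degreeLT ℝ (N + n) := by
  rw [mem_degreeLT] at hq ⊢
  rw [degree_mul, degree_pow, degree_X_sub_C, nsmul_eq_mul, mul_one, Nat.cast_add]
  exact WithBot.add_lt_add_left (WithBot.natCast_ne_bot N) hq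

theorem mem_jet_iff {N n : ℕ} {i : Option ℝ} {f : ℝ[X]} :
    f ∈ jet (N + n) i n ↔ ∃ q ∈ degreeLT ℝ n, f = pointPow N i * q := by
  cases i with
  | none => simp [jet, pointPow]
  | some a =>
    rw [mem_jet_some, Nat.add_sub_cancel]
    constructor
    · rintro ⟨h, q, rfl⟩
      refine ⟨q, ?_, rfl⟩
      by_cases hq : q = 0
      · rw [hq]; exact Submodule.zero_mem _
      rw [mem_degreeLT] at h ⊢
      rw [degree_mul, degree_pow, degree_X_sub_C, nsmul_eq_mul, mul_one, Nat.cast_add] at h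
      exact lt_of_add_lt_add_left h
    · rintro ⟨q, hq, rfl⟩
      exact ⟨pow_mul_mem_degreeLT hq, _, rfl⟩

/-- The map `(q i) ↦ ∑ i, ℓ_i ^ (D - n i) * q i`. -/
noncomputable def jetMap (T : Finset (Option ℝ)) (D : ℕ) (n : Option ℝ → ℕ) :
    ((i : T) → degreeLT ℝ (n i)) →ₗ[ℝ] ℝ[X] :=
  ∑ i : T, LinearMap.mulLeft ℝ (pointPow (D - n i) i.1) ∘ₗ (degreeLT ℝ (n i)).subtype ∘ₗ
    LinearMap.proj i

theorem jetMap_apply (T : Finset (Option ℝ)) (D : ℕ) (n : Option ℝ → ℕ)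
    (q : (i : T) → degreeLT ℝ (n i)) :
    jetMap T D n q = ∑ i : T, pointPow (D - n i) i.1 * (q i : ℝ[X]) := by
  simp [jetMap]

theorem finrank_degreeLT (n : ℕ) : Module.finrank ℝ (degreeLT ℝ n) = n := by
  rw [(degreeLTEquiv ℝ n).finrank_eq, Module.finrank_fin_fun]

instance (n : ℕ) : Module.Finite ℝ (degreeLT ℝ n) :=
  Module.Finite.equiv (degreeLTEquiv ℝ n).symm

theorem jetMap_injective {T : Finset (Option ℝ)} {D : ℕ} {n : Option ℝ → ℕ}
    (h : ∑ i ∈ T, n i ≤ D) : Function.Injective (jetMap T D n) := by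
  rw [← LinearMap.ker_eq_bot, LinearMap.ker_eq_bot']
  intro q hq
  rw [jetMap_apply] at hq
  have hn : ∀ i ∈ T, n i ≤ D := fun i hi =>
    (Finset.single_le_sum (f := n) (fun _ _ => Nat.zero_le _) hi).trans h
  have key := jet_independent T _ D n
    (fun i => if hi : i ∈ T then pointPow (D - n i) i * (q ⟨i, hi⟩ : ℝ[X]) else 0) rfl h ?_ ?_
  · funext i
    have := key i.1 i.2
    rw [dif_pos i.2] at this
    exact Subtype.ext ((mul_eq_zero.1 this).resolve_left (pointPow_ne_zero _ _))
  · intro i hi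
    have := hn i hi
    simp only [dif_pos hi]
    obtain ⟨N, rfl⟩ := Nat.exists_eq_add_of_le' this
    rw [Nat.add_sub_cancel]
    exact mem_jet_iff.2 ⟨_, (q ⟨i, hi⟩).2, rfl⟩
  · rw [← hq, ← Finset.sum_coe_sort T]
    exact Finset.sum_congr rfl fun i _ => by rw [dif_pos i.2]

theorem exists_le_sum_eq {ι : Type*} (T : Finset ι) (n : ι → ℕ) (D : ℕ) (h : D ≤ ∑ i ∈ T, n i) :
    ∃ m : ι → ℕ, (∀ i, m i ≤ n i) ∧ ∑ i ∈ T, m i = D := by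
  induction D with
  | zero => exact ⟨0, fun _ => Nat.zero_le _, by simp⟩
  | succ D ih =>
    obtain ⟨m, hm, hs⟩ := ih (by omega)
    obtain ⟨i, hi, hlt⟩ : ∃ i ∈ T, m i < n i := by
      by_contra! hcon
      have := Finset.sum_le_sum hcon
      omega
    refine ⟨Function.update m i (m i + 1), fun j => ?_, ?_⟩
    · by_cases hj : j = i
      · subst hj; simpa using hlt
      · simpa [hj] using hm j
    · rw [Finset.sum_update_of_mem hi, ← Finset.erase_eq]
      have := Finset.add_sum_erase T m hi
      omega

/-- Polynomials vanishing to given orders span as soon as the number of coefficients allows it. -/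
theorem exists_jet_sum_eq {T : Finset (Option ℝ)} {D : ℕ} {n : Option ℝ → ℕ}
    (h : D ≤ ∑ i ∈ T, n i) {p : ℝ[X]} (hp : p ∈ degreeLT ℝ D) :
    ∃ f : Option ℝ → ℝ[X], (∀ i ∈ T, f i ∈ jet D i (n i)) ∧ p = ∑ i ∈ T, f i := by
  obtain ⟨m, hm, hs⟩ := exists_le_sum_eq T n D h
  have hn : ∀ i ∈ T, m i ≤ D := fun i hi =>
    (Finset.single_le_sum (f := m) (fun _ _ => Nat.zero_le _) hi).trans hs.le
  have hmem : ∀ (i : T) (q : ℝ[X]), q ∈ degreeLT ℝ (m i) → pointPow (D - m i) i.1 * q ∈ jet D i (m i) := by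
    intro i q hq
    obtain ⟨N, hN⟩ := Nat.exists_eq_add_of_le' (hn i.1 i.2)
    have := (mem_jet_iff (N := N) (n := m i) (i := i)).2 ⟨q, hq, rfl⟩
    rwa [← hN, show N = D - m i by omega] at this
  have hrange : LinearMap.range (jetMap T D m) = degreeLT ℝ D := by
    apply Submodule.eq_of_le_of_finrank_eq
    · rintro _ ⟨q, rfl⟩
      rw [jetMap_apply]
      exact Submodule.sum_mem _ fun i _ => jet_le_degreeLT D i _ (hmem i _ (q i).2)
    · rw [LinearMap.finrank_range_of_inj (jetMap_injective hs.le), Module.finrank_pi_fintype,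
        finrank_degreeLT]
      simp only [finrank_degreeLT]
      rw [Finset.sum_coe_sort T m, hs]
  rw [← hrange] at hp
  obtain ⟨q, rfl⟩ := hp
  refine ⟨fun i => if hi : i ∈ T then pointPow (D - m i) i * (q ⟨i, hi⟩ : ℝ[X]) else 0, ?_, ?_⟩
  · intro i hi
    simp only [dif_pos hi]
    exact jet_mono (hm i) (hmem ⟨i, hi⟩ _ (q ⟨i, hi⟩).2)
  · rw [jetMap_apply, ← Finset.sum_coe_sort T]
    exact Finset.sum_congr rfl fun i _ => by rw [dif_pos i.2]

/-- The combinations `∑ i ∈ T, ℓ_i ^ N * q i` with `deg (q i) < n`. -/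
noncomputable def fan (N : ℕ) (T : Finset (Option ℝ)) (n : ℕ) : Submodule ℝ ℝ[X] :=
  LinearMap.range (jetMap T (N + n) fun _ => n)

theorem mem_fan {N n : ℕ} {T : Finset (Option ℝ)} {p : ℝ[X]} :
    p ∈ fan N T n ↔ ∃ q : Option ℝ → ℝ[X], (∀ i, q i ∈ degreeLT ℝ n) ∧
      p = ∑ i ∈ T, pointPow N i * q i := by
  constructor
  · rintro ⟨q, rfl⟩
    refine ⟨fun i => if hi : i ∈ T then q ⟨i, hi⟩ else 0, fun i => ?_, ?_⟩
    · by_cases hi : i ∈ T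
      · simp only [dif_pos hi]; exact (q ⟨i, hi⟩).2
      · simp only [dif_neg hi]; exact Submodule.zero_mem _
    · rw [jetMap_apply, ← Finset.sum_coe_sort T]
      exact Finset.sum_congr rfl fun i _ => by simp only [dif_pos i.2, Nat.add_sub_cancel]
  · rintro ⟨q, hq, rfl⟩
    refine ⟨fun i => ⟨q i, hq i⟩, ?_⟩
    rw [jetMap_apply, ← Finset.sum_coe_sort T, Nat.add_sub_cancel]

theorem finrank_fan (N : ℕ) (T : Finset (Option ℝ)) (n : ℕ) :
    Module.finrank ℝ (fan N T n) = min (N + n) (T.card * n) := by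
  have hsum : ∑ i ∈ T, (fun _ => n) i = T.card * n := by simp
  rcases le_total (T.card * n) (N + n) with h | h
  · rw [min_eq_right h, fan, LinearMap.finrank_range_of_inj (jetMap_injective (by rw [hsum]; exact h)),
      Module.finrank_pi_fintype]
    simp [finrank_degreeLT]
  · rw [min_eq_left h]
    have : fan N T n = degreeLT ℝ (N + n) := by
      refine le_antisymm ?_ fun p hp => ?_
      · intro p hp
        obtain ⟨q, hq, rfl⟩ := mem_fan.1 hp
        exact Submodule.sum_mem _ fun i _ => jet_le_degreeLT _ i n (mem_jet_iff.2 ⟨_, hq i, rfl⟩)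
      · obtain ⟨f, hf, rfl⟩ := exists_jet_sum_eq (n := fun _ => n) (by rw [hsum]; exact h) hp
        have h1 : ∀ i, ∃ q ∈ degreeLT ℝ n, i ∈ T → f i = pointPow N i * q := by
          intro i
          by_cases hi : i ∈ T
          · obtain ⟨q, hq, h⟩ := mem_jet_iff.1 (hf i hi)
            exact ⟨q, hq, fun _ => h⟩
          · exact ⟨0, Submodule.zero_mem _, fun h => absurd h hi⟩
        choose q hq hfq using h1
        exact mem_fan.2 ⟨q, hq, Finset.sum_congr rfl hfq⟩
    rw [this, finrank_degreeLT]

/-- The polynomials of degree at most `e` of the form `∑ a ∈ S, (X - a) ^ N * q a` with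
`deg (q a) ≤ e`. -/
noncomputable def colon (N : ℕ) (S : Finset ℝ) (e : ℕ) : Submodule ℝ ℝ[X] :=
  degreeLT ℝ (e + 1) ⊓ fan N (S.map Function.Embedding.some) (e + 1)

theorem mem_colon {N e : ℕ} {S : Finset ℝ} {p : ℝ[X]} :
    p ∈ colon N S e ↔ p ∈ degreeLT ℝ (e + 1) ∧ ∃ q : ℝ → ℝ[X], (∀ a, q a ∈ degreeLT ℝ (e + 1)) ∧
      p = ∑ a ∈ S, (X - C a) ^ N * q a := by
  rw [colon, Submodule.mem_inf, mem_fan]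
  refine and_congr_right fun _ => ?_
  constructor
  · rintro ⟨q, hq, rfl⟩
    exact ⟨fun a => q (some a), fun a => hq _, by simp [pointPow]⟩
  · rintro ⟨q, hq, rfl⟩
    refine ⟨fun i => i.elim 0 q, fun i => ?_, by simp [pointPow]⟩
    cases i with
    | none => exact Submodule.zero_mem _
    | some a => exact hq a

/-- A nonzero element of `colon N S e` has degree at least `N - (|S| - 1) * (e + 1)`. -/
theorem eq_zero_of_mem_colon {N e f : ℕ} {S : Finset ℝ} {p : ℝ[X]} (hp : p ∈ colon N S e)
    (hf : p ∈ degreeLT ℝ f) (h : S.card * (e + 1) + f ≤ N + (e + 1)) : p = 0 := by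
  obtain ⟨_, q, hq, hpq⟩ := mem_colon.1 hp
  have hno : none ∉ S.map Function.Embedding.some := by simp
  have hsum : ∑ i ∈ Finset.cons none _ hno, (fun i => i.elim f fun _ => e + 1 : Option ℝ → ℕ) i =
      f + S.card * (e + 1) := by simp
  have := jet_independent (Finset.cons none (S.map Function.Embedding.some) hno) _ (N + (e + 1))
    (fun i => i.elim f fun _ => e + 1) (fun i => i.elim (-p) fun a => (X - C a) ^ N * q a) hsum
    (by omega) ?_ ?_ none (by simp)
  · simpa using this
  · intro i _
    cases i with
    | none =>
      simp only [jet, Option.elim]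
      rw [min_eq_left (by omega)]
      exact Submodule.neg_mem _ hf
    | some a => exact mem_jet_iff.2 ⟨_, hq a, rfl⟩
  · rw [Finset.sum_cons, Finset.sum_map]
    simp only [Option.elim, Function.Embedding.some_apply]
    rw [← hpq, neg_add_cancel]

/-- Every degree from `N - (|S| - 1) * (e + 1)` to `e` is the degree of an element of
`colon N S e`. -/
theorem exists_monic_mem_colon {N e f : ℕ} {S : Finset ℝ} (hfe : f ≤ e)
    (h : N + (e + 1) ≤ S.card * (e + 1) + f) : ∃ p ∈ colon N S e, p.Monic ∧ p.natDegree = f := by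
  have hno : none ∉ S.map Function.Embedding.some := by simp
  have hsum : ∑ i ∈ Finset.cons none _ hno, (fun i => i.elim f fun _ => e + 1 : Option ℝ → ℕ) i =
      f + S.card * (e + 1) := by simp
  have hX : (X ^ f : ℝ[X]) ∈ degreeLT ℝ (N + (e + 1)) := by
    rw [mem_degreeLT, degree_X_pow, Nat.cast_lt]; omega
  obtain ⟨g, hg, hgs⟩ := exists_jet_sum_eq (T := Finset.cons none _ hno)
    (n := fun i => i.elim f fun _ => e + 1) (le_of_le_of_eq (by omega) hsum.symm) hX
  have h1 : ∀ a, ∃ q ∈ degreeLT ℝ (e + 1), a ∈ S → g (some a) = (X - C a) ^ N * q := by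
    intro a
    by_cases ha : a ∈ S
    · obtain ⟨q, hq, h⟩ := mem_jet_iff.1 (hg (some a) (by simpa using ha))
      exact ⟨q, hq, fun _ => h⟩
    · exact ⟨0, Submodule.zero_mem _, fun h => absurd h ha⟩
  choose q hq hgq using h1
  have hg0 : g none ∈ degreeLT ℝ f := by
    have := hg none (by simp)
    rw [jet] at this
    exact degreeLT_mono (min_le_left _ _) this
  rw [Finset.sum_cons, Finset.sum_map] at hgs
  have hs : X ^ f - g none = ∑ a ∈ S, (X - C a) ^ N * q a := by
    rw [hgs, add_sub_cancel_left]
    exact Finset.sum_congr rfl fun a ha => hgq a ha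
  rw [mem_degreeLT] at hg0
  have hdeg : (X ^ f - g none).degree = (f : WithBot ℕ) := by
    rw [degree_sub_eq_left_of_degree_lt (by rwa [degree_X_pow]), degree_X_pow]
  refine ⟨X ^ f - g none, mem_colon.2 ⟨?_, q, hq, hs⟩, ?_, natDegree_eq_of_degree_eq_some hdeg⟩
  · rw [mem_degreeLT, hdeg, Nat.cast_lt]; omega
  · exact (monic_X_pow f).sub_of_left (by rwa [degree_X_pow])

end SplineTriangulation

end

section

open Polynomial
open scoped Polynomial.Bivariate

namespace SplineTriangulation

theorem coeff_coeff_swap (f : ℝ[X][Y]) (i j : ℕ) :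
    ((Bivariate.swap f).coeff i).coeff j = (f.coeff j).coeff i := by
  induction f using Polynomial.induction_on' with
  | add p q hp hq => simp [hp, hq]
  | monomial n p =>
    induction p using Polynomial.induction_on' with
    | add p q hp hq => simp only [map_add, coeff_add, hp, hq]
    | monomial m c =>
      rw [Bivariate.swap_monomial_monomial]
      simp only [coeff_monomial]
      by_cases hm : m = i <;> by_cases hn : n = j <;> simp [hm, hn, coeff_monomial]

/-- The bivariate polynomials of total degree at most `d`. -/
def bidegLE (d : ℕ) : Submodule ℝ ℝ[X][Y] where
  carrier := {f | ∀ i j, d < i + j → (f.coeff j).coeff i = 0}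
  zero_mem' := by simp
  add_mem' := by
    intro f g hf hg i j h
    simp [hf i j h, hg i j h]
  smul_mem' := by
    intro c f hf i j h
    simp [hf i j h]

theorem mem_bidegLE {d : ℕ} {f : ℝ[X][Y]} :
    f ∈ bidegLE d ↔ ∀ i j, d < i + j → (f.coeff j).coeff i = 0 := Iff.rfl

theorem swap_mem_bidegLE {d : ℕ} {f : ℝ[X][Y]} : Bivariate.swap f ∈ bidegLE d ↔ f ∈ bidegLE d := by
  simp only [mem_bidegLE, coeff_coeff_swap]
  exact ⟨fun h i j hij => h j i (by omega), fun h i j hij => h j i (by omega)⟩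

theorem coeff_mem_degreeLT {d j : ℕ} {f : ℝ[X][Y]} (hf : f ∈ bidegLE d) (hj : j ≤ d) :
    f.coeff j ∈ degreeLT ℝ (d - j + 1) := by
  rw [mem_degreeLT_iff_coeff]
  exact fun i hi => hf i j (by omega)

theorem coeff_eq_zero_of_mem_bidegLE {d j : ℕ} {f : ℝ[X][Y]} (hf : f ∈ bidegLE d) (hj : d < j) :
    f.coeff j = 0 := by
  ext i
  exact hf i j (by omega)

/-- The polynomial `p(x) q(y)`. -/
noncomputable def sep (p q : ℝ[X]) : ℝ[X][Y] := C p * q.map C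

theorem coeff_coeff_sep (p q : ℝ[X]) (i j : ℕ) :
    ((sep p q).coeff j).coeff i = p.coeff i * q.coeff j := by
  simp [sep]

theorem swap_sep (p q : ℝ[X]) : Bivariate.swap (sep p q) = sep q p := by
  simp only [sep, map_mul, Bivariate.swap_C, Bivariate.swap_map_C, mul_comm]

theorem sep_mem_bidegLE {m n d : ℕ} {p q : ℝ[X]} (hp : p ∈ degreeLT ℝ (m + 1))
    (hq : q ∈ degreeLT ℝ (n + 1)) (h : m + n ≤ d) : sep p q ∈ bidegLE d := by
  rw [mem_degreeLT_iff_coeff] at hp hq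
  intro i j hij
  rw [coeff_coeff_sep]
  rcases Nat.lt_or_ge m i with hi | hi
  · rw [hp i hi, zero_mul]
  · rw [hq j (by omega), mul_zero]

/-- The polynomials `∑ a ∈ S, (x - a) ^ N * q a` of total degree at most `e`, with `q a` of total
degree at most `e`. -/
def bicolon (N : ℕ) (S : Finset ℝ) (e : ℕ) : Submodule ℝ ℝ[X][Y] where
  carrier := {f | f ∈ bidegLE e ∧ ∃ q : ℝ → ℝ[X][Y], (∀ a, q a ∈ bidegLE e) ∧
    f = ∑ a ∈ S, C ((X - C a) ^ N) * q a}
  zero_mem' := ⟨Submodule.zero_mem _, 0, fun _ => Submodule.zero_mem _, by simp⟩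
  add_mem' := by
    rintro f g ⟨hf, p, hp, rfl⟩ ⟨hg, q, hq, rfl⟩
    exact ⟨Submodule.add_mem _ hf hg, p + q, fun a => Submodule.add_mem _ (hp a) (hq a), by
      simp [mul_add, Finset.sum_add_distrib]⟩
  smul_mem' := by
    rintro c f ⟨hf, p, hp, rfl⟩
    exact ⟨Submodule.smul_mem _ _ hf, c • p, fun a => Submodule.smul_mem _ _ (hp a), by
      simp [Finset.smul_sum]⟩

theorem coeff_mem_colon {N e j : ℕ} {S : Finset ℝ} {f : ℝ[X][Y]} (hf : f ∈ bicolon N S e)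
    (hj : j ≤ e) : f.coeff j ∈ colon N S (e - j) := by
  obtain ⟨hf, q, hq, rfl⟩ := hf
  refine mem_colon.2 ⟨coeff_mem_degreeLT hf hj, fun a => (q a).coeff j,
    fun a => coeff_mem_degreeLT (hq a) hj, ?_⟩
  rw [finsetSum_coeff]
  exact Finset.sum_congr rfl fun a _ => by rw [coeff_C_mul]

theorem sep_mem_bicolon {N e i j : ℕ} {S : Finset ℝ} {p q : ℝ[X]} (hp : p ∈ colon N S i)
    (hq : q ∈ degreeLT ℝ (j + 1)) (h : i + j ≤ e) : sep p q ∈ bicolon N S e := by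
  obtain ⟨hp, g, hg, hs⟩ := mem_colon.1 hp
  refine ⟨sep_mem_bidegLE hp hq h, fun a => sep (g a) q, fun a => sep_mem_bidegLE (hg a) hq h, ?_⟩
  rw [hs]
  simp only [sep, map_sum, Finset.sum_mul, map_mul, mul_assoc]

/-- The polynomials in `x` and `y` spanned by the two families of `N`-th powers, in the directions
`x` and `y`, of total degree at most `e`. -/
noncomputable def bicolonSum (N : ℕ) (S T : Finset ℝ) (e : ℕ) : Submodule ℝ ℝ[X][Y] :=
  bicolon N S e ⊔ (bicolon N T e).comap Bivariate.swap.toLinearMap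

theorem exists_eq_sum_of_monic {u : ℕ → ℝ[X]} (hm : ∀ i, (u i).Monic)
    (hd : ∀ i, (u i).natDegree = i) (m : ℕ) :
    ∀ p ∈ degreeLT ℝ m, ∃ c : ℕ → ℝ, p = ∑ i ∈ Finset.range m, c i • u i := by
  induction m with
  | zero =>
    intro p hp
    exact ⟨0, by simpa [mem_degreeLT] using hp⟩
  | succ m ih =>
    intro p hp
    have h : p - p.coeff m • u m ∈ degreeLT ℝ m := by
      rw [mem_degreeLT_iff_coeff] at hp ⊢
      intro k hk
      rcases hk.eq_or_lt with rfl | hk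
      · have := (hm m).coeff_natDegree
        rw [hd] at this
        simp [this]
      · rw [coeff_sub, coeff_smul, hp k hk,
          coeff_eq_zero_of_natDegree_lt (by rw [hd m]; exact hk : (u m).natDegree < k)]
        simp
    obtain ⟨c, hc⟩ := ih _ h
    refine ⟨Function.update c m (p.coeff m), ?_⟩
    rw [Finset.sum_range_succ, Function.update_self, ← sub_eq_iff_eq_add, hc]
    refine Finset.sum_congr rfl fun i hi => ?_
    rw [Function.update_of_ne (Finset.mem_range.1 hi).ne]

theorem exists_monic_forall_mem_colon {N s A ρ δ : ℕ} {S : Finset ℝ} (hS : S.card = s)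
    (hs : 2 ≤ s) (hN : N = s * A + ρ) (hρ : ρ < s) (hδ : ρ = s - 1 → δ = 1) (i : ℕ) :
    ∃ p : ℝ[X], p.Monic ∧ p.natDegree = i ∧
      (A ≤ i → p ∈ colon N S i) ∧ (i < A → p ∈ colon N S (2 * A - i - 1 + δ)) := by
  rcases Nat.lt_or_ge i A with hi | hi
  · obtain ⟨k, rfl⟩ := Nat.exists_eq_add_of_lt hi
    obtain ⟨p, hp, hm, hd⟩ := exists_monic_mem_colon (N := N)
      (e := 2 * (i + k + 1) - i - 1 + δ) (f := i) (S := S) (by omega) (by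
        rw [hS, hN, show 2 * (i + k + 1) - i - 1 + δ + 1 = (i + k + 1) + (k + 1 + δ) by omega,
          Nat.mul_add s (i + k + 1) (k + 1 + δ)]
        have : (k + 1 + δ) + ρ + (k + 1) ≤ s * (k + 1 + δ) := by
          obtain ⟨s, rfl⟩ := Nat.exists_eq_add_of_le hs
          rcases Nat.lt_or_ge ρ (1 + s) with h | h
          · have := Nat.zero_le (s * (k + δ))
            have := Nat.zero_le (s * δ)
            nlinarith
          · have hd := hδ (by omega)
            subst hd
            nlinarith
        omega)
    exact ⟨p, hm, hd, fun h => by omega, fun _ => hp⟩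
  · obtain ⟨p, hp, hm, hd⟩ := exists_monic_mem_colon (N := N) (e := i) (f := i) (S := S) le_rfl (by
        rw [hS, hN]
        have := Nat.mul_le_mul_left s hi
        rw [mul_add]; omega)
    exact ⟨p, hm, hd, fun _ => hp, fun h => by omega⟩

theorem mem_degreeLT_of_natDegree {p : ℝ[X]} {i : ℕ} (h : p.natDegree = i) :
    p ∈ degreeLT ℝ (i + 1) := by
  rw [mem_degreeLT]
  exact (degree_le_natDegree).trans_lt (by rw [h]; exact_mod_cast Nat.lt_succ_self i)

theorem eq_sum_sep (f : ℝ[X][Y]) :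
    f = ∑ j ∈ f.support, ∑ i ∈ (f.coeff j).support, (f.coeff j).coeff i • sep (X ^ i) (X ^ j) := by
  conv_lhs => rw [f.as_sum_support_C_mul_X_pow]
  refine Finset.sum_congr rfl fun j _ => ?_
  conv_lhs => rw [(f.coeff j).as_sum_support_C_mul_X_pow]
  rw [map_sum, Finset.sum_mul]
  refine Finset.sum_congr rfl fun i _ => ?_
  rw [sep, Polynomial.map_pow, map_X, C_mul, mul_assoc, ← smul_eq_C_mul]
  exact algebraMap_smul ℝ[X] _ _

/-- The two families of powers span all bivariate polynomials of large degree. -/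
theorem bidegLE_le_bicolonSum {N s t A B ρ ρ' δ δ' e : ℕ} {S T : Finset ℝ}
    (hS : S.card = s) (hs : 2 ≤ s) (hN : N = s * A + ρ) (hρ : ρ < s) (hδ : ρ = s - 1 → δ = 1)
    (hT : T.card = t) (ht : 2 ≤ t) (hN' : N = t * B + ρ') (hρ' : ρ' < t)
    (hδ' : ρ' = t - 1 → δ' = 1) (he : 2 * (A + B) + δ + δ' < 2 * e + 4) :
    bidegLE e ≤ bicolonSum N S T e := by
  choose u hum hud hu1 hu2 using exists_monic_forall_mem_colon hS hs hN hρ hδ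
  choose w hwm hwd hw1 hw2 using exists_monic_forall_mem_colon hT ht hN' hρ' hδ'
  have key : ∀ i j, i + j ≤ e → sep (u i) (w j) ∈ bicolonSum N S T e := by
    intro i j hij
    have hX : ∀ k, k + j ≤ e → u i ∈ colon N S k → sep (u i) (w j) ∈ bicolonSum N S T e :=
      fun k hk hu => Submodule.mem_sup_left
        (sep_mem_bicolon hu (mem_degreeLT_of_natDegree (hwd j)) hk)
    have hY : ∀ k, k + i ≤ e → w j ∈ colon N T k → sep (u i) (w j) ∈ bicolonSum N S T e := by
      intro k hk hw
      refine Submodule.mem_sup_right ?_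
      rw [Submodule.mem_comap, AlgEquiv.toLinearMap_apply, swap_sep]
      exact sep_mem_bicolon hw (mem_degreeLT_of_natDegree (hud i)) hk
    rcases Nat.lt_or_ge i A with hi | hi
    · rcases Nat.lt_or_ge j B with hj | hj
      · by_cases h : 2 * A - i - 1 + δ + j ≤ e
        · exact hX _ h (hu2 i hi)
        · exact hY _ (by omega) (hw2 j hj)
      · exact hY j (by omega) (hw1 j hj)
    · exact hX i hij (hu1 i hi)
  intro f hf
  rw [eq_sum_sep f]
  refine Submodule.sum_mem _ fun j _ => Submodule.sum_mem _ fun i hi => Submodule.smul_mem _ _ ?_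
  have hij : i + j ≤ e := by
    by_contra hcon
    exact mem_support_iff.1 hi (hf i j (by omega))
  obtain ⟨c, hc⟩ := exists_eq_sum_of_monic hum hud (i + 1) (X ^ i)
    (mem_degreeLT_of_natDegree (natDegree_X_pow i))
  obtain ⟨c', hc'⟩ := exists_eq_sum_of_monic hwm hwd (j + 1) (X ^ j)
    (mem_degreeLT_of_natDegree (natDegree_X_pow j))
  have : sep (X ^ i) (X ^ j) = ∑ i' ∈ Finset.range (i + 1), ∑ j' ∈ Finset.range (j + 1),
      (c i' * c' j') • sep (u i') (w j') := by
    ext n m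
    simp only [coeff_coeff_sep, finsetSum_coeff, coeff_smul, smul_eq_mul]
    rw [hc, hc', finsetSum_coeff, finsetSum_coeff, Finset.sum_mul_sum]
    refine Finset.sum_congr rfl fun i' _ => Finset.sum_congr rfl fun j' _ => ?_
    simp only [coeff_smul, smul_eq_mul]; ring
  rw [this]
  refine Submodule.sum_mem _ fun i' hi' => Submodule.sum_mem _ fun j' hj' =>
    Submodule.smul_mem _ _ (key i' j' ?_)
  rw [Finset.mem_range] at hi' hj'
  omega

theorem colon_eq_zero {N s A ρ e : ℕ} {S : Finset ℝ} (hS : S.card = s) (hN : N = s * A + ρ)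
    (he : e < A) {p : ℝ[X]} (hp : p ∈ colon N S e) : p = 0 := by
  refine eq_zero_of_mem_colon hp (mem_colon.1 hp).1 ?_
  have := Nat.mul_le_mul_left s (show e + 1 ≤ A by omega)
  rw [hS]; omega

theorem exists_coeff_relation {N s A ρ : ℕ} {S : Finset ℝ} (hS : S.card = s)
    (hN : N = s * A + ρ) (hρ : ρ = s - 1) (hs : 2 ≤ s) :
    ∃ c : ℝ, ∀ p ∈ colon N S A, p.coeff (A - 1) = c * p.coeff A := by
  obtain ⟨g, hg, hm, hd⟩ := exists_monic_mem_colon (N := N) (e := A) (f := A) (S := S) le_rfl (by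
    rw [hS, hN, mul_add]; omega)
  refine ⟨g.coeff (A - 1), fun p hp => ?_⟩
  have hgA : g.coeff A = 1 := by rw [← hd]; exact hm.coeff_natDegree
  have h0 : p - p.coeff A • g = 0 := by
    refine eq_zero_of_mem_colon (Submodule.sub_mem _ hp (Submodule.smul_mem _ _ hg)) (f := A) ?_ ?_
    · rw [mem_degreeLT_iff_coeff]
      intro k hk
      rcases hk.eq_or_lt with rfl | hk
      · simp [hgA]
      · have h1 := mem_degreeLT_iff_coeff.1 (mem_colon.1 hp).1 k hk
        have h2 := mem_degreeLT_iff_coeff.1 (mem_colon.1 hg).1 k hk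
        simp [h1, h2]
    · rw [hS, hN, mul_add]; omega
  have := congrArg (fun q => q.coeff (A - 1)) h0
  simp only [coeff_sub, coeff_smul, smul_eq_mul, coeff_zero] at this
  linarith

theorem coeff_eq_zero_of_mem_bicolon {N s A ρ e i j : ℕ} {S : Finset ℝ} {f : ℝ[X][Y]}
    (hS : S.card = s) (hN : N = s * A + ρ) (hf : f ∈ bicolon N S e) (he : e < A + j) :
    (f.coeff j).coeff i = 0 := by
  rcases Nat.lt_or_ge e j with h | h
  · rw [coeff_eq_zero_of_mem_bidegLE hf.1 h, coeff_zero]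
  · rw [colon_eq_zero hS hN (by omega) (coeff_mem_colon hf h), coeff_zero]

/-- The two families of powers do not span the polynomials of degree `A + B - 2`. -/
theorem not_bidegLE_le_bicolonSum {N s t A B ρ ρ' : ℕ} {S T : Finset ℝ}
    (hS : S.card = s) (hN : N = s * A + ρ) (hA : 1 ≤ A)
    (hT : T.card = t) (hN' : N = t * B + ρ') (hB : 1 ≤ B) :
    ¬ bidegLE (A + B - 2) ≤ bicolonSum N S T (A + B - 2) := by
  intro h
  have hx : sep (X ^ (A - 1)) (X ^ (B - 1)) ∈ bidegLE (A + B - 2) :=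
    sep_mem_bidegLE (mem_degreeLT_of_natDegree (natDegree_X_pow _))
      (mem_degreeLT_of_natDegree (natDegree_X_pow _)) (by omega)
  obtain ⟨f, hf, g, hg, hfg⟩ := Submodule.mem_sup.1 (h hx)
  rw [Submodule.mem_comap, AlgEquiv.toLinearMap_apply] at hg
  have h1 := congrArg (fun q => (q.coeff (B - 1)).coeff (A - 1)) hfg
  simp only [coeff_add, coeff_coeff_sep, coeff_X_pow_self] at h1
  rw [coeff_eq_zero_of_mem_bicolon hS hN hf (by omega), ← coeff_coeff_swap,
    coeff_eq_zero_of_mem_bicolon hT hN' hg (by omega)] at h1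
  norm_num at h1

/-- The two families of powers do not span the polynomials of degree `A + B - 1` if both remainders
are maximal. -/
theorem not_bidegLE_le_bicolonSum_of_remainder {N s t A B ρ ρ' : ℕ} {S T : Finset ℝ}
    (hS : S.card = s) (hs : 2 ≤ s) (hN : N = s * A + ρ) (hρ : ρ = s - 1) (hA : 1 ≤ A)
    (hT : T.card = t) (ht : 2 ≤ t) (hN' : N = t * B + ρ') (hρ' : ρ' = t - 1) (hB : 1 ≤ B) :
    ¬ bidegLE (A + B - 1) ≤ bicolonSum N S T (A + B - 1) := by
  intro h
  obtain ⟨c, hc⟩ := exists_coeff_relation hS hN hρ hs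
  obtain ⟨c', hc'⟩ := exists_coeff_relation hT hN' hρ' ht
  have hx : sep (X ^ (A - 1)) (X ^ (B - 1)) ∈ bidegLE (A + B - 1) :=
    sep_mem_bidegLE (mem_degreeLT_of_natDegree (natDegree_X_pow _))
      (mem_degreeLT_of_natDegree (natDegree_X_pow _)) (by omega)
  obtain ⟨f, hf, g, hg, hfg⟩ := Submodule.mem_sup.1 (h hx)
  rw [Submodule.mem_comap, AlgEquiv.toLinearMap_apply] at hg
  have h1 := congrArg (fun q => (q.coeff (B - 1)).coeff (A - 1) - c * (q.coeff (B - 1)).coeff A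
    - c' * (q.coeff B).coeff (A - 1)) hfg
  have hf1 := coeff_mem_colon (j := B - 1) hf (by omega)
  have hg1 := coeff_mem_colon (j := A - 1) hg (by omega)
  rw [show A + B - 1 - (B - 1) = A by omega] at hf1
  rw [show A + B - 1 - (A - 1) = B by omega] at hg1
  have hf2 := hc _ hf1
  have hg2 := hc' _ hg1
  rw [coeff_coeff_swap, coeff_coeff_swap] at hg2
  have hf3 : (f.coeff B).coeff (A - 1) = 0 := coeff_eq_zero_of_mem_bicolon hS hN hf (by omega)
  have hg3 : (g.coeff (B - 1)).coeff A = 0 := by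
    rw [← coeff_coeff_swap]
    exact coeff_eq_zero_of_mem_bicolon hT hN' hg (by omega)
  simp only [coeff_add, coeff_coeff_sep, coeff_X_pow, if_true, hf2, hg2, hf3, hg3] at h1
  rw [if_neg (by omega : ¬ A = A - 1), if_neg (by omega : ¬ B = B - 1)] at h1
  ring_nf at h1
  norm_num at h1

end SplineTriangulation

end

section

open Polynomial
open scoped Polynomial.Bivariate

namespace SplineTriangulation

theorem mul_mem_bidegLE {d e : ℕ} {f g : ℝ[X][Y]} (hf : f ∈ bidegLE d) (hg : g ∈ bidegLE e) :
    f * g ∈ bidegLE (d + e) := by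
  intro i j hij
  rw [coeff_mul, finsetSum_coeff]
  refine Finset.sum_eq_zero fun p hp => ?_
  rw [coeff_mul]
  refine Finset.sum_eq_zero fun q hq => ?_
  rw [Finset.HasAntidiagonal.mem_antidiagonal] at hp hq
  rcases Nat.lt_or_ge d (q.1 + p.1) with h | h
  · rw [hf _ _ h, zero_mul]
  · rw [hg q.2 p.2 (by omega), mul_zero]

theorem one_mem_bidegLE (d : ℕ) : (1 : ℝ[X][Y]) ∈ bidegLE d := by
  intro i j hij
  rw [coeff_one]
  split_ifs with h
  · rw [coeff_one, if_neg (by omega)]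
  · simp

/-- The linear form with coefficients `c`. -/
noncomputable def linForm (c : Fin 3 → ℝ) : R := ∑ i, c i • MvPolynomial.X i

theorem linForm_isHomogeneous (c : Fin 3 → ℝ) : (linForm c).IsHomogeneous 1 :=
  MvPolynomial.IsHomogeneous.sum _ _ _ fun i _ => by
    rw [MvPolynomial.smul_eq_C_mul]
    simpa using (MvPolynomial.isHomogeneous_C (Fin 3) (c i)).mul (MvPolynomial.isHomogeneous_X ℝ i)

theorem eval_linForm (c p : Fin 3 → ℝ) : MvPolynomial.eval p (linForm c) = ∑ i, c i * p i := by
  simp [linForm, MvPolynomial.smul_eval]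

/-- Dehomogenization with respect to the last coordinate of the coordinate system in which
`X i = ∑ k, M i k * λ k`. -/
noncomputable def chart (M : Matrix (Fin 3) (Fin 3) ℝ) : R →ₐ[ℝ] ℝ[X][Y] :=
  MvPolynomial.aeval fun i => sep (C (M i 0) * X + C (M i 2)) 1 + sep (C (M i 1)) X

theorem chart_X (M : Matrix (Fin 3) (Fin 3) ℝ) (i : Fin 3) :
    chart M (MvPolynomial.X i) = sep (C (M i 0) * X + C (M i 2)) 1 + sep (C (M i 1)) X := by
  simp [chart]

theorem sep_one_one : sep 1 1 = 1 := by simp [sep]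

theorem swap_chart (M : Matrix (Fin 3) (Fin 3) ℝ) (f : R) :
    Bivariate.swap (chart M f) = chart (M.submatrix id (Equiv.swap 0 1)) f := by
  have : (Bivariate.swap (R := ℝ)).toAlgHom.comp (chart M) =
      chart (M.submatrix id (Equiv.swap 0 1)) := by
    apply MvPolynomial.algHom_ext
    intro i
    change Bivariate.swap (chart M (MvPolynomial.X i)) = _
    simp only [chart_X, map_add, Matrix.submatrix_apply, id,
      Equiv.swap_apply_left, Equiv.swap_apply_right, swap_sep, Equiv.swap_apply_of_ne_of_ne (show (2 : Fin 3) ≠ 0 by decide)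
      (show (2 : Fin 3) ≠ 1 by decide)]
    simp only [sep, Polynomial.map_add, Polynomial.map_mul, Polynomial.map_one, map_X, map_add,
      map_mul, Polynomial.map_C, map_one]
    ring
  exact congrArg (fun φ => φ f) this

theorem chart_mem_bidegLE {M : Matrix (Fin 3) (Fin 3) ℝ} {d : ℕ} {f : R}
    (hf : f.IsHomogeneous d) : chart M f ∈ bidegLE d := by
  have hX : ∀ i, chart M (MvPolynomial.X i) ∈ bidegLE 1 := by
    intro i
    rw [chart_X]
    refine Submodule.add_mem _ (sep_mem_bidegLE (m := 1) (n := 0) ?_ ?_ le_rfl)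
      (sep_mem_bidegLE (m := 0) (n := 1) ?_ ?_ le_rfl)
    · rw [mem_degreeLT]
      exact (degree_linear_le).trans_lt (by norm_num)
    · rw [mem_degreeLT]; exact degree_one_le.trans_lt (by norm_num)
    · rw [mem_degreeLT]; exact degree_C_le.trans_lt (by norm_num)
    · rw [mem_degreeLT]; exact degree_X_le.trans_lt (by norm_num)
  have hpow : ∀ i k, chart M (MvPolynomial.X i) ^ k ∈ bidegLE k := by
    intro i k
    induction k with
    | zero => rw [pow_zero]; exact one_mem_bidegLE 0
    | succ k ih => rw [pow_succ]; exact mul_mem_bidegLE ih (hX i)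
  rw [f.as_sum, map_sum]
  refine Submodule.sum_mem _ fun m hm => ?_
  have hd := hf (MvPolynomial.mem_support_iff.1 hm)
  rw [MvPolynomial.monomial_eq, Finsupp.prod_fintype _ _ (by simp), Fin.prod_univ_three, map_mul,
    ← MvPolynomial.algebraMap_eq, AlgHom.commutes, ← Algebra.smul_def, map_mul, map_mul, map_pow,
    map_pow, map_pow]
  refine Submodule.smul_mem _ _ ?_
  have : d = m 0 + m 1 + m 2 := by
    rw [← hd, Finsupp.weight_apply, Finsupp.sum_fintype _ _ (by simp), Fin.sum_univ_three]; simp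
  rw [this]
  exact mul_mem_bidegLE (mul_mem_bidegLE (hpow _ _) (hpow _ _)) (hpow _ _)

theorem evalEval_chart (M : Matrix (Fin 3) (Fin 3) ℝ) (f : R) (x y : ℝ) :
    evalEval x y (chart M f) = MvPolynomial.eval (M.mulVec ![x, y, 1]) f := by
  have : (evalEvalRingHom x y).comp (chart M).toRingHom =
      (MvPolynomial.eval (M.mulVec ![x, y, 1]) : R →+* ℝ) := by
    apply MvPolynomial.ringHom_ext
    · intro r
      simp only [RingHom.comp_apply, AlgHom.toRingHom_eq_coe, RingHom.coe_coe, MvPolynomial.eval_C]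
      rw [← MvPolynomial.algebraMap_eq, AlgHom.commutes]
      simp [Polynomial.algebraMap_apply]
    · intro i
      simp only [RingHom.comp_apply, AlgHom.toRingHom_eq_coe, RingHom.coe_coe, MvPolynomial.eval_X,
        chart_X]
      simp [sep, Matrix.mulVec, dotProduct, Fin.sum_univ_three]
      ring
  exact congrArg (fun φ => φ f) this

theorem chart_linForm {M M' : Matrix (Fin 3) (Fin 3) ℝ} (h : M' * M = 1) (k : Fin 3) :
    chart M (linForm (M' k)) = ![sep X 1, sep 1 X, 1] k := by
  have h1 : ∀ j, ∑ i, M' k i * M i j = if k = j then 1 else 0 := by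
    intro j; rw [← Matrix.one_apply, ← h, Matrix.mul_apply]
  have e0 := h1 0
  have e1 := h1 1
  have e2 := h1 2
  rw [Fin.sum_univ_three] at e0 e1 e2
  have : chart M (linForm (M' k)) = (if k = 0 then 1 else 0 : ℝ) • sep X 1 +
      (if k = 1 then 1 else 0 : ℝ) • sep 1 X + (if k = 2 then 1 else 0 : ℝ) • sep 1 1 := by
    rw [linForm, map_sum, Fin.sum_univ_three, ← e0, ← e1, ← e2]
    ext m n
    simp only [map_smul, chart_X, coeff_add, coeff_smul, coeff_coeff_sep, smul_eq_mul, coeff_C_mul,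
      coeff_C, coeff_X, coeff_one]
    split_ifs <;> ring
  rw [this]
  fin_cases k <;> simp [sep_one_one]

/-- Homogenization, inverse to `chart`. -/
noncomputable def homogenize (M' : Matrix (Fin 3) (Fin 3) ℝ) (d : ℕ) (f : ℝ[X][Y]) : R :=
  ∑ j ∈ f.support, ∑ i ∈ (f.coeff j).support, (f.coeff j).coeff i •
    (linForm (M' 0) ^ i * linForm (M' 1) ^ j * linForm (M' 2) ^ (d - i - j))

theorem homogenize_isHomogeneous (M' : Matrix (Fin 3) (Fin 3) ℝ) {d : ℕ} {f : ℝ[X][Y]}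
    (hf : f ∈ bidegLE d) : (homogenize M' d f).IsHomogeneous d := by
  refine MvPolynomial.IsHomogeneous.sum _ _ _ fun j _ =>
    MvPolynomial.IsHomogeneous.sum _ _ _ fun i hi => ?_
  have hij : i + j ≤ d := by
    by_contra hcon
    exact mem_support_iff.1 hi (hf i j (by omega))
  have h := (((linForm_isHomogeneous (M' 0)).pow i).mul ((linForm_isHomogeneous (M' 1)).pow j)).mul
    ((linForm_isHomogeneous (M' 2)).pow (d - i - j))
  rw [show 1 * i + 1 * j + 1 * (d - i - j) = d by omega] at h
  exact (MvPolynomial.homogeneousSubmodule (Fin 3) ℝ d).smul_mem _ h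

theorem sep_mul_sep (p q p' q' : ℝ[X]) : sep p q * sep p' q' = sep (p * p') (q * q') := by
  simp only [sep, Polynomial.map_mul, map_mul]; ring

theorem sep_pow (p q : ℝ[X]) (n : ℕ) : sep p q ^ n = sep (p ^ n) (q ^ n) := by
  simp only [sep, Polynomial.map_pow, map_pow, mul_pow]

theorem chart_homogenize {M M' : Matrix (Fin 3) (Fin 3) ℝ} (h : M' * M = 1) (d : ℕ)
    (f : ℝ[X][Y]) : chart M (homogenize M' d f) = f := by
  conv_rhs => rw [eq_sum_sep f]
  rw [homogenize, map_sum]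
  refine Finset.sum_congr rfl fun j _ => ?_
  rw [map_sum]
  refine Finset.sum_congr rfl fun i _ => ?_
  rw [map_smul, map_mul, map_mul, map_pow, map_pow, map_pow, chart_linForm h, chart_linForm h,
    chart_linForm h]
  simp [sep_pow, sep_mul_sep]

theorem eval_smul_of_isHomogeneous {d : ℕ} {f : R} (hf : f.IsHomogeneous d) (c : ℝ)
    (p : Fin 3 → ℝ) : MvPolynomial.eval (c • p) f = c ^ d * MvPolynomial.eval p f := by
  rw [MvPolynomial.eval_eq, MvPolynomial.eval_eq, Finset.mul_sum]
  refine Finset.sum_congr rfl fun m hm => ?_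
  have hd := hf (MvPolynomial.mem_support_iff.1 hm)
  have : d = ∑ i ∈ m.support, m i := by
    rw [← hd, Finsupp.weight_apply, Finsupp.sum]; simp
  rw [this]
  simp only [Pi.smul_apply, smul_eq_mul, mul_pow, Finset.prod_mul_distrib,
    Finset.prod_pow_eq_pow_sum]
  ring

theorem eq_zero_of_chart_eq_zero {M M' : Matrix (Fin 3) (Fin 3) ℝ} (h : M' * M = 1) {d : ℕ} {f : R}
    (hf : f.IsHomogeneous d) (h0 : chart M f = 0) : f = 0 := by
  have hM : M * M' = 1 := mul_eq_one_comm.1 h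
  have h2 : linForm (M' 2) ≠ 0 := by
    intro h2
    have := chart_linForm h 2
    rw [h2, map_zero] at this
    simp at this
  have key : linForm (M' 2) * f = 0 := by
    refine MvPolynomial.funext fun p => ?_
    rw [map_mul, eval_linForm, map_zero]
    by_cases hc : ∑ i, M' 2 i * p i = 0
    · rw [hc, zero_mul]
    set c := ∑ i, M' 2 i * p i with hcdef
    have hp : p = c • M.mulVec ![(M'.mulVec p 0) / c, (M'.mulVec p 1) / c, 1] := by
      rw [← Matrix.mulVec_smul]
      have : c • ![(M'.mulVec p 0) / c, (M'.mulVec p 1) / c, 1] = M'.mulVec p := by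
        funext k
        fin_cases k
        · simp [mul_div_cancel₀ _ hc]
        · simp [mul_div_cancel₀ _ hc]
        · simp [hcdef, Matrix.mulVec, dotProduct]
      rw [this, Matrix.mulVec_mulVec, hM, Matrix.one_mulVec]
    rw [hp, eval_smul_of_isHomogeneous hf, ← evalEval_chart, h0]
    simp
  exact (mul_eq_zero.1 key).resolve_left h2

/-- `chart` identifies the forms of degree `d` with the bivariate polynomials of total degree at
most `d`. -/
noncomputable def chartEquiv (M M' : Matrix (Fin 3) (Fin 3) ℝ) (h : M' * M = 1) (d : ℕ) :
    MvPolynomial.homogeneousSubmodule (Fin 3) ℝ d ≃ₗ[ℝ] bidegLE d :=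
  LinearEquiv.ofBijective
    (((chart M).toLinearMap ∘ₗ (MvPolynomial.homogeneousSubmodule (Fin 3) ℝ d).subtype).codRestrict
      (bidegLE d) fun f => chart_mem_bidegLE f.2) <| by
    constructor
    · refine (injective_iff_map_eq_zero _).2 fun f hf => ?_
      exact Subtype.ext (eq_zero_of_chart_eq_zero h f.2 (congrArg Subtype.val hf))
    · intro g
      exact ⟨⟨homogenize M' d g, homogenize_isHomogeneous M' g.2⟩,
        Subtype.ext (chart_homogenize h d g.1)⟩

/-- The bivariate polynomials whose coefficient of `y ^ j` lies in `U (d - j)`. -/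
def graded (U : ℕ → Submodule ℝ ℝ[X]) (d : ℕ) : Submodule ℝ ℝ[X][Y] where
  carrier := {f | (∀ j ≤ d, f.coeff j ∈ U (d - j)) ∧ ∀ j, d < j → f.coeff j = 0}
  zero_mem' := by simp
  add_mem' := by
    rintro f g ⟨hf, hf'⟩ ⟨hg, hg'⟩
    exact ⟨fun j hj => by simpa using Submodule.add_mem _ (hf j hj) (hg j hj),
      fun j hj => by simp [hf' j hj, hg' j hj]⟩
  smul_mem' := by
    rintro c f ⟨hf, hf'⟩
    exact ⟨fun j hj => by simpa using Submodule.smul_mem _ c (hf j hj),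
      fun j hj => by simp [hf' j hj]⟩

noncomputable def gradedEquiv (U : ℕ → Submodule ℝ ℝ[X]) (d : ℕ) :
    graded U d ≃ₗ[ℝ] ((j : Fin (d + 1)) → U (d - j)) where
  toFun f j := ⟨f.1.coeff j, f.2.1 j (Nat.lt_succ_iff.1 j.2)⟩
  map_add' f g := by funext j; ext1; simp
  map_smul' c f := by funext j; ext1; simp
  invFun g := ⟨∑ j : Fin (d + 1), monomial (j : ℕ) (g j : ℝ[X]), by
    constructor
    · intro j hj
      rw [finsetSum_coeff, Finset.sum_eq_single_of_mem (⟨j, Nat.lt_succ_iff.2 hj⟩ : Fin (d + 1))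
        (Finset.mem_univ _)]
      · simp
      · intro k _ hk
        rw [coeff_monomial, if_neg]
        intro h; exact hk (Fin.ext h)
    · intro j hj
      rw [finsetSum_coeff]
      refine Finset.sum_eq_zero fun k _ => ?_
      rw [coeff_monomial, if_neg]
      have := k.2
      omega⟩
  left_inv f := by
    ext1
    refine Polynomial.ext fun j => ?_
    simp only [finsetSum_coeff, coeff_monomial]
    rcases Nat.lt_or_ge d j with hj | hj
    · rw [f.2.2 j hj]
      refine Finset.sum_eq_zero fun k _ => ?_
      rw [if_neg]
      have := k.2
      omega
    · rw [Finset.sum_eq_single_of_mem (⟨j, Nat.lt_succ_iff.2 hj⟩ : Fin (d + 1)) (Finset.mem_univ _)]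
      · simp
      · intro k _ hk
        rw [if_neg]
        intro h; exact hk (Fin.ext h)
  right_inv g := by
    funext j
    ext1
    simp only [finsetSum_coeff, coeff_monomial]
    rw [Finset.sum_eq_single_of_mem j (Finset.mem_univ _)]
    · simp
    · intro k _ hk
      rw [if_neg]
      intro h; exact hk (Fin.ext h)

theorem finrank_graded (U : ℕ → Submodule ℝ ℝ[X]) (d : ℕ) [∀ e, Module.Finite ℝ (U e)] :
    Module.finrank ℝ (graded U d) = ∑ e ∈ Finset.range (d + 1), Module.finrank ℝ (U e) := by
  rw [(gradedEquiv U d).finrank_eq, Module.finrank_pi_fintype,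
    Fin.sum_univ_eq_sum_range (fun j => Module.finrank ℝ (U (d - j))) (d + 1),
    ← Finset.sum_range_reflect]
  refine Finset.sum_congr rfl fun j hj => ?_
  rw [Finset.mem_range] at hj
  rw [show d - (d + 1 - 1 - j) = j by omega]

theorem bidegLE_eq_graded (d : ℕ) : bidegLE d = graded (fun e => degreeLT ℝ (e + 1)) d := by
  ext f
  refine ⟨fun hf => ⟨fun j hj => coeff_mem_degreeLT hf hj,
    fun j hj => coeff_eq_zero_of_mem_bidegLE hf hj⟩, fun hf i j hij => ?_⟩
  rcases Nat.lt_or_ge d j with hj | hj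
  · rw [hf.2 j hj, coeff_zero]
  · exact mem_degreeLT_iff_coeff.1 (hf.1 j hj) i (by omega)

instance (d : ℕ) : Module.Finite ℝ (bidegLE d) := by
  rw [bidegLE_eq_graded]
  exact Module.Finite.equiv (gradedEquiv _ d).symm

theorem finrank_bidegLE (d : ℕ) : Module.finrank ℝ (bidegLE d) = (d + 2).choose 2 := by
  rw [bidegLE_eq_graded, finrank_graded]
  simp only [finrank_degreeLT]
  induction d with
  | zero => simp
  | succ d ih =>
    rw [Finset.sum_range_succ, ih, Nat.choose_succ_succ' (d + 2) 1, Nat.choose_one_right]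
    simp only [Nat.reduceAdd]
    omega

instance (d : ℕ) : Module.Finite ℝ (MvPolynomial.homogeneousSubmodule (Fin 3) ℝ d) :=
  Module.Finite.equiv (chartEquiv 1 1 (one_mul 1) d).symm

theorem finrank_homogeneousSubmodule (d : ℕ) :
    Module.finrank ℝ (MvPolynomial.homogeneousSubmodule (Fin 3) ℝ d) = (d + 2).choose 2 := by
  rw [(chartEquiv 1 1 (one_mul 1) d).finrank_eq, finrank_bidegLE]

end SplineTriangulation

end

section

open Polynomial
open scoped Polynomial.Bivariate

namespace SplineTriangulation

theorem homogeneousComponent_mul_of_isHomogeneous {k e : ℕ} {p : R} (hp : p.IsHomogeneous k)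
    (q : R) : MvPolynomial.homogeneousComponent (k + e) (p * q) =
      p * MvPolynomial.homogeneousComponent e q := by
  conv_lhs => rw [← MvPolynomial.sum_homogeneousComponent q]
  rw [Finset.mul_sum, map_sum]
  have h : ∀ i, MvPolynomial.homogeneousComponent (k + e)
      (p * MvPolynomial.homogeneousComponent i q) =
        if i = e then p * MvPolynomial.homogeneousComponent e q else 0 := by
    intro i
    rw [MvPolynomial.homogeneousComponent_of_mem
      (hp.mul (MvPolynomial.homogeneousComponent_isHomogeneous i q))]
    by_cases hi : i = e
    · subst hi; simp
    · rw [if_neg (by omega), if_neg hi]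
  simp only [h]
  rw [Finset.sum_ite_eq' (Finset.range (q.totalDegree + 1)) e]
  split_ifs with he
  · rfl
  · rw [MvPolynomial.homogeneousComponent_eq_zero e q (by
      rw [Finset.mem_range] at he; omega), mul_zero]

theorem mem_iSup_span_pow {ι : Type*} {T : Finset ι} {L : ι → R} {N : ℕ} {f : R} :
    f ∈ (⨆ i ∈ T, Ideal.span {L i ^ N} : Ideal R) ↔ ∃ q : ι → R, f = ∑ i ∈ T, L i ^ N * q i := by
  rw [Submodule.mem_iSup_finset_iff_exists_sum]
  constructor
  · rintro ⟨μ, rfl⟩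
    have h : ∀ i, ∃ q, L i ^ N * q = μ i := fun i => by
      obtain ⟨q, hq⟩ := Ideal.mem_span_singleton.1 (μ i).2
      exact ⟨q, hq.symm⟩
    choose q hq using h
    exact ⟨q, Finset.sum_congr rfl fun i _ => (hq i).symm⟩
  · rintro ⟨q, rfl⟩
    exact ⟨fun i => ⟨L i ^ N * q i, Ideal.mem_span_singleton.2 ⟨_, rfl⟩⟩, rfl⟩

theorem mem_iSup_span_pow_of_isHomogeneous {ι : Type*} {T : Finset ι} {L : ι → R} {N e : ℕ} {f : R}
    (hL : ∀ i, (L i).IsHomogeneous 1) (hf : f.IsHomogeneous (N + e)) :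
    f ∈ (⨆ i ∈ T, Ideal.span {L i ^ N} : Ideal R) ↔
      ∃ q : ι → R, (∀ i, (q i).IsHomogeneous e) ∧ f = ∑ i ∈ T, L i ^ N * q i := by
  rw [mem_iSup_span_pow]
  constructor
  · rintro ⟨q, hq⟩
    refine ⟨fun i => MvPolynomial.homogeneousComponent e (q i),
      fun i => MvPolynomial.homogeneousComponent_isHomogeneous e _, ?_⟩
    rw [← MvPolynomial.homogeneousComponent_eq_self hf, hq, map_sum]
    refine Finset.sum_congr rfl fun i _ => ?_
    have := (hL i).pow N
    rw [one_mul] at this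
    exact homogeneousComponent_mul_of_isHomogeneous this _
  · rintro ⟨q, _, hq⟩
    exact ⟨q, hq⟩

theorem homogeneousComponent_mem_iSup_span_pow {ι : Type*} {T : Finset ι} {L : ι → R} {N : ℕ}
    {f : R} (hL : ∀ i, (L i).IsHomogeneous 1) (hf : f ∈ (⨆ i ∈ T, Ideal.span {L i ^ N} : Ideal R))
    (e : ℕ) : MvPolynomial.homogeneousComponent (N + e) f ∈
      (⨆ i ∈ T, Ideal.span {L i ^ N} : Ideal R) := by
  obtain ⟨q, rfl⟩ := mem_iSup_span_pow.1 hf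
  refine mem_iSup_span_pow.2 ⟨fun i => MvPolynomial.homogeneousComponent e (q i), ?_⟩
  rw [map_sum]
  refine Finset.sum_congr rfl fun i _ => ?_
  have := (hL i).pow N
  rw [one_mul] at this
  exact homogeneousComponent_mul_of_isHomogeneous this _

/-- The linear forms of the pencil spanned by the first and the last row of `M'`. -/
noncomputable def pencilForm (M' : Matrix (Fin 3) (Fin 3) ℝ) : Option ℝ → R
  | none => linForm (M' 2)
  | some a => linForm (M' 0 - a • M' 2)

theorem pencilForm_isHomogeneous (M' : Matrix (Fin 3) (Fin 3) ℝ) (i : Option ℝ) :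
    (pencilForm M' i).IsHomogeneous 1 := by
  cases i <;> exact linForm_isHomogeneous _

theorem chart_pencilForm_pow {M M' : Matrix (Fin 3) (Fin 3) ℝ} (h : M' * M = 1) (i : Option ℝ)
    (N : ℕ) : chart M (pencilForm M' i ^ N) = C (pointPow N i) := by
  cases i with
  | none => rw [map_pow, pencilForm, chart_linForm h]; simp [pointPow]
  | some a =>
    have : linForm (M' 0 - a • M' 2) = linForm (M' 0) - a • linForm (M' 2) := by
      simp only [linForm, Finset.smul_sum, ← Finset.sum_sub_distrib]
      refine Finset.sum_congr rfl fun i _ => ?_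
      simp [sub_smul, mul_smul]
    rw [map_pow, pencilForm, this, map_sub, map_smul, chart_linForm h, chart_linForm h]
    simp only [pointPow, map_pow, map_sub]
    congr 1
    ext m n
    simp [coeff_coeff_sep, coeff_one, coeff_C]
    split_ifs <;> simp [coeff_one, coeff_C, *]

/-- The ideal generated by the `N`-th powers of forms of a pencil. -/
noncomputable def pencilIdeal (M' : Matrix (Fin 3) (Fin 3) ℝ) (N : ℕ) (T : Finset (Option ℝ)) :
    Ideal R := ⨆ i ∈ T, Ideal.span {pencilForm M' i ^ N}

theorem mem_pencilIdeal_iff {M M' : Matrix (Fin 3) (Fin 3) ℝ} (h : M' * M = 1) {N e : ℕ}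
    {T : Finset (Option ℝ)} {f : R} (hf : f.IsHomogeneous (N + e)) :
    f ∈ pencilIdeal M' N T ↔ ∃ g : Option ℝ → ℝ[X][Y], (∀ i, g i ∈ bidegLE e) ∧
      chart M f = ∑ i ∈ T, C (pointPow N i) * g i := by
  rw [pencilIdeal, mem_iSup_span_pow_of_isHomogeneous (pencilForm_isHomogeneous M') hf]
  constructor
  · rintro ⟨q, hq, rfl⟩
    refine ⟨fun i => chart M (q i), fun i => chart_mem_bidegLE (hq i), ?_⟩
    simp only [map_sum, map_mul, chart_pencilForm_pow h]
  · rintro ⟨g, hg, hs⟩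
    refine ⟨fun i => homogenize M' e (g i), fun i => homogenize_isHomogeneous M' (hg i), ?_⟩
    rw [← sub_eq_zero]
    refine eq_zero_of_chart_eq_zero h (d := N + e) (hf.sub ?_) ?_
    · refine MvPolynomial.IsHomogeneous.sum _ _ _ fun i _ => ?_
      have := (pencilForm_isHomogeneous M' i).pow N
      rw [one_mul] at this
      exact this.mul (homogenize_isHomogeneous M' (hg i))
    · rw [map_sub, hs, sub_eq_zero, map_sum]
      refine Finset.sum_congr rfl fun i _ => ?_
      rw [map_mul, chart_pencilForm_pow h, chart_homogenize h]

theorem mul_pow_mem_pencilIdeal_iff {M M' : Matrix (Fin 3) (Fin 3) ℝ} (h : M' * M = 1) {N e : ℕ}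
    {S : Finset ℝ} {f : R} (hf : f.IsHomogeneous e) :
    linForm (M' 2) ^ N * f ∈ pencilIdeal M' N (S.map Function.Embedding.some) ↔
      chart M f ∈ bicolon N S e := by
  have hl : (linForm (M' 2) ^ N).IsHomogeneous N := by
    simpa using (linForm_isHomogeneous (M' 2)).pow N
  have hc : chart M (linForm (M' 2) ^ N * f) = chart M f := by
    rw [map_mul, map_pow, chart_linForm h]; simp
  rw [mem_pencilIdeal_iff h (hl.mul hf), hc]
  constructor
  · rintro ⟨g, hg, hs⟩
    refine ⟨chart_mem_bidegLE hf, fun a => g (some a), fun a => hg _, ?_⟩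
    rw [hs, Finset.sum_map]
    rfl
  · rintro ⟨_, g, hg, hs⟩
    refine ⟨fun i => i.elim 0 g, fun i => ?_, ?_⟩
    · cases i with
      | none => exact Submodule.zero_mem _
      | some a => exact hg a
    · rw [hs, Finset.sum_map]
      rfl

/-- Exchange of the first two coordinates. -/
def flip (M' : Matrix (Fin 3) (Fin 3) ℝ) : Matrix (Fin 3) (Fin 3) ℝ :=
  M'.submatrix (Equiv.swap 0 1) id

theorem flip_mul {M M' : Matrix (Fin 3) (Fin 3) ℝ} (h : M' * M = 1) :
    flip M' * M.submatrix id (Equiv.swap 0 1) = 1 := by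
  rw [flip, ← Matrix.submatrix_mul _ _ _ _ _ Function.bijective_id, h]
  exact Matrix.submatrix_one_equiv _

theorem flip_two (M' : Matrix (Fin 3) (Fin 3) ℝ) : flip M' 2 = M' 2 := by
  funext i
  rfl

/-- The sum of the two colon ideals contains all forms of degree `e` if and only if the same holds
after dehomogenization. -/
theorem forall_mem_colon_iff {M M' : Matrix (Fin 3) (Fin 3) ℝ} (h : M' * M = 1) (N e : ℕ)
    (S T : Finset ℝ) :
    (∀ f : R, f.IsHomogeneous e → ∃ g : R,
      linForm (M' 2) ^ N * (f - g) ∈ pencilIdeal M' N (S.map Function.Embedding.some) ∧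
      linForm (M' 2) ^ N * g ∈ pencilIdeal (flip M') N (T.map Function.Embedding.some)) ↔
    bidegLE e ≤ bicolonSum N S T e := by
  have hl : (linForm (M' 2) ^ N).IsHomogeneous N := by
    simpa using (linForm_isHomogeneous (M' 2)).pow N
  have hT : ∀ {g : R}, g.IsHomogeneous e →
      (linForm (M' 2) ^ N * g ∈ pencilIdeal (flip M') N (T.map Function.Embedding.some) ↔
        Bivariate.swap (chart M g) ∈ bicolon N T e) := by
    intro g hg
    rw [swap_chart, ← mul_pow_mem_pencilIdeal_iff (flip_mul h) hg, flip_two]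
  constructor
  · intro H p hp
    obtain ⟨g, h1, h2⟩ := H _ (homogenize_isHomogeneous M' hp)
    have hf := homogenize_isHomogeneous M' hp
    have hg := MvPolynomial.homogeneousComponent_isHomogeneous e g
    have h1' := homogeneousComponent_mem_iSup_span_pow (pencilForm_isHomogeneous M') h1 e
    have h2' := homogeneousComponent_mem_iSup_span_pow (pencilForm_isHomogeneous (flip M')) h2 e
    rw [homogeneousComponent_mul_of_isHomogeneous hl] at h1' h2'
    rw [map_sub, MvPolynomial.homogeneousComponent_eq_self hf] at h1'
    have h1'' := (mul_pow_mem_pencilIdeal_iff h (hf.sub hg)).1 h1'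
    have h2'' := (hT hg).1 h2'
    rw [map_sub, chart_homogenize h] at h1''
    exact Submodule.mem_sup.2 ⟨_, h1'', _, h2'', sub_add_cancel _ _⟩
  · intro H f hf
    obtain ⟨p, hp, q, hq, hpq⟩ := Submodule.mem_sup.1 (H (chart_mem_bidegLE (M := M) hf))
    rw [Submodule.mem_comap, AlgEquiv.toLinearMap_apply] at hq
    have hqd : q ∈ bidegLE e := swap_mem_bidegLE.1 hq.1
    have hg := homogenize_isHomogeneous M' hqd
    refine ⟨homogenize M' e q, (mul_pow_mem_pencilIdeal_iff h (hf.sub hg)).2 ?_, (hT hg).2 ?_⟩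
    · rw [map_sub, chart_homogenize h, ← hpq, add_sub_cancel_right]; exact hp
    · rw [chart_homogenize h]; exact hq

instance (N : ℕ) (T : Finset (Option ℝ)) (n : ℕ) : Module.Finite ℝ (fan N T n) := by
  unfold fan; infer_instance

theorem fan_le_degreeLT (N : ℕ) (T : Finset (Option ℝ)) (n : ℕ) : fan N T n ≤ degreeLT ℝ (N + n) := by
  intro p hp
  obtain ⟨q, hq, rfl⟩ := mem_fan.1 hp
  exact Submodule.sum_mem _ fun i _ => jet_le_degreeLT _ i n (mem_jet_iff.2 ⟨_, hq i, rfl⟩)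

theorem exists_eq_sum_pointPow_iff {N e : ℕ} {T : Finset (Option ℝ)} {p : ℝ[X][Y]} :
    (∃ g : Option ℝ → ℝ[X][Y], (∀ i, g i ∈ bidegLE e) ∧ p = ∑ i ∈ T, C (pointPow N i) * g i) ↔
      p ∈ graded (fun D => fan N T (D + 1 - N)) (N + e) := by
  constructor
  · rintro ⟨g, hg, rfl⟩
    constructor
    · intro j hj
      rw [finsetSum_coeff]
      refine mem_fan.2 ⟨fun i => (g i).coeff j, fun i => ?_, ?_⟩
      · change (g i).coeff j ∈ _
        rcases Nat.lt_or_ge e j with h | h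
        · rw [coeff_eq_zero_of_mem_bidegLE (hg i) h]; exact Submodule.zero_mem _
        · exact degreeLT_mono (by omega) (coeff_mem_degreeLT (hg i) h)
      · exact Finset.sum_congr rfl fun i _ => by rw [coeff_C_mul]
    · intro j hj
      rw [finsetSum_coeff]
      exact Finset.sum_eq_zero fun i _ => by
        rw [coeff_C_mul, coeff_eq_zero_of_mem_bidegLE (hg i) (by omega), mul_zero]
  · rintro ⟨h1, h2⟩
    have h : ∀ j, ∃ q : Option ℝ → ℝ[X], (∀ i, q i ∈ degreeLT ℝ (e + 1 - j)) ∧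
        p.coeff j = ∑ i ∈ T, pointPow N i * q i := by
      intro j
      rcases Nat.lt_or_ge (N + e) j with hj | hj
      · exact ⟨0, fun i => Submodule.zero_mem _, by simp [h2 j hj]⟩
      · obtain ⟨q, hq, hs⟩ := mem_fan.1 (h1 j hj)
        exact ⟨q, fun i => degreeLT_mono (by omega) (hq i), hs⟩
    choose q hq hs using h
    refine ⟨fun i => ∑ j ∈ Finset.range (e + 1), monomial j (q j i), fun i => ?_, ?_⟩
    · refine Submodule.sum_mem _ fun k hk m j hmj => ?_
      rw [coeff_monomial]
      split_ifs with hkj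
      · subst hkj
        exact mem_degreeLT_iff_coeff.1 (hq k i) m (by omega)
      · exact coeff_zero _
    · refine Polynomial.ext fun j => ?_
      rw [finsetSum_coeff, hs j]
      refine Finset.sum_congr rfl fun i _ => ?_
      rw [coeff_C_mul, finsetSum_coeff]
      congr 1
      simp only [coeff_monomial]
      rw [Finset.sum_ite_eq']
      split_ifs with hj
      · rfl
      · have := hq j i
        rw [show e + 1 - j = 0 by rw [Finset.mem_range] at hj; omega, mem_degreeLT_iff_coeff] at this
        exact Polynomial.ext fun k => by rw [this k (Nat.zero_le _), coeff_zero]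

/-- The dimension of the degree `N + e` part of the ideal generated by the `N`-th powers of forms
of a pencil. -/
theorem finrank_pencilIdeal {M M' : Matrix (Fin 3) (Fin 3) ℝ} (h : M' * M = 1) (N e : ℕ)
    (T : Finset (Option ℝ)) :
    Module.finrank ℝ (MvPolynomial.homogeneousSubmodule (Fin 3) ℝ (N + e) ⊓
      (pencilIdeal M' N T).restrictScalars ℝ : Submodule ℝ R) =
      ∑ n ∈ Finset.range (e + 1), min (N + (n + 1)) (T.card * (n + 1)) := by
  set V := (MvPolynomial.homogeneousSubmodule (Fin 3) ℝ (N + e) ⊓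
      (pencilIdeal M' N T).restrictScalars ℝ : Submodule ℝ R) with hV
  have hinj : Function.Injective ((chart M).toLinearMap.domRestrict V) := by
    refine (injective_iff_map_eq_zero _).2 fun f hf => ?_
    exact Subtype.ext (eq_zero_of_chart_eq_zero h (Submodule.mem_inf.1 f.2).1 hf)
  have hrange : LinearMap.range ((chart M).toLinearMap.domRestrict V) =
      graded (fun D => fan N T (D + 1 - N)) (N + e) := by
    ext p
    rw [← exists_eq_sum_pointPow_iff]
    constructor
    · rintro ⟨f, rfl⟩
      exact (mem_pencilIdeal_iff h (Submodule.mem_inf.1 f.2).1).1 (Submodule.mem_inf.1 f.2).2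
    · intro hp
      have hd : p ∈ bidegLE (N + e) := by
        rw [exists_eq_sum_pointPow_iff] at hp
        rw [bidegLE_eq_graded]
        refine ⟨fun j hj => ?_, hp.2⟩
        rcases Nat.lt_or_ge e j with hj' | hj'
        · have h0 : p.coeff j ∈ fan N T (N + e - j + 1 - N) := hp.1 j hj
          rw [show N + e - j + 1 - N = 0 by omega] at h0
          obtain ⟨q, hq, hs⟩ := mem_fan.1 h0
          have : p.coeff j = 0 := by
            rw [hs]
            refine Finset.sum_eq_zero fun i _ => ?_
            have := mem_degreeLT_iff_coeff.1 (hq i)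
            rw [show q i = 0 from Polynomial.ext fun k => by rw [this k (Nat.zero_le _), coeff_zero],
              mul_zero]
          rw [this]; exact Submodule.zero_mem _
        · exact degreeLT_mono (by omega) (fan_le_degreeLT _ _ _ (hp.1 j hj))
      have hh := homogenize_isHomogeneous M' hd
      refine ⟨⟨homogenize M' (N + e) p, Submodule.mem_inf.2 ⟨hh, ?_⟩⟩, chart_homogenize h _ p⟩
      refine (mem_pencilIdeal_iff h hh).2 ?_
      rwa [chart_homogenize h]
  rw [← LinearMap.finrank_range_of_inj hinj, hrange, finrank_graded]
  simp only [finrank_fan]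
  rw [show N + e + 1 = N + (e + 1) by ring, Finset.sum_range_add, Finset.sum_eq_zero, zero_add]
  · refine Finset.sum_congr rfl fun n _ => ?_
    rw [show N + n + 1 - N = n + 1 by omega]
  · intro n hn
    rw [Finset.mem_range] at hn
    rw [show n + 1 - N = 0 by omega]; simp

theorem sum_min_eq {N S : ℕ} (hS : 2 ≤ S) (K : ℕ) :
    ((∑ n ∈ Finset.range K, min (N + (n + 1)) (S * (n + 1)) : ℕ) : ℤ) =
      S * ((K + 1).choose 2 : ℤ) -
        (((S - 1 - N % (S - 1) : ℕ) : ℤ) * ((K + 1 - N / (S - 1)).choose 2 : ℤ) +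
          (((N % (S - 1) : ℕ)) : ℤ) * ((K - N / (S - 1)).choose 2 : ℤ)) := by
  obtain ⟨S, rfl⟩ : ∃ T, S = T + 1 := ⟨S - 1, by omega⟩
  rw [Nat.add_sub_cancel]
  have hdiv := Nat.div_add_mod N S
  have hmod := Nat.mod_lt N (show 0 < S by omega)
  generalize N / S = q at *
  generalize N % S = ν at *
  induction K with
  | zero =>
    rw [Nat.choose_eq_zero_of_lt (show 0 + 1 - q < 2 by omega),
      Nat.choose_eq_zero_of_lt (show 0 - q < 2 by omega)]
    simp
  | succ K ih =>
    have h1 : (K + 1 + 1).choose 2 = (K + 1) + (K + 1).choose 2 := by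
      rw [Nat.choose_succ_succ' (K + 1) 1, Nat.choose_one_right]
    rw [Finset.sum_range_succ, Nat.cast_add, ih, h1]
    rcases Nat.lt_or_ge K q with hK | hK
    · have hm : min (N + (K + 1)) ((S + 1) * (K + 1)) = (S + 1) * (K + 1) := by
        refine min_eq_right ?_
        have := Nat.mul_le_mul_left S (show K + 1 ≤ q by omega)
        rw [add_mul]; omega
      rw [hm, Nat.choose_eq_zero_of_lt (show K + 1 + 1 - q < 2 by omega),
        Nat.choose_eq_zero_of_lt (show K + 1 - q < 2 by omega),
        Nat.choose_eq_zero_of_lt (show K - q < 2 by omega)]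
      push_cast; ring
    · obtain ⟨k, rfl⟩ := Nat.exists_eq_add_of_le hK
      have hm : min (N + (q + k + 1)) ((S + 1) * (q + k + 1)) = N + (q + k + 1) := by
        refine min_eq_left ?_
        have : S * (q + k + 1) = S * q + S * k + S := by ring
        rw [add_mul]
        have := Nat.zero_le (S * k)
        omega
      rw [hm, show q + k + 1 + 1 - q = k + 1 + 1 by omega, show q + k + 1 - q = k + 1 by omega,
        show q + k - q = k by omega, Nat.choose_succ_succ' (k + 1) 1, Nat.choose_succ_succ' k 1,
        Nat.choose_one_right, Nat.choose_one_right, Nat.cast_sub hmod.le, ← hdiv]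
      push_cast
      ring

end SplineTriangulation

end

section

open Topology Filter

namespace SplineTriangulation

/-- Twice the signed area of the triangle `a b c`. -/
def orient (a b c : Plane) : ℝ := (b 0 - a 0) * (c 1 - a 1) - (b 1 - a 1) * (c 0 - a 0)

theorem orient_rotate (a b c : Plane) : orient b c a = orient a b c := by
  simp only [orient]; ring

theorem orient_swap (a b c : Plane) : orient b a c = -orient a b c := by
  simp only [orient]; ring

theorem orient_swap' (a b c : Plane) : orient a c b = -orient a b c := by
  simp only [orient]; ring

theorem orient_self_left (a c : Plane) : orient a c a = 0 := by
  simp only [orient]; ring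

theorem orient_self_right (a c : Plane) : orient a c c = 0 := by
  simp only [orient]; ring

theorem orient_self (a c : Plane) : orient a a c = 0 := by
  simp only [orient]; ring

theorem orient_comb {a b p q r : Plane} {α β γ : ℝ} (h : α + β + γ = 1) :
    orient a b (α • p + β • q + γ • r) = α * orient a b p + β * orient a b q + γ * orient a b r := by
  obtain rfl : α = 1 - β - γ := by linarith
  simp only [orient, Pi.add_apply, Pi.smul_apply, smul_eq_mul]; ring

theorem orient_comb₂ {a b p q : Plane} {α β : ℝ} (h : α + β = 1) :
    orient a b (α • p + β • q) = α * orient a b p + β * orient a b q := by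
  obtain rfl : α = 1 - β := by linarith
  simp only [orient, Pi.add_apply, Pi.smul_apply, smul_eq_mul]; ring

theorem orient_add_add (a b c p : Plane) :
    orient p b c + orient a p c + orient a b p = orient a b c := by
  simp only [orient]; ring

theorem eq_comb {a b c : Plane} (h : orient a b c ≠ 0) (p : Plane) :
    p = (orient p b c / orient a b c) • a + (orient a p c / orient a b c) • b +
      (orient a b p / orient a b c) • c := by
  funext i
  simp only [Pi.add_apply, Pi.smul_apply, smul_eq_mul]
  field_simp
  fin_cases i <;> simp only [orient, Fin.zero_eta, Fin.mk_one, Fin.isValue] <;> ring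

theorem mem_convexHull_pair {a b p : Plane} :
    p ∈ convexHull ℝ ((({a, b} : Finset Plane) : Set Plane)) ↔
      ∃ α β : ℝ, 0 ≤ α ∧ 0 ≤ β ∧ α + β = 1 ∧ p = α • a + β • b := by
  rw [Finset.coe_pair, convexHull_pair]
  constructor
  · rintro ⟨α, β, h1, h2, h3, rfl⟩
    exact ⟨α, β, h1, h2, h3, rfl⟩
  · rintro ⟨α, β, h1, h2, h3, rfl⟩
    exact ⟨α, β, h1, h2, h3, rfl⟩

theorem mem_convexHull_triple {a b c p : Plane} :
    p ∈ convexHull ℝ ((({a, b, c} : Finset Plane) : Set Plane)) ↔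
      ∃ α β γ : ℝ, 0 ≤ α ∧ 0 ≤ β ∧ 0 ≤ γ ∧ α + β + γ = 1 ∧ p = α • a + β • b + γ • c := by
  constructor
  · intro hp
    rw [Finset.coe_insert, Finset.coe_pair, convexHull_insert ⟨b, by simp⟩, convexHull_pair] at hp
    simp only [convexJoin, Set.mem_singleton_iff, Set.iUnion_iUnion_eq_left, Set.mem_iUnion] at hp
    obtain ⟨q, ⟨β, γ, hβ, hγ, hs, rfl⟩, α, δ, hα, hδ, hs', rfl⟩ := hp
    refine ⟨α, δ * β, δ * γ, hα, mul_nonneg hδ hβ, mul_nonneg hδ hγ, ?_, ?_⟩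
    · rw [add_assoc, ← mul_add, hs, mul_one, hs']
    · rw [smul_add, smul_smul, smul_smul, add_assoc]
  · rintro ⟨α, β, γ, hα, hβ, hγ, hs, rfl⟩
    have := (convex_convexHull ℝ ((({a, b, c} : Finset Plane) : Set Plane))).sum_mem
      (t := Finset.univ) (w := ![α, β, γ]) (z := ![a, b, c]) ?_ ?_ ?_
    · simpa [Fin.sum_univ_three] using this
    · intro i _; fin_cases i <;> simpa
    · simpa [Fin.sum_univ_three] using hs
    · intro i _
      apply subset_convexHull
      fin_cases i <;> simp

/-- Barycentric description of a triangle. -/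
theorem mem_triangle_iff {a b c p : Plane} (h : orient a b c ≠ 0) :
    p ∈ convexHull ℝ ((({a, b, c} : Finset Plane) : Set Plane)) ↔
      0 ≤ orient p b c * orient a b c ∧ 0 ≤ orient a p c * orient a b c ∧
        0 ≤ orient a b p * orient a b c := by
  rw [mem_convexHull_triple]
  have hpos : 0 < orient a b c * orient a b c := mul_self_pos.2 h
  constructor
  · rintro ⟨α, β, γ, hα, hβ, hγ, hs, rfl⟩
    have e1 : orient (α • a + β • b + γ • c) b c = α * orient a b c := by
      rw [← orient_rotate, orient_comb hs, orient_self_left, orient_self_right, orient_rotate]; ring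
    have e2 : orient a (α • a + β • b + γ • c) c = β * orient a b c := by
      rw [← orient_rotate, ← orient_rotate, orient_comb hs, orient_self_left, orient_self_right,
        orient_swap' a c b, orient_swap c a b, orient_rotate]
      simp only [orient]; ring
    have e3 : orient a b (α • a + β • b + γ • c) = γ * orient a b c := by
      rw [orient_comb hs, orient_self_left, orient_self_right]; ring
    rw [e1, e2, e3]
    refine ⟨?_, ?_, ?_⟩ <;> rw [mul_assoc] <;> positivity
  · rintro ⟨h1, h2, h3⟩
    have hdiv : ∀ {x : ℝ}, 0 ≤ x * orient a b c → 0 ≤ x / orient a b c := by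
      intro x hx
      have : x / orient a b c = x * orient a b c / (orient a b c * orient a b c) := by field_simp
      rw [this]
      positivity
    refine ⟨_, _, _, hdiv h1, hdiv h2, hdiv h3, ?_, eq_comb h p⟩
    rw [← add_div, ← add_div, orient_add_add, div_self h]

theorem orient_ne_zero_of_affineIndependent {a b c : Plane} (hab : a ≠ b) (hac : a ≠ c)
    (hbc : b ≠ c)
    (h : AffineIndependent ℝ ((↑) : ({a, b, c} : Finset Plane) → Plane)) : orient a b c ≠ 0 := by
  intro h0
  have key : ∀ x y : ℝ, x • (b - a) + y • (c - a) = 0 → x = 0 := by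
    intro x y hxy
    let w : Plane → ℝ := fun p => if p = a then -(x + y) else if p = b then x else y
    have hsum : ∀ {V : Type} [AddCommGroup V] [Module ℝ V] (F : Plane → V),
        ∑ i : ({a, b, c} : Finset Plane), w i • F i =
          (-(x + y)) • F a + x • F b + y • F c := by
      intro V _ _ F
      rw [Finset.sum_coe_sort ({a, b, c} : Finset Plane) (fun p => w p • F p),
        Finset.sum_insert (by simp [hab, hac]), Finset.sum_pair hbc, ← add_assoc]
      simp [w, hab.symm, hac.symm, hbc.symm]
    have := (affineIndependent_iff (k := ℝ)).1 h Finset.univ (fun i => w i) ?_ ?_ ⟨b, by simp⟩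
      (Finset.mem_univ _)
    · simpa [w, hab.symm] using this
    · have := hsum (V := ℝ) (fun _ => 1)
      simp only [smul_eq_mul, mul_one] at this
      rw [this]; ring
    · rw [hsum (fun p => p), ← hxy]
      module
  have h1 := key (c 0 - a 0) (-(b 0 - a 0)) (by
    simp only [orient] at h0
    funext i; fin_cases i <;> simp <;> linarith)
  have h2 := key (c 1 - a 1) (-(b 1 - a 1)) (by
    simp only [orient] at h0
    funext i; fin_cases i <;> simp <;> linarith)
  apply hac
  funext i; fin_cases i <;> simp <;> linarith

namespace PlanarTriangulation

variable (Δ : PlanarTriangulation)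

theorem mem_triangles {σ : Finset Plane} : σ ∈ Δ.triangles ↔ σ ∈ Δ.faces ∧ σ.card = 3 := by
  simp [triangles]

theorem mem_edges {τ : Finset Plane} : τ ∈ Δ.edges ↔ τ ∈ Δ.faces ∧ τ.card = 2 := by
  simp [edges]

theorem orient_ne_zero {a b c : Plane} (h : {a, b, c} ∈ Δ.triangles) : orient a b c ≠ 0 := by
  obtain ⟨hf, hc⟩ := Δ.mem_triangles.1 h
  have hab : a ≠ b := by
    rintro rfl
    rw [Finset.insert_eq_of_mem (by simp)] at hc
    have := Finset.card_le_two (a := a) (b := c); omega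
  have hbc : b ≠ c := by
    rintro rfl
    rw [Finset.pair_eq_singleton] at hc
    have := Finset.card_le_two (a := a) (b := b); omega
  have hac : a ≠ c := by
    rintro rfl
    rw [Finset.insert_eq_of_mem (by simp)] at hc
    have := Finset.card_le_two (a := b) (b := a); omega
  exact orient_ne_zero_of_affineIndependent hab hac hbc (Δ.indep hf)

theorem exists_eq_triple {σ : Finset Plane} (h : σ ∈ Δ.triangles) :
    ∃ a b c, σ = {a, b, c} := by
  obtain ⟨a, b, c, -, -, -, h⟩ := Finset.card_eq_three.1 (Δ.mem_triangles.1 h).2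
  exact ⟨a, b, c, h⟩

theorem exists_eq_triple_of_mem {σ : Finset Plane} {a : Plane} (h : σ ∈ Δ.triangles) (ha : a ∈ σ) :
    ∃ b c, σ = {a, b, c} := by
  have h2 : (σ.erase a).card = 2 := by
    rw [Finset.card_erase_of_mem ha, (Δ.mem_triangles.1 h).2]
  obtain ⟨b, c, -, hbc⟩ := Finset.card_eq_two.1 h2
  exact ⟨b, c, by rw [← hbc, Finset.insert_erase ha]⟩

theorem exists_eq_triple_of_subset {σ : Finset Plane} {a b : Plane} (h : σ ∈ Δ.triangles)
    (hab : a ≠ b) (hs : {a, b} ⊆ σ) : ∃ c, σ = {a, b, c} := by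
  have h2 : (σ \ {a, b}).card = 1 := by
    rw [Finset.card_sdiff_of_subset hs, (Δ.mem_triangles.1 h).2, Finset.card_pair hab]
  obtain ⟨c, hc⟩ := Finset.card_eq_one.1 h2
  refine ⟨c, ?_⟩
  rw [← Finset.union_sdiff_of_subset hs, hc]
  ext x; simp

theorem pair_mem_edges {a b c : Plane} (h : {a, b, c} ∈ Δ.triangles) : {a, b} ∈ Δ.edges := by
  have hne : a ≠ b := by
    rintro rfl
    exact Δ.orient_ne_zero h (orient_self a c)
  refine Δ.mem_edges.2 ⟨Δ.down_closed (Δ.mem_triangles.1 h).1 ?_ ⟨a, by simp⟩, Finset.card_pair hne⟩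
  intro x; simp; tauto

theorem ne_of_mem_edges {a b : Plane} (h : {a, b} ∈ Δ.edges) : a ≠ b := by
  rintro rfl
  have := (Δ.mem_edges.1 h).2
  simp at this

theorem mem_interiorEdges_or {τ : Finset Plane} (h : τ ∈ Δ.edges) :
    τ ∈ Δ.interiorEdges ∨ τ ∈ Δ.boundaryEdges := by
  obtain ⟨σ, hσ, hτσ, hc⟩ := Δ.pure τ (Δ.mem_edges.1 h).1
  have hσt := Δ.mem_triangles.2 ⟨hσ, hc⟩
  by_cases hu : ∃ σ' ∈ Δ.triangles, τ ⊆ σ' ∧ σ ≠ σ'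
  · obtain ⟨σ', h1, h2, h3⟩ := hu
    exact Or.inl (Finset.mem_filter.2 ⟨h, σ, hσt, σ', h1, h3, hτσ, h2⟩)
  · push Not at hu
    exact Or.inr (Finset.mem_filter.2 ⟨h, σ, ⟨hσt, hτσ⟩, fun σ' h' => (hu σ' h'.1 h'.2).symm⟩)

/-- The triangle with vertices `σ`. -/
abbrev hull (σ : Finset Plane) : Set Plane := convexHull ℝ (σ : Set Plane)

theorem isClosed_hull (σ : Finset Plane) : IsClosed (hull σ) :=
  (σ.finite_toSet.isCompact_convexHull (𝕜 := ℝ)).isClosed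

theorem mem_domain {x : Plane} : x ∈ Δ.domain ↔ ∃ σ ∈ Δ.triangles, x ∈ hull σ := by
  rw [domain, Geometry.SimplicialComplex.mem_space_iff]
  constructor
  · rintro ⟨e, he, hx⟩
    obtain ⟨σ, hσ, heσ, hc⟩ := Δ.pure e he
    exact ⟨σ, Δ.mem_triangles.2 ⟨hσ, hc⟩, convexHull_mono (Finset.coe_subset.2 heσ) hx⟩
  · rintro ⟨σ, hσ, hx⟩
    exact ⟨σ, (Δ.mem_triangles.1 hσ).1, hx⟩

theorem mem_hull_inter {s t : Finset Plane} {x : Plane} (hs : s ∈ Δ.faces) (ht : t ∈ Δ.faces)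
    (hx : x ∈ hull s) (hx' : x ∈ hull t) : x ∈ hull (s ∩ t) := by
  have := Δ.inter_subset_convexHull hs ht ⟨hx, hx'⟩
  rwa [← Finset.coe_inter] at this

theorem isClosed_domain : IsClosed Δ.domain := by
  have : Δ.domain = ⋃ σ ∈ Δ.triangles, hull σ := by
    ext x; simp [Δ.mem_domain]
  rw [this]
  exact Set.Finite.isClosed_biUnion Δ.triangles.finite_toSet fun σ _ => isClosed_hull σ

theorem eventually_mem_hull {ι : Type*} (T : Finset ι) (K : ι → Finset Plane) (x : Plane) :
    ∀ᶠ p in 𝓝 x, ∀ i ∈ T, p ∈ hull (K i) → x ∈ hull (K i) := by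
  rw [Filter.eventually_all_finset]
  intro i _
  by_cases hx : x ∈ hull (K i)
  · exact Filter.Eventually.of_forall fun _ _ => hx
  · filter_upwards [(isClosed_hull (K i)).isOpen_compl.mem_nhds hx] with p hp h
    exact absurd h hp

/-- Near a point of the relative interior of a side, a triangle agrees with a half plane. -/
theorem eventually_mem_triangle {a b c x : Plane} (h : orient a b c ≠ 0) {α β : ℝ} (hα : 0 < α)
    (hβ : 0 < β) (hs : α + β = 1) (hx : x = α • a + β • b) :
    ∀ᶠ p in 𝓝 x, (p ∈ hull {a, b, c} ↔ 0 ≤ orient a b p * orient a b c) := by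
  have hpos : 0 < orient a b c * orient a b c := mul_self_pos.2 h
  have e1 : orient x b c * orient a b c = α * (orient a b c * orient a b c) := by
    rw [hx, ← orient_rotate, orient_comb₂ hs, orient_self_left, orient_rotate]; ring
  have e2 : orient a x c * orient a b c = β * (orient a b c * orient a b c) := by
    rw [hx, ← orient_rotate, ← orient_rotate, orient_comb₂ hs, orient_self_right]
    simp only [orient]; ring
  have c1 : Continuous fun p => orient p b c * orient a b c := by unfold orient; fun_prop
  have c2 : Continuous fun p => orient a p c * orient a b c := by unfold orient; fun_prop
  have f1 : ∀ᶠ p in 𝓝 x, 0 < orient p b c * orient a b c :=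
    c1.continuousAt.eventually_const_lt (by simp only [e1]; positivity)
  have f2 : ∀ᶠ p in 𝓝 x, 0 < orient a p c * orient a b c :=
    c2.continuousAt.eventually_const_lt (by simp only [e2]; positivity)
  filter_upwards [f1, f2] with p h1 h2
  rw [mem_triangle_iff h]
  exact ⟨fun h => h.2.2, fun h3 => ⟨h1.le, h2.le, h3⟩⟩

theorem hull_subset_zero {a b p : Plane} (h : p ∈ hull {a, b}) : orient a b p = 0 := by
  obtain ⟨α, β, -, -, hs, rfl⟩ := mem_convexHull_pair.1 h
  rw [orient_comb₂ hs, orient_self_left, orient_self_right]; ring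

theorem exists_near_side {a b x : Plane} (hx : orient a b x = 0) (c : Plane) {P : Plane → Prop}
    (hP : ∀ᶠ p in 𝓝 x, P p) : ∃ p, P p ∧ ∃ t > 0, orient a b p = t * orient a b c := by
  have hc : Continuous fun t : ℝ => (1 - t) • x + t • c := by fun_prop
  have h1 : ∀ᶠ t in 𝓝 (0 : ℝ), P ((1 - t) • x + t • c) :=
    hc.continuousAt.eventually (by simpa using hP)
  have h2 : ∀ᶠ t in 𝓝[>] (0 : ℝ), P ((1 - t) • x + t • c) := h1.filter_mono nhdsWithin_le_nhds
  obtain ⟨t, ht, ht'⟩ := (h2.and self_mem_nhdsWithin).exists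
  refine ⟨_, ht, t, ht', ?_⟩
  rw [orient_comb₂ (by ring), hx]; ring

/-- Two triangles with a common edge lie on different sides of it. -/
theorem orient_mul_orient_neg {a b c c' : Plane} (h : {a, b, c} ∈ Δ.triangles)
    (h' : {a, b, c'} ∈ Δ.triangles) (hne : c ≠ c') : orient a b c * orient a b c' < 0 := by
  by_contra! hcon
  have ho := Δ.orient_ne_zero h
  have ho' := Δ.orient_ne_zero h'
  have hpos : 0 < orient a b c * orient a b c' := lt_of_le_of_ne hcon (mul_ne_zero ho ho').symm
  have hx : orient a b ((1 / 2 : ℝ) • a + (1 / 2 : ℝ) • b) = 0 := by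
    rw [orient_comb₂ (by norm_num), orient_self_left, orient_self_right]; ring
  obtain ⟨p, ⟨h1, h2⟩, t, ht, hp⟩ := exists_near_side hx c
    ((eventually_mem_triangle ho (x := (1 / 2 : ℝ) • a + (1 / 2 : ℝ) • b) one_half_pos one_half_pos
      (by norm_num) rfl).and
    (eventually_mem_triangle ho' one_half_pos one_half_pos (by norm_num) rfl))
  have m1 : p ∈ hull {a, b, c} := h1.2 (by
    rw [hp, mul_assoc]; exact mul_nonneg ht.le (mul_self_nonneg _))
  have m2 : p ∈ hull {a, b, c'} := h2.2 (by rw [hp, mul_assoc]; exact mul_nonneg ht.le hpos.le)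
  have hab : a ≠ b := by rintro rfl; exact ho (orient_self a c)
  have hi : ({a, b, c} ∩ {a, b, c'} : Finset Plane) = {a, b} := by
    have hc : c ≠ a := by rintro rfl; exact ho (orient_self_left c b)
    have hc' : c ≠ b := by rintro rfl; exact ho (orient_self_right a c)
    ext y
    simp only [Finset.mem_inter, Finset.mem_insert, Finset.mem_singleton]
    grind
  have m3 := Δ.mem_hull_inter (Δ.mem_triangles.1 h).1 (Δ.mem_triangles.1 h').1 m1 m2
  rw [hi] at m3
  rw [hull_subset_zero m3] at hp
  exact (mul_ne_zero ht.ne' ho) hp.symm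

/-- The two triangles containing an interior edge. -/
theorem exists_triangles_of_mem_interiorEdges {a b : Plane} (h : {a, b} ∈ Δ.interiorEdges) :
    ∃ c c', {a, b, c} ∈ Δ.triangles ∧ {a, b, c'} ∈ Δ.triangles ∧
      0 < orient a b c ∧ orient a b c' < 0 ∧
      ∀ σ ∈ Δ.triangles, {a, b} ⊆ σ → σ = {a, b, c} ∨ σ = {a, b, c'} := by
  obtain ⟨he, σ, hσ, σ', hσ', hne, hs, hs'⟩ := Finset.mem_filter.1 h
  have hab := Δ.ne_of_mem_edges he
  obtain ⟨c, rfl⟩ := Δ.exists_eq_triple_of_subset hσ hab hs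
  obtain ⟨c', rfl⟩ := Δ.exists_eq_triple_of_subset hσ' hab hs'
  have hcc : c ≠ c' := by rintro rfl; exact hne rfl
  have hneg := Δ.orient_mul_orient_neg hσ hσ' hcc
  have hall : ∀ σ ∈ Δ.triangles, {a, b} ⊆ σ → σ = {a, b, c} ∨ σ = {a, b, c'} := by
    intro σ hσ'' hs''
    obtain ⟨e, rfl⟩ := Δ.exists_eq_triple_of_subset hσ'' hab hs''
    by_cases h1 : e = c
    · left; rw [h1]
    by_cases h2 : e = c'
    · right; rw [h2]
    have n1 := Δ.orient_mul_orient_neg hσ'' hσ h1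
    have n2 := Δ.orient_mul_orient_neg hσ'' hσ' h2
    nlinarith [mul_pos_of_neg_of_neg n1 n2, mul_self_nonneg (orient a b e)]
  rcases lt_or_gt_of_ne (Δ.orient_ne_zero hσ) with hc | hc
  · exact ⟨c', c, hσ', hσ, by nlinarith, hc, fun σ h1 h2 => (hall σ h1 h2).symm⟩
  · exact ⟨c, c', hσ, hσ', hc, by nlinarith, hall⟩

end PlanarTriangulation

end SplineTriangulation

end

section

open Topology Filter

namespace SplineTriangulation
namespace PlanarTriangulation

variable (Δ : PlanarTriangulation)

theorem ne_of_mem_triangles {a b c : Plane} (h : {a, b, c} ∈ Δ.triangles) :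
    a ≠ b ∧ a ≠ c ∧ b ≠ c := by
  have ho := Δ.orient_ne_zero h
  refine ⟨?_, ?_, ?_⟩ <;> rintro rfl
  · exact ho (orient_self a c)
  · exact ho (orient_self_left a b)
  · exact ho (orient_self_right a b)

/-- A vertex with positive barycentric coordinate belongs to every face containing the point. -/
theorem mem_of_mem_hull {a b c x : Plane} (h : {a, b, c} ∈ Δ.triangles) {α β γ : ℝ} (hα : 0 < α)
    (hs : α + β + γ = 1) (hx : x = α • a + β • b + γ • c) {s : Finset Plane} (hsub : s ⊆ {a, b, c})
    (hxs : x ∈ hull s) : a ∈ s := by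
  by_contra ha
  have hbc : s ⊆ {b, c} := by
    intro y hy
    have := hsub hy
    simp only [Finset.mem_insert, Finset.mem_singleton] at this ⊢
    rcases this with rfl | h
    · exact absurd hy ha
    · exact h
  have h0 := hull_subset_zero (convexHull_mono (Finset.coe_subset.2 hbc) hxs)
  rw [hx, orient_comb hs, orient_self_left, orient_self_right, orient_rotate] at h0
  have := mul_ne_zero hα.ne' (Δ.orient_ne_zero h)
  apply this
  linarith

/-- `x` lies in the relative interior of the segment from `a` to `b`. -/
def Between (a b x : Plane) : Prop := ∃ α β : ℝ, 0 < α ∧ 0 < β ∧ α + β = 1 ∧ x = α • a + β • b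

theorem Between.symm {a b x : Plane} (h : Between a b x) : Between b a x := by
  obtain ⟨α, β, h1, h2, h3, h4⟩ := h
  exact ⟨β, α, h2, h1, by rw [add_comm, h3], by rw [h4, add_comm]⟩

theorem Between.mem_hull {a b x : Plane} (h : Between a b x) {s : Finset Plane} (hs : {a, b} ⊆ s) :
    x ∈ hull s := by
  obtain ⟨α, β, h1, h2, h3, h4⟩ := h
  exact convexHull_mono (Finset.coe_subset.2 hs)
    (mem_convexHull_pair.2 ⟨α, β, h1.le, h2.le, h3, h4⟩)

theorem subset_of_between {a b x : Plane} {σ τ : Finset Plane} (hσ : σ ∈ Δ.triangles)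
    (hτ : τ ∈ Δ.faces) (hab : {a, b} ∈ Δ.edges) (hs : {a, b} ⊆ σ) (hx : Between a b x)
    (hxτ : x ∈ hull τ) : {a, b} ⊆ τ := by
  have hne := Δ.ne_of_mem_edges hab
  have hi := Δ.mem_hull_inter (Δ.mem_triangles.1 hσ).1 hτ (hx.mem_hull hs) hxτ
  obtain ⟨c, rfl⟩ := Δ.exists_eq_triple_of_subset hσ hne hs
  obtain ⟨α, β, h1, h2, h3, h4⟩ := hx
  have ha := Δ.mem_of_mem_hull hσ h1 (γ := 0) (by linarith) (by rw [h4]; simp)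
    Finset.inter_subset_left hi
  have hb := Δ.mem_of_mem_hull (a := b) (b := a) (c := c) (by rwa [Finset.insert_comm]) h2
    (β := α) (γ := 0) (by linarith) (by rw [h4]; simp [add_comm])
    (by rw [Finset.insert_comm]; exact Finset.inter_subset_left) hi
  intro y hy
  simp only [Finset.mem_insert, Finset.mem_singleton] at hy
  rcases hy with rfl | rfl
  exacts [(Finset.mem_inter.1 ha).2, (Finset.mem_inter.1 hb).2]

theorem mem_of_vertex_mem_hull {v : Plane} {σ τ : Finset Plane} (hσ : σ ∈ Δ.triangles)
    (hτ : τ ∈ Δ.faces) (hv : v ∈ σ) (hvτ : v ∈ hull τ) : v ∈ τ := by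
  have hi := Δ.mem_hull_inter (Δ.mem_triangles.1 hσ).1 hτ (subset_convexHull ℝ _ hv) hvτ
  obtain ⟨b, c, rfl⟩ := Δ.exists_eq_triple_of_mem hσ hv
  have := Δ.mem_of_mem_hull hσ one_pos (β := 0) (γ := 0) (by norm_num) (by simp)
    Finset.inter_subset_left hi
  exact (Finset.mem_inter.1 this).2

theorem eventually_mem_hull_of_pos {a b c x : Plane} (h : orient a b c ≠ 0) {α β γ : ℝ}
    (hα : 0 < α) (hβ : 0 < β) (hγ : 0 < γ) (hs : α + β + γ = 1)
    (hx : x = α • a + β • b + γ • c) : ∀ᶠ p in 𝓝 x, p ∈ hull {a, b, c} := by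
  have hpos : 0 < orient a b c * orient a b c := mul_self_pos.2 h
  have e1 : orient x b c * orient a b c = α * (orient a b c * orient a b c) := by
    rw [hx, ← orient_rotate, orient_comb hs, orient_self_left, orient_self_right, orient_rotate]; ring
  have e2 : orient a x c * orient a b c = β * (orient a b c * orient a b c) := by
    rw [hx, ← orient_rotate, ← orient_rotate, orient_comb hs, orient_self_right, orient_self_left]
    rw [orient_rotate, orient_rotate]; ring_nf
  have e3 : orient a b x * orient a b c = γ * (orient a b c * orient a b c) := by
    rw [hx, orient_comb hs, orient_self_left, orient_self_right]; ring
  have c1 : Continuous fun p => orient p b c * orient a b c := by unfold orient; fun_prop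
  have c2 : Continuous fun p => orient a p c * orient a b c := by unfold orient; fun_prop
  have c3 : Continuous fun p => orient a b p * orient a b c := by unfold orient; fun_prop
  have f1 : ∀ᶠ p in 𝓝 x, 0 < orient p b c * orient a b c :=
    c1.continuousAt.eventually_const_lt (by simp only [e1]; positivity)
  have f2 : ∀ᶠ p in 𝓝 x, 0 < orient a p c * orient a b c :=
    c2.continuousAt.eventually_const_lt (by simp only [e2]; positivity)
  have f3 : ∀ᶠ p in 𝓝 x, 0 < orient a b p * orient a b c :=
    c3.continuousAt.eventually_const_lt (by simp only [e3]; positivity)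
  filter_upwards [f1, f2, f3] with p h1 h2 h3
  exact (mem_triangle_iff h).2 ⟨h1.le, h2.le, h3.le⟩

/-- A point of a triangle lies in its interior, inside a side, or is a vertex. -/
theorem mem_hull_cases {σ : Finset Plane} (hσ : σ ∈ Δ.triangles) {x : Plane} (hx : x ∈ hull σ) :
    (∀ᶠ p in 𝓝 x, p ∈ hull σ) ∨ (∃ a b, {a, b} ∈ Δ.edges ∧ {a, b} ⊆ σ ∧ Between a b x) ∨ x ∈ σ := by
  obtain ⟨a, b, c, rfl⟩ := Δ.exists_eq_triple hσ
  obtain ⟨α, β, γ, hα, hβ, hγ, hs, hx⟩ := mem_convexHull_triple.1 hx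
  have hbc : {b, c} ∈ Δ.edges := Δ.pair_mem_edges (c := a) (by
    convert hσ using 1; ext; simp; tauto)
  have hac : {a, c} ∈ Δ.edges := Δ.pair_mem_edges (c := b) (by
    convert hσ using 1; ext; simp; tauto)
  have hab : {a, b} ∈ Δ.edges := Δ.pair_mem_edges hσ
  rcases hα.eq_or_lt with rfl | hα
  · rcases hβ.eq_or_lt with rfl | hβ
    · right; right
      obtain rfl : γ = 1 := by linarith
      simp [hx]
    · rcases hγ.eq_or_lt with rfl | hγ
      · right; right
        obtain rfl : β = 1 := by linarith
        simp [hx]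
      · right; left
        exact ⟨b, c, hbc, by intro y; simp; tauto, β, γ, hβ, hγ, by linarith, by simpa using hx⟩
  · rcases hβ.eq_or_lt with rfl | hβ
    · rcases hγ.eq_or_lt with rfl | hγ
      · right; right
        obtain rfl : α = 1 := by linarith
        simp [hx]
      · right; left
        exact ⟨a, c, hac, by intro y; simp; tauto, α, γ, hα, hγ, by linarith, by simpa using hx⟩
    · rcases hγ.eq_or_lt with rfl | hγ
      · right; left
        exact ⟨a, b, hab, by intro y; simp; tauto, α, β, hα, hβ, by linarith, by simpa using hx⟩
      · left
        exact eventually_mem_hull_of_pos (Δ.orient_ne_zero hσ) hα hβ hγ hs hx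

theorem eventually_mem_of_between_interior {a b x : Plane} (h : {a, b} ∈ Δ.interiorEdges)
    (hx : Between a b x) :
    ∀ᶠ p in 𝓝 x, ∃ σ ∈ Δ.triangles, {a, b} ⊆ σ ∧ p ∈ hull σ := by
  obtain ⟨c, c', hc, hc', ho, ho', -⟩ := Δ.exists_triangles_of_mem_interiorEdges h
  obtain ⟨α, β, h1, h2, h3, h4⟩ := hx
  filter_upwards [eventually_mem_triangle ho.ne' h1 h2 h3 h4,
    eventually_mem_triangle ho'.ne h1 h2 h3 h4] with p p1 p2
  rcases le_total 0 (orient a b p) with hp | hp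
  · exact ⟨_, hc, by intro y; simp; tauto, p1.2 (mul_nonneg hp ho.le)⟩
  · exact ⟨_, hc', by intro y; simp; tauto, p2.2 (mul_nonneg_of_nonpos_of_nonpos hp ho'.le)⟩

/-- The ray from `v` through `w`. -/
def ray (v w : Plane) : Set Plane := {p | ∃ t : ℝ, 0 ≤ t ∧ p = v + t • (w - v)}

theorem isPreconnected_ball_diff_ray {v w : Plane} (hw : w ≠ v) {ε : ℝ} (hε : 0 < ε) :
    IsPreconnected (Metric.ball v ε \ ray v w) := by
  have hn : 0 < ‖w - v‖ := norm_pos_iff.2 (sub_ne_zero.2 hw)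
  set s := ε / (2 * ‖w - v‖) with hs
  have hs0 : 0 < s := by positivity
  set z := v - s • (w - v) with hz
  have hzb : z ∈ Metric.ball v ε := by
    rw [Metric.mem_ball, dist_eq_norm, hz, sub_sub_cancel_left, norm_neg, norm_smul,
      Real.norm_of_nonneg hs0.le, hs]
    field_simp
    linarith
  have key : ∀ {t : ℝ}, t • (w - v) = 0 → t = 0 := fun h =>
    (smul_eq_zero.1 h).resolve_right (sub_ne_zero.2 hw)
  have hzr : z ∉ ray v w := by
    rintro ⟨t, ht, h⟩
    have : (t + s) • (w - v) = 0 := by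
      have h' : v - s • (w - v) = v + t • (w - v) := h
      have : t • (w - v) + s • (w - v) = (v + t • (w - v)) - (v - s • (w - v)) := by abel
      rw [add_smul, this, h', sub_self]
    have := key this
    linarith
  have hstar : StarConvex ℝ z (Metric.ball v ε \ ray v w) := by
    intro p hp α β hα hβ hαβ
    refine ⟨(convex_ball v ε) hzb hp.1 hα hβ hαβ, ?_⟩
    rintro ⟨t, ht, h⟩
    have hβ0 : 0 < β := by
      rcases hβ.eq_or_lt with rfl | h'
      · exfalso
        obtain rfl : α = 1 := by linarith
        exact hzr ⟨t, ht, by simpa using h⟩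
      · exact h'
    refine hp.2 ⟨(t + α * s) / β, by positivity, ?_⟩
    have : β • p = v + t • (w - v) - α • z := by rw [← h]; abel
    have h2 : β • p = β • (v + ((t + α * s) / β) • (w - v)) := by
      rw [this, smul_add, smul_smul, mul_div_cancel₀ _ hβ0.ne', hz]
      obtain rfl : α = 1 - β := by linarith
      module
    exact smul_right_injective _ hβ0.ne' h2
  exact (hstar.isPathConnected ⟨hzb, hzr⟩).isConnected.isPreconnected

end PlanarTriangulation

end SplineTriangulation

end

section

open Topology Filter

namespace SplineTriangulation
namespace PlanarTriangulation

variable (Δ : PlanarTriangulation)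

theorem eventually_segment {v : Plane} {P : Plane → Prop} (hP : ∀ᶠ p in 𝓝 v, P p) (a : Plane) :
    ∀ᶠ t in 𝓝[>] (0 : ℝ), P ((1 - t) • v + t • a) := by
  have hc : Continuous fun t : ℝ => (1 - t) • v + t • a := by fun_prop
  exact (hc.continuousAt.eventually (by simpa using hP)).filter_mono nhdsWithin_le_nhds

theorem exists_notMem_ray {v w₀ : Plane} {σ : Finset Plane} (hσ : σ ∈ Δ.triangles)
    (hv : v ∈ σ) {P : Plane → Prop} (hP : ∀ᶠ p in 𝓝 v, P p) :
    ∃ p, P p ∧ p ∉ ray v w₀ ∧ p ≠ v ∧ p ∈ hull σ := by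
  obtain ⟨a, b, rfl⟩ := Δ.exists_eq_triple_of_mem hσ hv
  have ho := Δ.orient_ne_zero hσ
  have hsmall := eventually_segment hP
  obtain ⟨t, ⟨⟨hta, htb⟩, ht1⟩, ht0⟩ := (((hsmall a).and (hsmall b)).and
    (((eventually_lt_nhds (show (0 : ℝ) < 1 by norm_num)).filter_mono nhdsWithin_le_nhds))).and
    (self_mem_nhdsWithin) |>.exists
  have ht0 : 0 < t := ht0
  have hmem : ∀ c, c ∈ ({v, a, b} : Finset Plane) → (1 - t) • v + t • c ∈ hull {v, a, b} := by
    intro c hc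
    exact (convex_convexHull ℝ _) (subset_convexHull ℝ _ (by simp)) (subset_convexHull ℝ _ hc)
      (by linarith) ht0.le (by ring)
  have hray : ∀ c, (1 - t) • v + t • c ∈ ray v w₀ → ∃ s : ℝ, 0 ≤ s ∧ c - v = s • (w₀ - v) := by
    rintro c ⟨s, hs, h⟩
    refine ⟨s / t, by positivity, ?_⟩
    refine smul_right_injective Plane ht0.ne' ?_
    simp only
    rw [smul_smul, mul_div_cancel₀ _ ht0.ne', ← sub_eq_iff_eq_add'.2 h]
    module
  have hnev : ∀ c, c ≠ v → (1 - t) • v + t • c ≠ v := by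
    intro c hc h
    refine hc (smul_right_injective Plane ht0.ne' ?_)
    simp only
    have : t • c = v - (1 - t) • v := by rw [eq_sub_iff_add_eq']; exact h
    rw [this]; module
  obtain ⟨hva, hvb, -⟩ := Δ.ne_of_mem_triangles hσ
  by_cases h1 : (1 - t) • v + t • a ∈ ray v w₀
  · by_cases h2 : (1 - t) • v + t • b ∈ ray v w₀
    · exfalso
      obtain ⟨s, -, hs⟩ := hray a h1
      obtain ⟨s', -, hs'⟩ := hray b h2
      apply ho
      have e0 := congrFun hs 0
      have e1 := congrFun hs 1
      have e2 := congrFun hs' 0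
      have e3 := congrFun hs' 1
      simp only [Pi.sub_apply, Pi.smul_apply, smul_eq_mul] at e0 e1 e2 e3
      rw [orient, e0, e1, e2, e3]; ring
    · exact ⟨_, htb, h2, hnev b hvb.symm, hmem b (by simp)⟩
  · exact ⟨_, hta, h1, hnev a hva.symm, hmem a (by simp)⟩

/-- A set of triangles at `v` that is closed under passing to an adjacent triangle at `v` and has
at most one boundary edge at `v` covers a neighbourhood of `v`, slit along that edge. -/
theorem star_covers {v w₀ : Plane} {C : Finset (Finset Plane)}
    (hC : ∀ σ ∈ C, σ ∈ Δ.triangles ∧ v ∈ σ) (hne : C.Nonempty)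
    (hclosed : ∀ σ ∈ C, ∀ σ' ∈ Δ.triangles, ∀ w, w ≠ v → {v, w} ⊆ σ → {v, w} ⊆ σ' → σ' ∈ C)
    (hw₀ : w₀ ≠ v) (hb : ∀ w, {v, w} ∈ Δ.boundaryEdges → ∀ σ ∈ C, {v, w} ⊆ σ → w = w₀) :
    ∀ᶠ p in 𝓝 v, p ∉ ray v w₀ → ∃ σ ∈ C, p ∈ hull σ := by
  have hnot : ∀ σ ∈ C, v ∉ hull (σ.erase v) := by
    intro σ hσ hv
    obtain ⟨hσt, hvσ⟩ := hC σ hσ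
    obtain ⟨b, c, rfl⟩ := Δ.exists_eq_triple_of_mem hσt hvσ
    have := Δ.mem_of_mem_hull hσt one_pos (β := 0) (γ := 0) (by norm_num) (by simp)
      (Finset.erase_subset _ _) hv
    simp at this
  obtain ⟨ε, hε, hball⟩ := Metric.eventually_nhds_iff_ball.1
    (eventually_mem_hull C (fun σ => σ.erase v) v)
  set KC : Set Plane := ⋃ σ ∈ C, hull σ with hKC
  have hclosedKC : IsClosed KC := Set.Finite.isClosed_biUnion C.finite_toSet fun σ _ => isClosed_hull σ
  have hloc : ∀ x ∈ Metric.ball v ε \ ray v w₀, x ∈ KC → x ∈ interior KC := by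
    intro x hx hxK
    obtain ⟨σ, hσ, hxσ⟩ := Set.mem_iUnion₂.1 hxK
    obtain ⟨hσt, hvσ⟩ := hC σ hσ
    have herase : x ∉ hull (σ.erase v) := fun h => hnot σ hσ (hball x hx.1 σ hσ h)
    have hedge : ∀ a b, {a, b} ∈ Δ.edges → {a, b} ⊆ σ → Between a b x → a = v → x ∈ interior KC := by
      rintro a b he hs hbt rfl
      have hwv := (Δ.ne_of_mem_edges he).symm
      rcases Δ.mem_interiorEdges_or he with hi | hbd
      · rw [mem_interior_iff_mem_nhds]
        filter_upwards [Δ.eventually_mem_of_between_interior hi hbt] with p hp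
        obtain ⟨σ', h1, h2, h3⟩ := hp
        exact Set.mem_iUnion₂.2 ⟨σ', hclosed σ hσ σ' h1 b hwv hs h2, h3⟩
      · exfalso
        have := hb b hbd σ hσ hs
        subst this
        obtain ⟨α, β, h1, h2, h3, h4⟩ := hbt
        refine hx.2 ⟨β, h2.le, ?_⟩
        obtain rfl : α = 1 - β := by linarith
        rw [h4]; module
    rcases Δ.mem_hull_cases hσt hxσ with h | ⟨a, b, he, hs, hbt⟩ | h
    · rw [mem_interior_iff_mem_nhds]
      filter_upwards [h] with p hp
      exact Set.mem_iUnion₂.2 ⟨σ, hσ, hp⟩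
    · by_cases ha : a = v
      · exact hedge a b he hs hbt ha
      by_cases hb' : b = v
      · exact hedge b a (by rwa [Finset.pair_comm]) (by rwa [Finset.pair_comm]) hbt.symm hb'
      · refine absurd (hbt.mem_hull ?_) herase
        intro y hy
        refine Finset.mem_erase.2 ⟨?_, hs hy⟩
        simp only [Finset.mem_insert, Finset.mem_singleton] at hy
        rcases hy with rfl | rfl <;> assumption
    · by_cases hxv : x = v
      · exact absurd ⟨0, le_rfl, by simp [hxv]⟩ hx.2
      · exact absurd (subset_convexHull ℝ _ (Finset.mem_coe.2 (Finset.mem_erase.2 ⟨hxv, h⟩))) herase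
  have hpt : ((Metric.ball v ε \ ray v w₀) ∩ interior KC).Nonempty := by
    obtain ⟨σ, hσ⟩ := hne
    obtain ⟨hσt, hvσ⟩ := hC σ hσ
    obtain ⟨p, hp, hpr, -, hps⟩ := Δ.exists_notMem_ray (w₀ := w₀) hσt hvσ
      (show ∀ᶠ p in 𝓝 v, p ∈ Metric.ball v ε from Metric.ball_mem_nhds v hε)
    exact ⟨p, ⟨hp, hpr⟩, hloc p ⟨hp, hpr⟩ (Set.mem_iUnion₂.2 ⟨σ, hσ, hps⟩)⟩
  have hsub := IsPreconnected.subset_left_of_subset_union isOpen_interior hclosedKC.isOpen_compl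
    (Set.disjoint_left.2 fun x hx hx' => hx' (interior_subset hx))
    (fun x hx => by
      by_cases h : x ∈ KC
      · exact Or.inl (hloc x hx h)
      · exact Or.inr h) hpt (isPreconnected_ball_diff_ray hw₀ hε)
  filter_upwards [Metric.ball_mem_nhds v hε] with p hp hpr
  obtain ⟨σ, h1, h2⟩ := Set.mem_iUnion₂.1 (interior_subset (hsub ⟨hp, hpr⟩))
  exact ⟨σ, h1, h2⟩

theorem mem_of_star {v w₀ : Plane} {C : Finset (Finset Plane)}
    (hC : ∀ σ ∈ C, σ ∈ Δ.triangles ∧ v ∈ σ) (hne : C.Nonempty)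
    (hclosed : ∀ σ ∈ C, ∀ σ' ∈ Δ.triangles, ∀ w, w ≠ v → {v, w} ⊆ σ → {v, w} ⊆ σ' → σ' ∈ C)
    (hw₀ : w₀ ≠ v) (hb : ∀ w, {v, w} ∈ Δ.boundaryEdges → ∀ σ ∈ C, {v, w} ⊆ σ → w = w₀)
    {σ : Finset Plane} (hσ : σ ∈ Δ.triangles) (hv : v ∈ σ) : σ ∈ C := by
  obtain ⟨p, hp, hpr, hpv, hps⟩ := Δ.exists_notMem_ray (w₀ := w₀) hσ hv
    (Δ.star_covers hC hne hclosed hw₀ hb)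
  obtain ⟨σ', hσ', hps'⟩ := hp hpr
  have hi := Δ.mem_hull_inter (Δ.mem_triangles.1 hσ).1 (Δ.mem_triangles.1 (hC σ' hσ').1).1 hps hps'
  obtain ⟨w, hw, hwv⟩ : ∃ w ∈ σ ∩ σ', w ≠ v := by
    by_contra! hcon
    have : (σ ∩ σ') ⊆ {v} := fun w hw => Finset.mem_singleton.2 (hcon w hw)
    have := convexHull_mono (𝕜 := ℝ) (Finset.coe_subset.2 this) hi
    rw [Finset.coe_singleton, convexHull_singleton] at this
    exact hpv this
  rw [Finset.mem_inter] at hw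
  refine hclosed σ' hσ' σ hσ w hwv ?_ ?_ <;> intro y hy <;>
    simp only [Finset.mem_insert, Finset.mem_singleton] at hy <;> rcases hy with rfl | rfl
  exacts [(hC σ' hσ').2, hw.2, hv, hw.1]

theorem ray_inter_eq {v w p : Plane} (hw : w ≠ v) (hp : p ∈ ray v w)
    (hp' : p ∈ ray v (v + (v - w))) : p = v := by
  obtain ⟨s, hs, h⟩ := hp
  obtain ⟨t, ht, h'⟩ := hp'
  have : (s + t) • (w - v) = 0 := by
    have e : s • (w - v) = t • (v + (v - w) - v) := by
      rw [h] at h'; exact add_left_cancel h'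
    rw [add_smul, e]; module
  have h0 := (smul_eq_zero.1 this).resolve_right (sub_ne_zero.2 hw)
  obtain rfl : s = 0 := by linarith
  simpa using h

theorem mem_edges_of_mem_boundaryEdges {τ : Finset Plane} (h : τ ∈ Δ.boundaryEdges) : τ ∈ Δ.edges :=
  (Finset.mem_filter.1 h).1

theorem domain_mem_nhds_of_interior_vertex {v : Plane} {σ : Finset Plane} (hσ : σ ∈ Δ.triangles)
    (hv : v ∈ σ) (hb : ∀ τ ∈ Δ.boundaryEdges, v ∉ τ) : Δ.domain ∈ 𝓝 v := by
  set C := Δ.triangles.filter fun σ => v ∈ σ with hC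
  have hne : (v + 1) ≠ v := by
    intro h
    have := congrFun h 0
    simp at this
  have hne' : v + (v - (v + 1)) ≠ v := by
    intro h
    have := congrFun h 0
    simp at this
  have key : ∀ w₀ ≠ v, ∀ᶠ p in 𝓝 v, p ∉ ray v w₀ → ∃ σ ∈ C, p ∈ hull σ := by
    intro w₀ hw₀
    refine Δ.star_covers (fun σ hσ => Finset.mem_filter.1 hσ) ⟨σ, Finset.mem_filter.2 ⟨hσ, hv⟩⟩ ?_
      hw₀ ?_
    · intro σ _ σ' hσ' w _ _ hs'
      exact Finset.mem_filter.2 ⟨hσ', hs' (by simp)⟩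
    · intro w hw
      exact absurd (by simp) (hb _ hw)
  filter_upwards [key _ hne, key _ hne'] with p h1 h2
  by_cases hp : p ∈ ray v (v + 1)
  · by_cases hp' : p ∈ ray v (v + (v - (v + 1)))
    · rw [ray_inter_eq hne hp hp']
      exact Δ.mem_domain.2 ⟨σ, hσ, subset_convexHull ℝ _ hv⟩
    · obtain ⟨σ', h, h'⟩ := h2 hp'
      exact Δ.mem_domain.2 ⟨σ', (Finset.mem_filter.1 h).1, h'⟩
  · obtain ⟨σ', h, h'⟩ := h1 hp
    exact Δ.mem_domain.2 ⟨σ', (Finset.mem_filter.1 h).1, h'⟩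

theorem exists_boundaryEdge_of_mem_frontier {x : Plane} (hx : x ∈ frontier Δ.domain) :
    ∃ τ ∈ Δ.boundaryEdges, x ∈ hull τ := by
  by_contra! hcon
  have hxd : x ∈ Δ.domain := Δ.isClosed_domain.frontier_subset hx
  obtain ⟨σ, hσ, hxσ⟩ := Δ.mem_domain.1 hxd
  have hnot : Δ.domain ∉ 𝓝 x := fun h => hx.2 (mem_interior_iff_mem_nhds.2 h)
  apply hnot
  rcases Δ.mem_hull_cases hσ hxσ with h | ⟨a, b, he, hs, hbt⟩ | h
  · filter_upwards [h] with p hp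
    exact Δ.mem_domain.2 ⟨σ, hσ, hp⟩
  · rcases Δ.mem_interiorEdges_or he with hi | hbd
    · filter_upwards [Δ.eventually_mem_of_between_interior hi hbt] with p hp
      obtain ⟨σ', h1, -, h3⟩ := hp
      exact Δ.mem_domain.2 ⟨σ', h1, h3⟩
    · exact absurd (hbt.mem_hull subset_rfl) (hcon _ hbd)
  · exact Δ.domain_mem_nhds_of_interior_vertex hσ h fun τ hτ hv =>
      hcon τ hτ (subset_convexHull ℝ _ hv)

theorem between_mem_frontier {a b x : Plane} (h : {a, b} ∈ Δ.boundaryEdges) (hx : Between a b x) :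
    x ∈ frontier Δ.domain := by
  obtain ⟨he, σ, ⟨hσ, hs⟩, hu⟩ := Finset.mem_filter.1 h
  have hxd : x ∈ Δ.domain := Δ.mem_domain.2 ⟨σ, hσ, hx.mem_hull hs⟩
  rw [Δ.isClosed_domain.frontier_eq]
  refine ⟨hxd, fun hint => ?_⟩
  obtain ⟨c, rfl⟩ := Δ.exists_eq_triple_of_subset hσ (Δ.ne_of_mem_edges he) hs
  have ho := Δ.orient_ne_zero hσ
  obtain ⟨α, β, h1, h2, h3, h4⟩ := id hx
  have hx0 : orient a b x = 0 := hull_subset_zero (hx.mem_hull subset_rfl)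
  have hopp : orient a b (x + (x - c)) = -orient a b c := by
    have : orient a b (x + (x - c)) = 2 * orient a b x - orient a b c := by
      simp only [orient, Pi.add_apply, Pi.sub_apply]; ring
    rw [this, hx0]; ring
  obtain ⟨p, ⟨⟨hp1, hp2⟩, hp3⟩, t, ht, hp⟩ := exists_near_side hx0 (x + (x - c))
    (((eventually_mem_hull Δ.triangles id x).and (eventually_mem_triangle ho h1 h2 h3 h4)).and
      (mem_interior_iff_mem_nhds.1 hint))
  obtain ⟨σ', hσ', hpσ'⟩ := Δ.mem_domain.1 hp3
  have hxσ' := hp1 σ' hσ' hpσ'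
  have := hu σ' ⟨hσ', Δ.subset_of_between hσ (Δ.mem_triangles.1 hσ').1 he hs hx hxσ'⟩
  subst this
  have h5 := hp2.1 hpσ'
  rw [hp, hopp] at h5
  nlinarith [mul_pos ht (mul_self_pos.2 ho)]

/-- Near any point, the boundary of a polygonal domain consists of at most two segments. -/
theorem exists_two_segments {Ω : Set Plane} (h : IsPolygonalDomain Ω) (v : Plane) :
    ∃ q₁ q₂, ∀ᶠ p in 𝓝 v, p ∈ frontier Ω → p ∈ segment ℝ v q₁ ∨ p ∈ segment ℝ v q₂ := by
  obtain ⟨-, -, n, P, ⟨hn, hinj, hdisj⟩, hF⟩ := h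
  have : NeZero n := ⟨by omega⟩
  have hloc : ∀ᶠ p in 𝓝 v, ∀ i ∈ (Finset.univ : Finset (ZMod n)),
      p ∈ hull {P i, P (i + 1)} → v ∈ hull {P i, P (i + 1)} :=
    eventually_mem_hull Finset.univ (fun i => {P i, P (i + 1)}) v
  have hseg : ∀ i, hull {P i, P (i + 1)} = segment ℝ (P i) (P (i + 1)) := by
    intro i; rw [hull, Finset.coe_pair, convexHull_pair]
  simp only [hseg, Finset.mem_univ, true_imp_iff] at hloc
  by_cases hv : ∃ i, v ∈ openSegment ℝ (P i) (P (i + 1))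
  · obtain ⟨i, hi⟩ := hv
    refine ⟨P i, P (i + 1), ?_⟩
    filter_upwards [hloc] with p hp hpF
    rw [hF] at hpF
    obtain ⟨j, hj⟩ := Set.mem_iUnion.1 hpF
    have : j = i := by
      by_contra hne
      exact Set.disjoint_left.1 (hdisj i j (Ne.symm hne)) hi (hp j hj)
    subst this
    obtain ⟨α, β, hα, hβ, hs, rfl⟩ := hj
    obtain ⟨α', β', hα', hβ', hs', rfl⟩ := hi
    obtain rfl : α = 1 - β := by linarith
    obtain rfl : α' = 1 - β' := by linarith
    rcases le_total β β' with hb | hb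
    · left
      refine ⟨β / β', 1 - β / β', by positivity, ?_, by ring, ?_⟩
      · rw [sub_nonneg, div_le_one hβ']; exact hb
      · have : β = (β / β') * β' := by field_simp
        generalize β / β' = κ at *
        subst this
        module
    · right
      refine ⟨(1 - β) / (1 - β'), 1 - (1 - β) / (1 - β'), by positivity, ?_, by ring, ?_⟩
      · rw [sub_nonneg, div_le_one hα']; linarith
      · have : 1 - β = ((1 - β) / (1 - β')) * (1 - β') := by field_simp
        generalize (1 - β) / (1 - β') = κ at *
        obtain rfl : β = 1 - κ * (1 - β') := by linarith
        module
  · have hend : ∀ i, v ∈ segment ℝ (P i) (P (i + 1)) → v = P i ∨ v = P (i + 1) := by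
      intro i hi
      by_contra! hcon
      exact hv ⟨i, mem_openSegment_of_ne_left_right hcon.1.symm hcon.2.symm hi⟩
    by_cases hj : ∃ j, v = P j
    · obtain ⟨j, rfl⟩ := hj
      refine ⟨P (j + 1), P (j - 1), ?_⟩
      filter_upwards [hloc] with p hp hpF
      rw [hF] at hpF
      obtain ⟨i, hi⟩ := Set.mem_iUnion.1 hpF
      rcases hend i (hp i hi) with h | h
      · left; rw [hinj h]; exact hi
      · right
        have := hinj h
        rw [this, add_sub_cancel_right, segment_symm]; exact hi
    · refine ⟨v, v, ?_⟩
      filter_upwards [hloc] with p hp hpF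
      rw [hF] at hpF
      obtain ⟨i, hi⟩ := Set.mem_iUnion.1 hpF
      rcases hend i (hp i hi) with h | h
      · exact absurd ⟨_, h⟩ hj
      · exact absurd ⟨_, h⟩ hj

end PlanarTriangulation
end SplineTriangulation

end

section

open Topology Filter

namespace SplineTriangulation
namespace PlanarTriangulation

variable (Δ : PlanarTriangulation)

theorem exists_triangle_of_mem_edges {τ : Finset Plane} (h : τ ∈ Δ.edges) :
    ∃ σ ∈ Δ.triangles, τ ⊆ σ := by
  obtain ⟨σ, hσ, hτσ, hc⟩ := Δ.pure τ (Δ.mem_edges.1 h).1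
  exact ⟨σ, Δ.mem_triangles.2 ⟨hσ, hc⟩, hτσ⟩

theorem eq_of_mem_segment {v w w' q : Plane} {t : ℝ} (hw : {v, w} ∈ Δ.edges)
    (hw' : {v, w'} ∈ Δ.edges) (ht : 0 < t) (h : (1 - t) • v + t • w ∈ segment ℝ v q)
    (h' : (1 - t) • v + t • w' ∈ segment ℝ v q) : w = w' := by
  have main : ∀ {w w' : Plane}, {v, w} ∈ Δ.edges → {v, w'} ∈ Δ.edges → ∀ θ θ' : ℝ, 0 ≤ θ →
      θ ≤ θ' → t • (w - v) = θ • (q - v) → t • (w' - v) = θ' • (q - v) → w = w' := by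
    intro w w' hw hw' θ θ' hθ hle h1 h2
    have hvw := Δ.ne_of_mem_edges hw
    have hvw' := Δ.ne_of_mem_edges hw'
    have hθ' : 0 < θ' := by
      rcases (hθ.trans hle).eq_or_lt with h0 | h0
      · rw [← h0, zero_smul] at h2
        exact absurd ((smul_eq_zero.1 h2).resolve_left ht.ne') (sub_ne_zero.2 hvw'.symm)
      · exact h0
    have h3 : w - v = (θ / θ') • (w' - v) := by
      refine smul_right_injective Plane ht.ne' ?_
      simp only
      rw [h1, smul_comm, h2, smul_smul, div_mul_cancel₀ _ hθ'.ne']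
    have hmem : w ∈ hull {v, w'} := by
      refine mem_convexHull_pair.2 ⟨1 - θ / θ', θ / θ', ?_, by positivity, by ring, ?_⟩
      · rw [sub_nonneg, div_le_one hθ']; exact hle
      · rw [← sub_eq_zero, ← sub_eq_zero.2 h3]; module
    obtain ⟨σ, hσ, hs⟩ := Δ.exists_triangle_of_mem_edges hw
    have := Δ.mem_of_vertex_mem_hull hσ (Δ.mem_edges.1 hw').1 (hs (by simp)) hmem
    simp only [Finset.mem_insert, Finset.mem_singleton] at this
    exact this.resolve_left hvw.symm
  have conv : ∀ {w : Plane}, (1 - t) • v + t • w ∈ segment ℝ v q →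
      ∃ θ : ℝ, 0 ≤ θ ∧ t • (w - v) = θ • (q - v) := by
    rintro w ⟨α, θ, -, hθ, hs, h⟩
    refine ⟨θ, hθ, ?_⟩
    obtain rfl : α = 1 - θ := by linarith
    rw [← sub_eq_zero, ← sub_eq_zero.2 h.symm]; module
  obtain ⟨θ, hθ, h1⟩ := conv h
  obtain ⟨θ', hθ', h2⟩ := conv h'
  rcases le_total θ θ' with hle | hle
  · exact main hw hw' θ θ' hθ hle h1 h2
  · exact (main hw' hw θ' θ hθ' hle h2 h1).symm

/-- A vertex lies on at most two boundary edges. -/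
theorem not_three_boundaryEdges {v w₁ w₂ w₃ : Plane} (h₁ : {v, w₁} ∈ Δ.boundaryEdges)
    (h₂ : {v, w₂} ∈ Δ.boundaryEdges) (h₃ : {v, w₃} ∈ Δ.boundaryEdges) (h12 : w₁ ≠ w₂)
    (h13 : w₁ ≠ w₃) (h23 : w₂ ≠ w₃) : False := by
  obtain ⟨q₁, q₂, hq⟩ := exists_two_segments Δ.polygonal v
  have hsmall := eventually_segment hq
  obtain ⟨t, ⟨⟨⟨ht1, ht2⟩, ht3⟩, hlt⟩, ht0⟩ := ((((hsmall w₁).and (hsmall w₂)).and (hsmall w₃)).and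
    (((eventually_lt_nhds (show (0 : ℝ) < 1 by norm_num)).filter_mono nhdsWithin_le_nhds))).and
    (self_mem_nhdsWithin) |>.exists
  have ht0 : 0 < t := ht0
  have hbt : ∀ w, Between v w ((1 - t) • v + t • w) := fun w =>
    ⟨1 - t, t, by linarith, ht0, by ring, rfl⟩
  have e1 := Δ.mem_edges_of_mem_boundaryEdges h₁
  have e2 := Δ.mem_edges_of_mem_boundaryEdges h₂
  have e3 := Δ.mem_edges_of_mem_boundaryEdges h₃
  rcases ht1 (Δ.between_mem_frontier h₁ (hbt _)) with a1 | a1 <;>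
    rcases ht2 (Δ.between_mem_frontier h₂ (hbt _)) with a2 | a2 <;>
    rcases ht3 (Δ.between_mem_frontier h₃ (hbt _)) with a3 | a3
  · exact h12 (Δ.eq_of_mem_segment e1 e2 ht0 a1 a2)
  · exact h12 (Δ.eq_of_mem_segment e1 e2 ht0 a1 a2)
  · exact h13 (Δ.eq_of_mem_segment e1 e3 ht0 a1 a3)
  · exact h23 (Δ.eq_of_mem_segment e2 e3 ht0 a2 a3)
  · exact h23 (Δ.eq_of_mem_segment e2 e3 ht0 a2 a3)
  · exact h13 (Δ.eq_of_mem_segment e1 e3 ht0 a1 a3)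
  · exact h12 (Δ.eq_of_mem_segment e1 e2 ht0 a1 a2)
  · exact h12 (Δ.eq_of_mem_segment e1 e2 ht0 a1 a2)

/-- The two triangles have a common edge that contains `x`. -/
def Adjacent (x : Plane) (σ σ' : Finset Plane) : Prop :=
  σ ∈ Δ.triangles ∧ σ' ∈ Δ.triangles ∧
    ∃ a b, {a, b} ∈ Δ.edges ∧ {a, b} ⊆ σ ∧ {a, b} ⊆ σ' ∧ x ∈ hull {a, b}

theorem Adjacent.symm {Δ : PlanarTriangulation} {x : Plane} {σ σ' : Finset Plane}
    (h : Δ.Adjacent x σ σ') : Δ.Adjacent x σ' σ := by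
  obtain ⟨h1, h2, a, b, h3, h4, h5, h6⟩ := h
  exact ⟨h2, h1, a, b, h3, h5, h4, h6⟩

theorem pair_mem_edges_of_subset {v w : Plane} {σ : Finset Plane} (hσ : σ ∈ Δ.triangles)
    (hvw : v ≠ w) (hs : {v, w} ⊆ σ) : {v, w} ∈ Δ.edges := by
  obtain ⟨c, rfl⟩ := Δ.exists_eq_triple_of_subset hσ hvw hs
  exact Δ.pair_mem_edges hσ

theorem exists_boundaryEdge_of_class {v w₀ : Plane} {C : Finset (Finset Plane)}
    (hC : ∀ σ ∈ C, σ ∈ Δ.triangles ∧ v ∈ σ) (hne : C.Nonempty)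
    (hclosed : ∀ σ ∈ C, ∀ σ' ∈ Δ.triangles, ∀ w, w ≠ v → {v, w} ⊆ σ → {v, w} ⊆ σ' → σ' ∈ C)
    (hw₀ : w₀ ≠ v) {σ : Finset Plane} (hσ : σ ∈ Δ.triangles) (hv : v ∈ σ) (hσC : σ ∉ C) :
    ∃ w, {v, w} ∈ Δ.boundaryEdges ∧ (∃ σ ∈ C, {v, w} ⊆ σ) ∧ w ≠ w₀ := by
  by_contra! hcon
  exact hσC (Δ.mem_of_star hC hne hclosed hw₀
    (fun w hw σ hσ hs => hcon w hw ⟨σ, hσ, hs⟩) hσ hv)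

/-- Any two triangles with a common point are linked by a chain of triangles with common edges
through that point. -/
theorem reflTransGen_adjacent {x : Plane} {σ σ' : Finset Plane} (hσ : σ ∈ Δ.triangles)
    (hσ' : σ' ∈ Δ.triangles) (hx : x ∈ hull σ) (hx' : x ∈ hull σ') :
    Relation.ReflTransGen (Δ.Adjacent x) σ σ' := by
  have hi := Δ.mem_hull_inter (Δ.mem_triangles.1 hσ).1 (Δ.mem_triangles.1 hσ').1 hx hx'
  have hcard : (σ ∩ σ').card ≤ 3 := by
    rw [← (Δ.mem_triangles.1 hσ).2]; exact Finset.card_le_card Finset.inter_subset_left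
  have hne : (σ ∩ σ').Nonempty := by
    by_contra h
    rw [Finset.not_nonempty_iff_eq_empty] at h
    rw [h, hull, Finset.coe_empty, convexHull_empty] at hi
    exact hi
  have hpos := hne.card_pos
  obtain h1 | h2 | h3 : (σ ∩ σ').card = 1 ∨ (σ ∩ σ').card = 2 ∨ (σ ∩ σ').card = 3 := by omega
  · obtain ⟨v, hv⟩ := Finset.card_eq_one.1 h1
    rw [hv, hull, Finset.coe_singleton, convexHull_singleton] at hi
    obtain rfl : x = v := hi
    have hxs : x ∈ σ ∩ σ' := by rw [hv]; simp
    rw [Finset.mem_inter] at hxs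
    by_contra hcon
    set C := Δ.triangles.filter fun s => x ∈ s ∧ Relation.ReflTransGen (Δ.Adjacent x) σ s with hC
    set C' := Δ.triangles.filter fun s => x ∈ s ∧ ¬ Relation.ReflTransGen (Δ.Adjacent x) σ s with hC'
    have hadj : ∀ s ∈ Δ.triangles, ∀ s' ∈ Δ.triangles, ∀ w, w ≠ x → {x, w} ⊆ s → {x, w} ⊆ s' →
        Δ.Adjacent x s s' := fun s hs s' hs' w hw h h' =>
      ⟨hs, hs', x, w, Δ.pair_mem_edges_of_subset hs hw.symm h, h, h',
        subset_convexHull ℝ _ (by simp)⟩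
    have c1 : ∀ s ∈ C, s ∈ Δ.triangles ∧ x ∈ s := fun s hs =>
      ⟨(Finset.mem_filter.1 hs).1, (Finset.mem_filter.1 hs).2.1⟩
    have c1' : ∀ s ∈ C', s ∈ Δ.triangles ∧ x ∈ s := fun s hs =>
      ⟨(Finset.mem_filter.1 hs).1, (Finset.mem_filter.1 hs).2.1⟩
    have m1 : σ ∈ C := Finset.mem_filter.2 ⟨hσ, hxs.1, Relation.ReflTransGen.refl⟩
    have m1' : σ' ∈ C' := Finset.mem_filter.2 ⟨hσ', hxs.2, hcon⟩
    have n1 : σ' ∉ C := fun h => hcon (Finset.mem_filter.1 h).2.2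
    have n1' : σ ∉ C' := fun h => (Finset.mem_filter.1 h).2.2 Relation.ReflTransGen.refl
    have c2 : ∀ s ∈ C, ∀ s' ∈ Δ.triangles, ∀ w, w ≠ x → {x, w} ⊆ s → {x, w} ⊆ s' → s' ∈ C := by
      intro s hs s' hs' w hw h h'
      exact Finset.mem_filter.2 ⟨hs', h' (by simp),
        (Finset.mem_filter.1 hs).2.2.tail (hadj s (c1 s hs).1 s' hs' w hw h h')⟩
    have c2' : ∀ s ∈ C', ∀ s' ∈ Δ.triangles, ∀ w, w ≠ x → {x, w} ⊆ s → {x, w} ⊆ s' → s' ∈ C' := by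
      intro s hs s' hs' w hw h h'
      exact Finset.mem_filter.2 ⟨hs', h' (by simp), fun hr => (Finset.mem_filter.1 hs).2.2
        (hr.tail (hadj s (c1' s hs).1 s' hs' w hw h h').symm)⟩
    have hne : (x + 1) ≠ x := by
      intro h
      have := congrFun h 0
      simp at this
    obtain ⟨w₁, b1, ⟨s1, hs1, hs1'⟩, -⟩ :=
      Δ.exists_boundaryEdge_of_class c1 ⟨σ, m1⟩ c2 hne hσ' hxs.2 n1
    have hw₁ := (Δ.ne_of_mem_edges (Δ.mem_edges_of_mem_boundaryEdges b1)).symm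
    obtain ⟨w₂, b2, ⟨s2, hs2, hs2'⟩, h21⟩ :=
      Δ.exists_boundaryEdge_of_class c1 ⟨σ, m1⟩ c2 hw₁ hσ' hxs.2 n1
    obtain ⟨w₃, b3, ⟨s3, hs3, hs3'⟩, -⟩ :=
      Δ.exists_boundaryEdge_of_class c1' ⟨σ', m1'⟩ c2' hne hσ hxs.1 n1'
    have hdis : ∀ w, {x, w} ∈ Δ.boundaryEdges → ∀ s ∈ C, {x, w} ⊆ s → w ≠ w₃ := by
      rintro w hb s hs hsub rfl
      obtain ⟨-, u, -, hu⟩ := Finset.mem_filter.1 hb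
      have e1 := hu s ⟨(c1 s hs).1, hsub⟩
      have e2 := hu s3 ⟨(c1' s3 hs3).1, hs3'⟩
      rw [e1, ← e2] at hs
      exact (Finset.mem_filter.1 hs3).2.2 (Finset.mem_filter.1 hs).2.2
    exact Δ.not_three_boundaryEdges b1 b2 b3 h21.symm (hdis w₁ b1 s1 hs1 hs1')
      (hdis w₂ b2 s2 hs2 hs2')
  · obtain ⟨a, b, hab, h⟩ := Finset.card_eq_two.1 h2
    have hs : {a, b} ⊆ σ := by rw [← h]; exact Finset.inter_subset_left
    have hs' : {a, b} ⊆ σ' := by rw [← h]; exact Finset.inter_subset_right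
    refine Relation.ReflTransGen.single ⟨hσ, hσ', a, b, Δ.pair_mem_edges_of_subset hσ hab hs, hs, hs',
      ?_⟩
    rwa [h] at hi
  · have e1 : σ ∩ σ' = σ := Finset.eq_of_subset_of_card_le Finset.inter_subset_left
      (by rw [h3, (Δ.mem_triangles.1 hσ).2])
    have e2 : σ ∩ σ' = σ' := Finset.eq_of_subset_of_card_le Finset.inter_subset_right
      (by rw [h3, (Δ.mem_triangles.1 hσ').2])
    have : σ = σ' := by rw [← e1, e2]
    rw [this]

theorem isPreconnected_interior : IsPreconnected (interior Δ.domain) :=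
  Δ.polygonal.2.1.isPreconnected

theorem exists_mem_interior {σ : Finset Plane} (hσ : σ ∈ Δ.triangles) :
    ∃ x ∈ hull σ, hull σ ∈ 𝓝 x := by
  obtain ⟨a, b, c, rfl⟩ := Δ.exists_eq_triple hσ
  have h := eventually_mem_hull_of_pos (Δ.orient_ne_zero hσ)
    (x := (1 / 3 : ℝ) • a + (1 / 3 : ℝ) • b + (1 / 3 : ℝ) • c)
    (show (0 : ℝ) < 1 / 3 by norm_num) (show (0 : ℝ) < 1 / 3 by norm_num)
    (show (0 : ℝ) < 1 / 3 by norm_num) (by norm_num) rfl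
  exact ⟨_, h.self_of_nhds, h⟩

/-- The triangles are connected through common edges. -/
theorem mem_of_closed_under_adjacent {C : Finset (Finset Plane)} (hC : C ⊆ Δ.triangles)
    (hne : C.Nonempty) (hclosed : ∀ σ ∈ C, ∀ x σ', Δ.Adjacent x σ σ' → σ' ∈ C) {σ : Finset Plane}
    (hσ : σ ∈ Δ.triangles) : σ ∈ C := by
  by_contra hσC
  set U : Set Plane := ⋃ s ∈ C, hull s
  set U' : Set Plane := ⋃ s ∈ Δ.triangles \ C, hull s
  have hsub : ∀ s ∈ Δ.triangles, hull s ⊆ Δ.domain := fun s hs x hx => Δ.mem_domain.2 ⟨s, hs, hx⟩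
  have h1 : interior Δ.domain ⊆ U ∪ U' := by
    intro x hx
    obtain ⟨s, hs, hxs⟩ := Δ.mem_domain.1 (interior_subset hx)
    by_cases h : s ∈ C
    · exact Or.inl (Set.mem_iUnion₂.2 ⟨s, h, hxs⟩)
    · exact Or.inr (Set.mem_iUnion₂.2 ⟨s, Finset.mem_sdiff.2 ⟨hs, h⟩, hxs⟩)
  have h2 : (interior Δ.domain ∩ U).Nonempty := by
    obtain ⟨s, hs⟩ := hne
    obtain ⟨x, hx, hn⟩ := Δ.exists_mem_interior (hC hs)
    exact ⟨x, mem_interior_iff_mem_nhds.2 (Filter.mem_of_superset hn (hsub s (hC hs))),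
      Set.mem_iUnion₂.2 ⟨s, hs, hx⟩⟩
  have h3 : (interior Δ.domain ∩ U').Nonempty := by
    obtain ⟨x, hx, hn⟩ := Δ.exists_mem_interior hσ
    exact ⟨x, mem_interior_iff_mem_nhds.2 (Filter.mem_of_superset hn (hsub σ hσ)),
      Set.mem_iUnion₂.2 ⟨σ, Finset.mem_sdiff.2 ⟨hσ, hσC⟩, hx⟩⟩
  obtain ⟨x, -, hx, hx'⟩ := isPreconnected_closed_iff.1 Δ.isPreconnected_interior U U'
    (Set.Finite.isClosed_biUnion C.finite_toSet fun σ _ => isClosed_hull σ)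
    (Set.Finite.isClosed_biUnion (Δ.triangles \ C).finite_toSet fun σ _ => isClosed_hull σ) h1 h2 h3
  obtain ⟨s, hs, hxs⟩ := Set.mem_iUnion₂.1 hx
  obtain ⟨s', hs', hxs'⟩ := Set.mem_iUnion₂.1 hx'
  rw [Finset.mem_sdiff] at hs'
  have hr := Δ.reflTransGen_adjacent (hC hs) hs'.1 hxs hxs'
  apply hs'.2
  clear hxs' hs' hx'
  induction hr with
  | refl => exact hs
  | tail _ hab ih => exact hclosed _ ih _ _ hab

theorem isPreconnected_frontier : IsPreconnected (frontier Δ.domain) := by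
  obtain ⟨-, -, n, P, ⟨hn, -, -⟩, hF⟩ := Δ.polygonal
  have : NeZero n := ⟨by omega⟩
  have h : frontier Δ.domain = ⋃ k : ℕ, segment ℝ (P (k : ZMod n)) (P ((k : ZMod n) + 1)) := by
    rw [domain, hF]
    ext x
    simp only [Set.mem_iUnion]
    constructor
    · rintro ⟨i, hi⟩
      exact ⟨i.val, by simpa using hi⟩
    · rintro ⟨k, hk⟩
      exact ⟨_, hk⟩
  rw [h]
  refine IsPreconnected.iUnion_of_chain (fun k => (convex_segment _ _).isPreconnected) fun k => ?_
  refine ⟨P ((k : ZMod n) + 1), right_mem_segment ℝ _ _, ?_⟩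
  rw [Nat.succ_eq_succ, Nat.succ_eq_add_one, Nat.cast_add, Nat.cast_one]
  exact left_mem_segment ℝ _ _

theorem hull_inter_frontier_nonempty {τ : Finset Plane} (h : τ ∈ Δ.boundaryEdges) :
    (hull τ ∩ frontier Δ.domain).Nonempty := by
  obtain ⟨a, b, -, rfl⟩ := Finset.card_eq_two.1
    (Δ.mem_edges.1 (Δ.mem_edges_of_mem_boundaryEdges h)).2
  have hb : Between a b ((1 / 2 : ℝ) • a + (1 / 2 : ℝ) • b) :=
    ⟨1 / 2, 1 / 2, by norm_num, by norm_num, by norm_num, rfl⟩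
  exact ⟨_, hb.mem_hull subset_rfl, Δ.between_mem_frontier h hb⟩

/-- The boundary edges form a connected graph. -/
theorem mem_of_closed_under_boundary {C : Finset (Finset Plane)} (hC : C ⊆ Δ.boundaryEdges)
    (hne : C.Nonempty)
    (hclosed : ∀ τ ∈ C, ∀ τ' ∈ Δ.boundaryEdges, (τ ∩ τ').Nonempty → τ' ∈ C) {τ : Finset Plane}
    (hτ : τ ∈ Δ.boundaryEdges) : τ ∈ C := by
  by_contra hτC
  set U : Set Plane := ⋃ s ∈ C, hull s
  set U' : Set Plane := ⋃ s ∈ Δ.boundaryEdges \ C, hull s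
  have h1 : frontier Δ.domain ⊆ U ∪ U' := by
    intro x hx
    obtain ⟨s, hs, hxs⟩ := Δ.exists_boundaryEdge_of_mem_frontier hx
    by_cases h : s ∈ C
    · exact Or.inl (Set.mem_iUnion₂.2 ⟨s, h, hxs⟩)
    · exact Or.inr (Set.mem_iUnion₂.2 ⟨s, Finset.mem_sdiff.2 ⟨hs, h⟩, hxs⟩)
  have h2 : (frontier Δ.domain ∩ U).Nonempty := by
    obtain ⟨s, hs⟩ := hne
    obtain ⟨x, hx, hn⟩ := Δ.hull_inter_frontier_nonempty (hC hs)
    exact ⟨x, hn, Set.mem_iUnion₂.2 ⟨s, hs, hx⟩⟩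
  have h3 : (frontier Δ.domain ∩ U').Nonempty := by
    obtain ⟨x, hx, hn⟩ := Δ.hull_inter_frontier_nonempty hτ
    exact ⟨x, hn, Set.mem_iUnion₂.2 ⟨τ, Finset.mem_sdiff.2 ⟨hτ, hτC⟩, hx⟩⟩
  obtain ⟨x, -, hx, hx'⟩ := isPreconnected_closed_iff.1 Δ.isPreconnected_frontier U U'
    (Set.Finite.isClosed_biUnion C.finite_toSet fun σ _ => isClosed_hull σ)
    (Set.Finite.isClosed_biUnion (Δ.boundaryEdges \ C).finite_toSet fun σ _ => isClosed_hull σ)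
    h1 h2 h3
  obtain ⟨s, hs, hxs⟩ := Set.mem_iUnion₂.1 hx
  obtain ⟨s', hs', hxs'⟩ := Set.mem_iUnion₂.1 hx'
  rw [Finset.mem_sdiff] at hs'
  have hf : ∀ s ∈ Δ.boundaryEdges, s ∈ Δ.faces := fun s hs =>
    (Δ.mem_edges.1 (Δ.mem_edges_of_mem_boundaryEdges hs)).1
  have hi := Δ.mem_hull_inter (hf s (hC hs)) (hf s' hs'.1) hxs hxs'
  refine hs'.2 (hclosed s hs s' hs'.1 ?_)
  by_contra h
  rw [Finset.not_nonempty_iff_eq_empty] at h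
  rw [h, hull, Finset.coe_empty, convexHull_empty] at hi
  exact hi

end PlanarTriangulation
end SplineTriangulation

end

noncomputable section

open Topology Filter

namespace SplineTriangulation
namespace PlanarTriangulation

theorem lexLT_ne {a b : Plane} (h : LexLT a b) : a ≠ b := by
  rintro rfl; exact lexLT_irrefl _ h

theorem incidence_pair_right {a b : Plane} (h : LexLT a b) : incidence {a, b} {b} = 1 := by
  have hne : b ≠ a := (lexLT_ne h).symm
  have h' : ¬ LexLT b a := by
    rcases lexLT_trichotomy hne with h' | h'
    · exact absurd h h'.2
    · exact h'.2
  rw [Finset.pair_comm, incidence_pair hne, if_neg h']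

theorem incidence_pair_left {a b : Plane} (h : LexLT a b) : incidence {a, b} {a} = -1 := by
  rw [incidence_pair (lexLT_ne h), if_pos h]

theorem exists_lexLT_of_card_eq_two {τ : Finset Plane} (h : τ.card = 2) :
    ∃ a b, LexLT a b ∧ τ = {a, b} := by
  obtain ⟨a, b, hab, rfl⟩ := Finset.card_eq_two.1 h
  rcases lexLT_trichotomy hab with h | h
  · exact ⟨a, b, h.1, rfl⟩
  · exact ⟨b, a, h.1, Finset.pair_comm _ _⟩

/-- A weighted sum over the vertices of the boundary of an edge. -/
theorem sum_mul_incidence {a b : Plane} (h : LexLT a b) {V : Finset Plane} (ha : a ∈ V) (hb : b ∈ V)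
    (S : Plane → ℤ) : ∑ v ∈ V, S v * incidence {a, b} {v} = S b - S a := by
  rw [← Finset.sum_subset (s₁ := {a, b}), Finset.sum_pair (lexLT_ne h), incidence_pair_left h,
    incidence_pair_right h]
  · ring
  · intro x; simp; rintro (rfl | rfl) <;> assumption
  · intro x _ hx; rw [incidence_eq_zero_of_notMem hx, mul_zero]

/-- The number of crossings of the upward vertical ray from `x` with the segment from `a` to `b`,
if `b` lies to the right of `a`. -/
def rayCross (a b x : Plane) : ℤ := if a 0 ≤ x 0 ∧ x 0 < b 0 ∧ orient a b x < 0 then 1 else 0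

/-- The indicator function of the region above the segment from `x` to `x'`. -/
def above (x x' p : Plane) : ℤ := if x 0 < p 0 ∧ p 0 ≤ x' 0 ∧ 0 < orient x x' p then 1 else 0

theorem pos_iff_pos_of_ne_zero {u v : ℝ}
    (h : ∀ t : ℝ, 0 ≤ t → t ≤ 1 → (1 - t) * u + t * v ≠ 0) : 0 < u ↔ 0 < v := by
  have key : ∀ u v : ℝ, (∀ t : ℝ, 0 ≤ t → t ≤ 1 → (1 - t) * u + t * v ≠ 0) → 0 < u → 0 < v := by
    intro u v h hu
    by_contra hv
    push Not at hv
    have h0 : 0 < u - v := by linarith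
    refine h (u / (u - v)) (by positivity) ((div_le_one h0).2 (by linarith)) ?_
    field_simp
    ring
  refine ⟨key u v h, key v u fun t h0 h1 => ?_⟩
  have := h (1 - t) (by linarith) (by linarith)
  rwa [sub_sub_cancel, add_comm] at this

theorem comb_mem_hull {a b p q : Plane} (hp : p ∈ hull {a, b}) (hq : q ∈ hull {a, b}) {t : ℝ}
    (h0 : 0 ≤ t) (h1 : t ≤ 1) : (1 - t) • p + t • q ∈ hull {a, b} :=
  convex_convexHull ℝ _ hp hq (by linarith) h0 (by ring)

theorem orient_ne_zero_of_disjoint {a b x x' p : Plane} (hd : Disjoint (hull {a, b}) (hull {x, x'}))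
    (hp : p ∈ hull {a, b}) (h0 : x 0 < x' 0) (h1 : x 0 ≤ p 0) (h2 : p 0 ≤ x' 0) :
    orient x x' p ≠ 0 := by
  intro h
  refine Set.disjoint_left.1 hd hp (mem_convexHull_pair.2
    ⟨(x' 0 - p 0) / (x' 0 - x 0), (p 0 - x 0) / (x' 0 - x 0), div_nonneg (by linarith) (by linarith),
      div_nonneg (by linarith) (by linarith), ?_, ?_⟩)
  · rw [← add_div, div_eq_one_iff_eq] <;> linarith
  · have hne : x' 0 - x 0 ≠ 0 := by linarith
    simp only [orient] at h
    ext i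
    fin_cases i
    · simp; field_simp; ring
    · simp; field_simp; linarith

theorem orient_pos_iff_of_disjoint {a b x x' p q : Plane}
    (hd : Disjoint (hull {a, b}) (hull {x, x'})) (hp : p ∈ hull {a, b}) (hq : q ∈ hull {a, b})
    (h0 : x 0 < x' 0) (h1 : x 0 ≤ p 0) (h2 : p 0 ≤ x' 0) (h3 : x 0 ≤ q 0) (h4 : q 0 ≤ x' 0) :
    0 < orient x x' p ↔ 0 < orient x x' q := by
  refine pos_iff_pos_of_ne_zero fun t ht0 ht1 => ?_
  rw [← orient_comb₂ (by ring)]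
  refine orient_ne_zero_of_disjoint hd (comb_mem_hull hp hq ht0 ht1) h0 ?_ ?_
  · simp only [Pi.add_apply, Pi.smul_apply, smul_eq_mul]; nlinarith
  · simp only [Pi.add_apply, Pi.smul_apply, smul_eq_mul]; nlinarith

theorem exists_mem_hull_over {a b : Plane} {u : ℝ} (h : a 0 < b 0) (h1 : a 0 ≤ u) (h2 : u ≤ b 0) :
    ∃ q ∈ hull {a, b}, q 0 = u ∧ (b 0 - a 0) * (q 1 - a 1) = (b 1 - a 1) * (u - a 0) := by
  have hne : b 0 - a 0 ≠ 0 := by linarith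
  refine ⟨((b 0 - u) / (b 0 - a 0)) • a + ((u - a 0) / (b 0 - a 0)) • b,
    mem_convexHull_pair.2 ⟨_, _, div_nonneg (by linarith) (by linarith),
      div_nonneg (by linarith) (by linarith), ?_, rfl⟩, ?_, ?_⟩
  · rw [← add_div, div_eq_one_iff_eq] <;> linarith
  · simp; field_simp; ring
  · simp; field_simp; ring

theorem neg_iff_pos_of_eq {u v y z : ℝ} (hu : 0 < u) (hv : 0 < v) (h : u * y = -(v * z)) :
    z < 0 ↔ 0 < y := by
  constructor
  · intro hz
    have : 0 < u * y := by rw [h]; nlinarith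
    exact pos_of_mul_pos_right this hu.le
  · intro hy
    have : 0 < u * y := by positivity
    nlinarith

/-- Crossing numbers of the two end points of a segment that does not meet the edge. -/
theorem rayCross_sub_rayCross {a b x x' : Plane} (hab : LexLT a b) (hx : x 0 ≤ x' 0)
    (hd : Disjoint (hull {a, b}) (hull {x, x'})) :
    rayCross a b x - rayCross a b x' = above x x' b - above x x' a := by
  have ha : a ∈ hull {a, b} := subset_convexHull ℝ _ (by simp)
  have hb : b ∈ hull {a, b} := subset_convexHull ℝ _ (by simp)
  have hxm : x ∈ hull {x, x'} := subset_convexHull ℝ _ (by simp)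
  have hxm' : x' ∈ hull {x, x'} := subset_convexHull ℝ _ (by simp)
  have hab' : a 0 ≤ b 0 := by rcases hab with h | h; exacts [h.le, h.1.le]
  have F1 : a 0 ≤ x 0 → x 0 < b 0 → b 0 ≤ x' 0 → (orient a b x < 0 ↔ 0 < orient x x' b) := by
    intro h1 h2 h3
    obtain ⟨q, hq, hq0, hq1⟩ := exists_mem_hull_over (by linarith) h1 h2.le
    rw [orient_pos_iff_of_disjoint hd hb hq (by linarith) h2.le h3 hq0.ge (by linarith)]
    refine neg_iff_pos_of_eq (u := b 0 - a 0) (v := x' 0 - x 0) (by linarith) (by linarith) ?_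
    simp only [orient, hq0]
    linear_combination (x' 0 - x 0) * hq1
  have F2 : a 0 ≤ x 0 → x' 0 ≤ b 0 → a 0 < b 0 → (orient a b x < 0 ↔ orient a b x' < 0) := by
    intro h1 h2 h3
    have e1 := orient_pos_iff_of_disjoint hd.symm hxm hxm' h3 h1 (by linarith) (by linarith) h2
    have n1 := orient_ne_zero_of_disjoint hd.symm hxm h3 h1 (by linarith)
    have n2 := orient_ne_zero_of_disjoint hd.symm hxm' h3 (by linarith) h2
    rw [← not_le, ← not_le, n1.symm.le_iff_lt, n2.symm.le_iff_lt, e1]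
  have F3 : x 0 ≤ a 0 → b 0 ≤ x' 0 → x 0 < x' 0 → (0 < orient x x' a ↔ 0 < orient x x' b) :=
    fun h1 h2 h3 => orient_pos_iff_of_disjoint hd ha hb h3 h1 (by linarith) (by linarith) h2
  have F4 : x 0 < a 0 → a 0 ≤ x' 0 → x' 0 < b 0 → (orient a b x' < 0 ↔ 0 < orient x x' a) := by
    intro h1 h2 h3
    obtain ⟨q, hq, hq0, hq1⟩ := exists_mem_hull_over (by linarith) h2 h3.le
    rw [orient_pos_iff_of_disjoint hd ha hq (by linarith) h1.le h2 (by linarith) hq0.le]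
    refine neg_iff_pos_of_eq (u := b 0 - a 0) (v := x' 0 - x 0) (by linarith) (by linarith) ?_
    simp only [orient, hq0]
    linear_combination (x' 0 - x 0) * hq1
  simp only [rayCross, above]
  grind

end PlanarTriangulation
end SplineTriangulation

end

noncomputable section

open Topology Filter

namespace SplineTriangulation
namespace PlanarTriangulation

variable (Δ : PlanarTriangulation) {A : Type*} [AddCommGroup A]

theorem mem_vertexSet {v : Plane} {τ : Finset Plane} (hτ : τ ∈ Δ.edges) (hv : v ∈ τ) :
    v ∈ Δ.vertexSet :=
  Finset.mem_biUnion.2 ⟨τ, (Finset.mem_filter.1 hτ).1, hv⟩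

/-- The winding number of a chain of edges around a point. -/
def winding (z : Finset Plane → A) (x : Plane) : A :=
  ∑ τ ∈ Δ.edges, (∑ a ∈ τ, ∑ b ∈ τ, rayCross a b x) • z τ

theorem sum_rayCross {a b : Plane} (h : LexLT a b) (x : Plane) :
    ∑ p ∈ ({a, b} : Finset Plane), ∑ q ∈ ({a, b} : Finset Plane), rayCross p q x =
      rayCross a b x := by
  have hab' : a 0 ≤ b 0 := by rcases h with h | h; exacts [h.le, h.1.le]
  have h0 : ∀ p q : Plane, q 0 ≤ p 0 → rayCross p q x = 0 := fun p q hpq =>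
    if_neg fun hh => by linarith [hh.1, hh.2.1]
  rw [Finset.sum_pair (lexLT_ne h), Finset.sum_pair (lexLT_ne h), Finset.sum_pair (lexLT_ne h),
    h0 a a le_rfl, h0 b a hab', h0 b b le_rfl]
  simp

theorem sum_incidence_smul_eq_zero {z : Finset Plane → A}
    (hz : ∀ v ∈ Δ.vertexSet, ∑ τ ∈ Δ.edges, incidence τ {v} • z τ = 0) (S : Plane → ℤ) :
    ∑ τ ∈ Δ.edges, (∑ v ∈ Δ.vertexSet, S v * incidence τ {v}) • z τ = 0 := by
  simp_rw [Finset.sum_smul]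
  rw [Finset.sum_comm]
  refine Finset.sum_eq_zero fun v hv => ?_
  simp_rw [mul_smul]
  rw [← Finset.smul_sum, hz v hv, smul_zero]

theorem winding_sub_winding {z : Finset Plane → A}
    (hz : ∀ v ∈ Δ.vertexSet, ∑ τ ∈ Δ.edges, incidence τ {v} • z τ = 0) {x x' : Plane}
    (hx : x 0 ≤ x' 0) {E : Finset (Finset Plane)} (hE : E ⊆ Δ.edges)
    (hd : ∀ τ ∈ Δ.edges, τ ∉ E → Disjoint (hull τ) (hull {x, x'})) :
    Δ.winding z x - Δ.winding z x' = ∑ τ ∈ E, ((∑ a ∈ τ, ∑ b ∈ τ, rayCross a b x) -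
      (∑ a ∈ τ, ∑ b ∈ τ, rayCross a b x') -
        ∑ v ∈ Δ.vertexSet, above x x' v * incidence τ {v}) • z τ := by
  have := Δ.sum_incidence_smul_eq_zero hz (above x x')
  rw [← sub_zero (_ - _), ← this, winding, winding, ← Finset.sum_sub_distrib,
    ← Finset.sum_sub_distrib]
  simp_rw [← sub_smul]
  refine (Finset.sum_subset hE fun τ hτ hτE => ?_).symm
  obtain ⟨a, b, hab, rfl⟩ := exists_lexLT_of_card_eq_two (Δ.mem_edges.1 hτ).2
  rw [sum_rayCross hab, sum_rayCross hab, sum_mul_incidence hab (Δ.mem_vertexSet hτ (by simp))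
    (Δ.mem_vertexSet hτ (by simp)), rayCross_sub_rayCross hab hx (hd _ hτ hτE), sub_self, zero_smul]

/-- The relative interior of the convex hull of `σ`. -/
def Inner (σ : Finset Plane) (x : Plane) : Prop :=
  ∃ f : Plane → ℝ, (∀ v ∈ σ, 0 < f v) ∧ ∑ v ∈ σ, f v = 1 ∧ x = ∑ v ∈ σ, f v • v

theorem exists_inner {σ : Finset Plane} (h : σ ∈ Δ.triangles) : ∃ x, Inner σ x := by
  refine ⟨_, fun _ => 1 / 3, fun _ _ => by norm_num, ?_, rfl⟩
  simp [(Δ.mem_triangles.1 h).2]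

theorem Inner.comb {σ : Finset Plane} {x y : Plane} (hx : Inner σ x) (hy : Inner σ y) {α β : ℝ}
    (hα : 0 ≤ α) (hβ : 0 ≤ β) (h : α + β = 1) : Inner σ (α • x + β • y) := by
  obtain ⟨f, hf, hf1, rfl⟩ := hx
  obtain ⟨g, hg, hg1, rfl⟩ := hy
  refine ⟨fun v => α * f v + β * g v, fun v hv => ?_, ?_, ?_⟩
  · rcases hα.eq_or_lt with rfl | hα
    · have : β = 1 := by linarith
      simpa [this] using hg v hv
    · have := hf v hv; have := hg v hv; positivity
  · rw [Finset.sum_add_distrib, ← Finset.mul_sum, ← Finset.mul_sum, hf1, hg1]; linarith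
  · simp_rw [Finset.smul_sum, smul_smul, add_smul, Finset.sum_add_distrib]

theorem Inner.notMem_hull {Δ : PlanarTriangulation} {σ τ : Finset Plane} {x : Plane} (hx : Inner σ x)
    (hσ : σ ∈ Δ.triangles) (hτ : τ ∈ Δ.edges) : x ∉ hull τ := by
  intro hxτ
  obtain ⟨a, b, c, rfl⟩ := Δ.exists_eq_triple hσ
  obtain ⟨hab, hac, hbc⟩ := Δ.ne_of_mem_triangles hσ
  obtain ⟨f, hf, hf1, rfl⟩ := hx
  have e : ∀ {M : Type} [AddCommMonoid M] (g : Plane → M),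
      ∑ v ∈ ({a, b, c} : Finset Plane), g v = g a + g b + g c := fun g => by
    rw [Finset.sum_insert (by simp [hab, hac]), Finset.sum_pair hbc, add_assoc]
  have hxσ : ∑ v ∈ ({a, b, c} : Finset Plane), f v • v ∈ hull {a, b, c} := by
    refine mem_convexHull_triple.2 ⟨f a, f b, f c, (hf a (by simp)).le, (hf b (by simp)).le,
      (hf c (by simp)).le, by rw [← e f, hf1], e _⟩
  have hi := Δ.mem_hull_inter (Δ.mem_triangles.1 hσ).1 (Δ.mem_edges.1 hτ).1 hxσ hxτ
  rw [e] at hf1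
  have key : ∀ v ∈ ({a, b, c} : Finset Plane), v ∈ {a, b, c} ∩ τ := by
    have p1 : ({b, c, a} : Finset Plane) = {a, b, c} := by ext; simp; tauto
    have p2 : ({c, a, b} : Finset Plane) = {a, b, c} := by ext; simp; tauto
    intro v hv
    rw [e] at hi
    simp only [Finset.mem_insert, Finset.mem_singleton] at hv
    rcases hv with hv | hv | hv <;> rw [hv]
    · exact Δ.mem_of_mem_hull hσ (hf _ (by simp)) hf1 rfl Finset.inter_subset_left hi
    · refine Δ.mem_of_mem_hull (p1 ▸ hσ) (hf b (by simp)) (by linarith) ?_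
        (p1 ▸ Finset.inter_subset_left) hi (β := f c) (γ := f a)
      abel
    · refine Δ.mem_of_mem_hull (p2 ▸ hσ) (hf c (by simp)) (by linarith) ?_
        (p2 ▸ Finset.inter_subset_left) hi (β := f a) (γ := f b)
      abel
  have hle := Finset.card_le_card (fun v hv => (Finset.mem_inter.1 (key v hv)).2 :
    ({a, b, c} : Finset Plane) ⊆ τ)
  rw [(Δ.mem_triangles.1 hσ).2, (Δ.mem_edges.1 hτ).2] at hle
  omega

theorem winding_eq_of_inner {z : Finset Plane → A}
    (hz : ∀ v ∈ Δ.vertexSet, ∑ τ ∈ Δ.edges, incidence τ {v} • z τ = 0) {σ : Finset Plane}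
    (hσ : σ ∈ Δ.triangles) {x x' : Plane} (hx : Inner σ x) (hx' : Inner σ x') :
    Δ.winding z x = Δ.winding z x' := by
  wlog h : x 0 ≤ x' 0 generalizing x x'
  · exact (this hx' hx (le_of_not_ge h)).symm
  have := Δ.winding_sub_winding hz h (Finset.empty_subset _) fun τ hτ _ =>
    Set.disjoint_left.2 fun p hp hp' => by
      obtain ⟨α, β, hα, hβ, hs, rfl⟩ := mem_convexHull_pair.1 hp'
      exact (hx.comb hx' hα hβ hs).notMem_hull hσ hτ hp
  simpa [sub_eq_zero] using this

/-- Points on the side of `c` of the midpoint of `a b` lie inside the triangle. -/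
theorem inner_of_near {a b c : Plane} (h : {a, b, c} ∈ Δ.triangles) :
    ∀ᶠ p in 𝓝 ((1 / 2 : ℝ) • a + (1 / 2 : ℝ) • b),
      0 < orient a b p * orient a b c → Inner {a, b, c} p := by
  have h0 := Δ.orient_ne_zero h
  obtain ⟨hab, hac, hbc⟩ := Δ.ne_of_mem_triangles h
  have h2 : 0 < orient a b c * orient a b c := mul_self_pos.2 h0
  have c1 : Continuous fun p => orient p b c * orient a b c := by
    simp only [orient]; fun_prop
  have c2 : Continuous fun p => orient a p c * orient a b c := by
    simp only [orient]; fun_prop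
  have e1 : ∀ᶠ p in 𝓝 ((1 / 2 : ℝ) • a + (1 / 2 : ℝ) • b), 0 < orient p b c * orient a b c := by
    refine c1.continuousAt.eventually (lt_mem_nhds ?_)
    simp only [orient, Pi.add_apply, Pi.smul_apply, smul_eq_mul] at h2 ⊢
    linarith
  have e2 : ∀ᶠ p in 𝓝 ((1 / 2 : ℝ) • a + (1 / 2 : ℝ) • b), 0 < orient a p c * orient a b c := by
    refine c2.continuousAt.eventually (lt_mem_nhds ?_)
    simp only [orient, Pi.add_apply, Pi.smul_apply, smul_eq_mul] at h2 ⊢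
    linarith
  filter_upwards [e1, e2] with p h1 h2 h3
  have pos : ∀ {u : ℝ}, 0 < u * orient a b c → 0 < u / orient a b c := by
    intro u hu
    rcases h0.lt_or_gt with h | h
    · exact div_pos_of_neg_of_neg (by nlinarith) h
    · exact div_pos (pos_of_mul_pos_left hu h.le) h
  have e : ∀ {M : Type} [AddCommMonoid M] (g : Plane → M),
      ∑ v ∈ ({a, b, c} : Finset Plane), g v = g a + g b + g c := fun g => by
    rw [Finset.sum_insert (by simp [hab, hac]), Finset.sum_pair hbc, add_assoc]
  refine ⟨fun v => if v = a then orient p b c / orient a b c else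
    if v = b then orient a p c / orient a b c else orient a b p / orient a b c, ?_, ?_, ?_⟩
  · intro v _
    dsimp only
    split_ifs
    exacts [pos h1, pos h2, pos h3]
  · rw [e]
    simp only [if_true, if_neg hab.symm, if_neg hac.symm, if_neg hbc.symm]
    rw [← add_div, ← add_div, orient_add_add, div_self h0]
  · rw [e]
    simp only [if_true, if_neg hab.symm, if_neg hac.symm, if_neg hbc.symm]
    exact eq_comb h0 p

/-- The winding number jumps by the coefficient of an edge. -/
theorem winding_sub_winding_across {z : Finset Plane → A}
    (hz : ∀ v ∈ Δ.vertexSet, ∑ τ ∈ Δ.edges, incidence τ {v} • z τ = 0) {a b c c' x x' : Plane}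
    (hab : LexLT a b) (hc : {a, b, c} ∈ Δ.triangles) (hc' : {a, b, c'} ∈ Δ.triangles)
    (h : 0 < orient a b c) (h' : orient a b c' < 0) (hx : Inner {a, b, c} x)
    (hx' : Inner {a, b, c'} x') : Δ.winding z x' - Δ.winding z x = z {a, b} := by
  set m : Plane := (1 / 2 : ℝ) • a + (1 / 2 : ℝ) • b with hm
  have hbt : Between a b m := ⟨1 / 2, 1 / 2, by norm_num, by norm_num, by norm_num, hm⟩
  have hab0 := Δ.pair_mem_edges hc
  have hom : ∀ n : Plane, ∀ u : ℝ, orient a b (m + u • n) = u * orient 0 (b - a) n := by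
    intro n u; simp [orient, hm]; ring
  have key : ∀ n : Plane, 0 < orient 0 (b - a) n → ∃ ε > 0, ∀ u : ℝ, 0 < u → u ≤ ε →
      Inner {a, b, c} (m + u • n) ∧ Inner {a, b, c'} (m + (-u) • n) := by
    intro n hn
    have hcont : Continuous fun u : ℝ => m + u • n := by fun_prop
    have h1 := (hcont.tendsto' 0 m (by simp)).eventually (Δ.inner_of_near hc)
    have hcont' : Continuous fun u : ℝ => m + (-u) • n := by fun_prop
    have h2 := (hcont'.tendsto' 0 m (by simp)).eventually (Δ.inner_of_near hc')
    obtain ⟨δ, hδ, hball⟩ := Metric.eventually_nhds_iff.1 (h1.and h2)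
    refine ⟨δ / 2, by positivity, fun u hu hu' => ?_⟩
    obtain ⟨g1, g2⟩ := hball (y := u) (by rw [Real.dist_eq, sub_zero, abs_of_pos hu]; linarith)
    refine ⟨g1 ?_, g2 ?_⟩
    · rw [hom]; positivity
    · rw [hom]; nlinarith [mul_pos hu hn]
  have avoid : ∀ n : Plane, ∀ ε : ℝ, (∀ u : ℝ, 0 < u → u ≤ ε →
      Inner {a, b, c} (m + u • n) ∧ Inner {a, b, c'} (m + (-u) • n)) →
      ∀ τ ∈ Δ.edges, τ ∉ ({{a, b}} : Finset (Finset Plane)) → ∀ u : ℝ, |u| ≤ ε →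
        m + u • n ∉ hull τ := by
    intro n ε hε τ hτ hne u hu hmem
    rcases lt_trichotomy u 0 with h0 | h0 | h0
    · have := (hε (-u) (by linarith) (by linarith [neg_abs_le u])).2
      rw [neg_neg] at this
      exact this.notMem_hull hc' hτ hmem
    · rw [h0, zero_smul, add_zero] at hmem
      have hs := Δ.subset_of_between hc (Δ.mem_edges.1 hτ).1 hab0 (by intro v; simp; tauto) hbt hmem
      refine hne (Finset.mem_singleton.2 (Finset.eq_of_subset_of_card_le hs ?_).symm)
      rw [(Δ.mem_edges.1 hτ).2, (Δ.mem_edges.1 hab0).2]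
    · exact (hε u h0 ((le_abs_self u).trans hu)).1.notMem_hull hc hτ hmem
  have hE : ({{a, b}} : Finset (Finset Plane)) ⊆ Δ.edges := by simpa using hab0
  have hsa := Δ.mem_vertexSet hab0 (v := a) (by simp)
  have hsb := Δ.mem_vertexSet hab0 (v := b) (by simp)
  rcases hab with h1 | h1
  · have hn : 0 < orient 0 (b - a) ![0, 1] := by simp [orient, h1]
    obtain ⟨ε, hε, hin⟩ := key _ hn
    obtain ⟨i1, i2⟩ := hin ε hε le_rfl
    rw [Δ.winding_eq_of_inner hz hc hx i1, Δ.winding_eq_of_inner hz hc' hx' i2,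
      Δ.winding_sub_winding hz (by simp) hE, Finset.sum_singleton, sum_rayCross (Or.inl h1),
      sum_rayCross (Or.inl h1), sum_mul_incidence (Or.inl h1) hsa hsb]
    · have o1 : orient a b (m + ε • ![0, 1]) > 0 := by rw [hom]; positivity
      have o2 : orient a b (m + (-ε) • ![0, 1]) < 0 := by rw [hom]; nlinarith [mul_pos hε hn]
      have q1 : a 0 ≤ (m + (-ε) • ![0, 1] : Plane) 0 := by simp [hm]; linarith
      have q2 : (m + (-ε) • ![0, 1] : Plane) 0 < b 0 := by simp [hm]; linarith
      rw [rayCross, if_pos ⟨q1, q2, o2⟩, rayCross, if_neg (by rintro ⟨_, _, h⟩; linarith), above,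
        if_neg (by rintro ⟨h, h', _⟩; simp at h h'; linarith), above,
        if_neg (by rintro ⟨h, h', _⟩; simp at h h'; linarith)]
      simp
    · intro τ hτ hne
      refine Set.disjoint_left.2 fun p hp hp' => ?_
      obtain ⟨α, β, hα, hβ, hs, rfl⟩ := mem_convexHull_pair.1 hp'
      refine avoid _ ε hin τ hτ hne (-(α * ε) + β * ε) (abs_le.2 ⟨by nlinarith, by nlinarith⟩) ?_
      convert hp using 1
      rw [show β = 1 - α by linarith]
      module
  · have hn : 0 < orient 0 (b - a) ![-1, 0] := by simp [orient, h1]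
    obtain ⟨ε, hε, hin⟩ := key _ hn
    obtain ⟨i1, i2⟩ := hin ε hε le_rfl
    rw [Δ.winding_eq_of_inner hz hc hx i1, Δ.winding_eq_of_inner hz hc' hx' i2, ← neg_sub,
      Δ.winding_sub_winding hz (by simp; linarith) hE, Finset.sum_singleton,
      sum_rayCross (Or.inr h1), sum_rayCross (Or.inr h1), sum_mul_incidence (Or.inr h1) hsa hsb]
    · rw [rayCross, if_neg (by rintro ⟨_, _, h⟩; linarith), rayCross,
        if_neg (by rintro ⟨_, _, h⟩; linarith), above, if_pos, above, if_neg]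
      · simp
      · rintro ⟨_, _, h⟩
        simp [orient, hm] at h
        nlinarith
      · refine ⟨?_, ?_, ?_⟩
        · simp [hm]; linarith
        · simp [hm]; linarith
        · simp [orient, hm]; nlinarith
    · intro τ hτ hne
      refine Set.disjoint_left.2 fun p hp hp' => ?_
      obtain ⟨α, β, hα, hβ, hs, rfl⟩ := mem_convexHull_pair.1 hp'
      refine avoid _ ε hin τ hτ hne (α * ε - β * ε) (abs_le.2 ⟨by nlinarith, by nlinarith⟩) ?_
      convert hp using 1
      rw [show β = 1 - α by linarith]
      module

end PlanarTriangulation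
end SplineTriangulation

end

noncomputable section

namespace SplineTriangulation
namespace PlanarTriangulation

variable (Δ : PlanarTriangulation) {A : Type*} [AddCommGroup A]

theorem notMem_boundaryEdges {τ : Finset Plane} (h : τ ∈ Δ.interiorEdges) :
    τ ∉ Δ.boundaryEdges := by
  obtain ⟨_, σ, hσ, σ', hσ', hne, h1, h2⟩ := Finset.mem_filter.1 h
  intro hb
  obtain ⟨_, ρ, _, hρ⟩ := Finset.mem_filter.1 hb
  exact hne ((hρ σ ⟨hσ, h1⟩).trans (hρ σ' ⟨hσ', h2⟩).symm)

/-- The boundaries of chains of boundary edges. -/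
def boundaryChains (A : Type*) [AddCommGroup A] : AddSubgroup (Plane → A) where
  carrier := {g | ∃ z : Finset Plane → A, (∀ τ ∉ Δ.boundaryEdges, z τ = 0) ∧
    ∀ v, g v = ∑ τ ∈ Δ.edges, incidence τ {v} • z τ}
  zero_mem' := ⟨0, fun _ _ => rfl, fun v => by simp⟩
  add_mem' := by
    rintro g g' ⟨z, hz, h⟩ ⟨z', hz', h'⟩
    exact ⟨z + z', fun τ hτ => by simp [hz τ hτ, hz' τ hτ],
      fun v => by simp [h v, h' v, smul_add, Finset.sum_add_distrib]⟩
  neg_mem' := by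
    rintro g ⟨z, hz, h⟩
    exact ⟨-z, fun τ hτ => by simp [hz τ hτ], fun v => by simp [h v]⟩

theorem single_sub_single_mem_of_edge {τ : Finset Plane} (hτ : τ ∈ Δ.boundaryEdges) {v w : Plane}
    (hv : v ∈ τ) (hw : w ∈ τ) (u : A) :
    Pi.single v u - Pi.single w u ∈ Δ.boundaryChains A := by
  have hτe := Δ.mem_edges_of_mem_boundaryEdges hτ
  obtain ⟨a, b, hab, rfl⟩ := exists_lexLT_of_card_eq_two (Δ.mem_edges.1 hτe).2
  have key : ∀ u : A, Pi.single b u - Pi.single a u ∈ Δ.boundaryChains A := by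
    intro u
    refine ⟨Pi.single {a, b} u, fun τ hτ' => Pi.single_eq_of_ne (by rintro rfl; exact hτ' hτ) _,
      fun v => ?_⟩
    rw [Finset.sum_eq_single {a, b} (fun τ _ hne => by rw [Pi.single_eq_of_ne hne, smul_zero])
      (fun h => absurd hτe h), Pi.single_eq_same, Pi.sub_apply]
    by_cases h1 : v = a
    · rw [h1, incidence_pair_left hab, Pi.single_eq_same, Pi.single_eq_of_ne (lexLT_ne hab)]
      simp
    by_cases h2 : v = b
    · rw [h2, incidence_pair_right hab, Pi.single_eq_same, Pi.single_eq_of_ne (lexLT_ne hab).symm]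
      simp
    rw [Pi.single_eq_of_ne h1, Pi.single_eq_of_ne h2, incidence_eq_zero_of_notMem (by simp [h1, h2])]
    simp
  simp only [Finset.mem_insert, Finset.mem_singleton] at hv hw
  rcases hv with rfl | rfl <;> rcases hw with rfl | rfl
  · rw [sub_self]; exact zero_mem _
  · rw [← neg_sub]; exact neg_mem (key u)
  · exact key u
  · rw [sub_self]; exact zero_mem _

theorem single_sub_single_mem {τ τ' : Finset Plane} (hτ : τ ∈ Δ.boundaryEdges)
    (hτ' : τ' ∈ Δ.boundaryEdges) {v w : Plane} (hv : v ∈ τ) (hw : w ∈ τ') (u : A) :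
    Pi.single v u - Pi.single w u ∈ Δ.boundaryChains A := by
  have := Δ.mem_of_closed_under_boundary
    (C := Δ.boundaryEdges.filter fun τ => ∀ v ∈ τ, Pi.single v u - Pi.single w u ∈ Δ.boundaryChains A)
    (Finset.filter_subset _ _)
    ⟨τ', Finset.mem_filter.2 ⟨hτ', fun v hv => Δ.single_sub_single_mem_of_edge hτ' hv hw u⟩⟩ ?_ hτ
  · exact (Finset.mem_filter.1 this).2 v hv
  · rintro ρ hρ ρ' hρ' ⟨x, hx⟩
    obtain ⟨hx, hx'⟩ := Finset.mem_inter.1 hx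
    refine Finset.mem_filter.2 ⟨hρ', fun v hv => ?_⟩
    rw [← sub_add_sub_cancel _ (Pi.single x u)]
    exact add_mem (Δ.single_sub_single_mem_of_edge hρ' hv hx' u) ((Finset.mem_filter.1 hρ).2 x hx)

theorem exists_boundaryEdge_of_notMem_interiorVertices {v : Plane} (hv : v ∈ Δ.vertexSet)
    (h : v ∉ Δ.interiorVertices) : ∃ τ ∈ Δ.boundaryEdges, v ∈ τ := by
  by_contra hcon
  push Not at hcon
  exact h (Finset.mem_filter.2 ⟨hv, hcon⟩)

theorem mem_boundaryChains {g : Plane → A} (h1 : ∀ v ∉ Δ.vertexSet, g v = 0)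
    (h2 : ∀ v ∈ Δ.interiorVertices, g v = 0) (h3 : ∑ v ∈ Δ.vertexSet, g v = 0) :
    g ∈ Δ.boundaryChains A := by
  by_cases hne : Δ.boundaryEdges.Nonempty
  · obtain ⟨τ₀, hτ₀⟩ := hne
    obtain ⟨v₀, _, _, rfl⟩ := exists_lexLT_of_card_eq_two
      (Δ.mem_edges.1 (Δ.mem_edges_of_mem_boundaryEdges hτ₀)).2
    have e : g = ∑ v ∈ Δ.vertexSet, (Pi.single v (g v) - Pi.single v₀ (g v)) := by
      have h4 : ∑ v ∈ Δ.vertexSet, (Pi.single v₀ (g v) : Plane → A) = 0 := by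
        have := map_sum (AddMonoidHom.single (fun _ : Plane => A) v₀) g Δ.vertexSet
        simp only [AddMonoidHom.single_apply] at this
        rw [← this, h3, Pi.single_zero]
      rw [Finset.sum_sub_distrib, h4, sub_zero]
      funext w
      rw [Finset.sum_apply]
      by_cases hw : w ∈ Δ.vertexSet
      · rw [Finset.sum_eq_single w (fun v _ hv => Pi.single_eq_of_ne hv.symm _)
          (fun h => absurd hw h), Pi.single_eq_same]
      · rw [h1 w hw, Finset.sum_eq_zero fun v hv => Pi.single_eq_of_ne
          (by rintro rfl; exact hw hv) _]
    rw [e]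
    refine sum_mem fun v hv => ?_
    by_cases hvi : v ∈ Δ.interiorVertices
    · rw [h2 v hvi]; simp
    · obtain ⟨τ, hτ, hvτ⟩ := Δ.exists_boundaryEdge_of_notMem_interiorVertices hv hvi
      exact Δ.single_sub_single_mem hτ hτ₀ hvτ (by simp) _
  · have : g = 0 := by
      funext v
      by_cases hv : v ∈ Δ.vertexSet
      · exact h2 v (Finset.mem_filter.2 ⟨hv, fun τ hτ => absurd ⟨τ, hτ⟩ hne⟩)
      · exact h1 v hv
    rw [this]
    exact zero_mem _

/-- A chain of interior edges that is a cycle at the interior vertices extends to a cycle. -/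
theorem exists_cycle {z₀ : Finset Plane → A}
    (hz : ∀ v ∈ Δ.interiorVertices, ∑ τ ∈ Δ.edges, incidence τ {v} • z₀ τ = 0) :
    ∃ z : Finset Plane → A, (∀ τ ∈ Δ.interiorEdges, z τ = z₀ τ) ∧
      ∀ v ∈ Δ.vertexSet, ∑ τ ∈ Δ.edges, incidence τ {v} • z τ = 0 := by
  have h1 : ∀ v ∉ Δ.vertexSet, ∑ τ ∈ Δ.edges, incidence τ {v} • z₀ τ = 0 := fun v hv =>
    Finset.sum_eq_zero fun τ hτ => by
      rw [incidence_eq_zero_of_notMem fun h => hv (Δ.mem_vertexSet hτ h), zero_smul]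
  have h3 : ∑ v ∈ Δ.vertexSet, ∑ τ ∈ Δ.edges, incidence τ {v} • z₀ τ = 0 := by
    rw [Finset.sum_comm]
    refine Finset.sum_eq_zero fun τ hτ => ?_
    rw [← Finset.sum_smul]
    obtain ⟨a, b, hab, rfl⟩ := exists_lexLT_of_card_eq_two (Δ.mem_edges.1 hτ).2
    have := sum_mul_incidence hab (Δ.mem_vertexSet hτ (v := a) (by simp))
      (Δ.mem_vertexSet hτ (v := b) (by simp)) 1
    simp only [Pi.one_apply, one_mul, sub_self] at this
    rw [this, zero_smul]
  obtain ⟨z, hz1, hz2⟩ := Δ.mem_boundaryChains h1 hz h3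
  refine ⟨z₀ - z, fun τ hτ => ?_, fun v hv => ?_⟩
  · rw [Pi.sub_apply, hz1 τ (Δ.notMem_boundaryEdges hτ), sub_zero]
  · simp only [Pi.sub_apply, smul_sub, Finset.sum_sub_distrib]
    rw [← hz2 v, sub_self]

/-- The orientation of a triangle relative to the lexicographic order of its vertices. -/
theorem exists_orientation {σ : Finset Plane} (hσ : σ ∈ Δ.triangles) :
    ∃ o : ℤ, o * o = 1 ∧ ∀ a b c, σ = {a, b, c} → LexLT a b →
      incidence σ {a, b} = o * (if 0 < orient a b c then 1 else -1) := by
  have key : ∀ a b c, {a, b, c} ∈ Δ.triangles → LexLT a b → LexLT b c →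
      ∃ o : ℤ, o * o = 1 ∧ ∀ a' b' c', ({a, b, c} : Finset Plane) = {a', b', c'} → LexLT a' b' →
      incidence {a, b, c} {a', b'} = o * (if 0 < orient a' b' c' then 1 else -1) := by
    intro a b c h hab hbc
    have h0 := Δ.orient_ne_zero h
    obtain ⟨nab, nac, nbc⟩ := Δ.ne_of_mem_triangles h
    have hac : LexLT a c := by
      simp only [LexLT] at hab hbc ⊢
      grind
    have o1 := orient_rotate a b c
    have o2 := orient_swap' a b c
    have as : ∀ {p q : Plane}, LexLT p q → ¬ LexLT q p := by
      intro p q hpq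
      simp only [LexLT] at hpq ⊢
      grind
    refine ⟨if 0 < orient a b c then 1 else -1, by split_ifs <;> rfl, fun a' b' c' he hl => ?_⟩
    rw [he] at h
    obtain ⟨n1, n2, n3⟩ := Δ.ne_of_mem_triangles h
    rw [he, incidence_triple n1 n2 n3]
    have ma : a' ∈ ({a, b, c} : Finset Plane) := by rw [he]; simp
    have mb : b' ∈ ({a, b, c} : Finset Plane) := by rw [he]; simp
    have mc : c' ∈ ({a, b, c} : Finset Plane) := by rw [he]; simp
    simp only [Finset.mem_insert, Finset.mem_singleton] at ma mb mc
    rcases ma with rfl | rfl | rfl <;> rcases mb with rfl | rfl | rfl <;>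
      first
      | exact absurd rfl n1
      | exact absurd hl (as hab)
      | exact absurd hl (as hbc)
      | exact absurd hl (as hac)
      | (rcases mc with rfl | rfl | rfl <;>
          first
          | exact absurd rfl n2
          | exact absurd rfl n3
          | (simp only [hab, hbc, hac, as hab, as hbc, as hac, if_true, if_false, o1, o2]
             split_ifs <;> first | rfl | (exfalso; grind)))
  obtain ⟨a, b, c, rfl⟩ := Δ.exists_eq_triple hσ
  obtain ⟨nab, nac, nbc⟩ := Δ.ne_of_mem_triangles hσ
  have p1 : ({a, b, c} : Finset Plane) = {a, c, b} := by ext; simp; tauto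
  have p2 : ({a, b, c} : Finset Plane) = {b, a, c} := by ext; simp; tauto
  have p3 : ({a, b, c} : Finset Plane) = {b, c, a} := by ext; simp; tauto
  have p4 : ({a, b, c} : Finset Plane) = {c, a, b} := by ext; simp; tauto
  have p5 : ({a, b, c} : Finset Plane) = {c, b, a} := by ext; simp; tauto
  rcases lexLT_trichotomy nab with h1 | h1 <;> rcases lexLT_trichotomy nac with h2 | h2 <;>
    rcases lexLT_trichotomy nbc with h3 | h3
  · exact key a b c hσ h1.1 h3.1
  · rw [p1] at hσ ⊢; exact key _ _ _ hσ h2.1 h3.1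
  · exact key a b c hσ h1.1 h3.1
  · rw [p4] at hσ ⊢; exact key _ _ _ hσ h2.1 h1.1
  · rw [p2] at hσ ⊢; exact key _ _ _ hσ h1.1 h2.1
  · rw [p5] at hσ ⊢; exact key _ _ _ hσ h3.1 h1.1
  · rw [p3] at hσ ⊢; exact key _ _ _ hσ h3.1 h2.1
  · rw [p5] at hσ ⊢; exact key _ _ _ hσ h3.1 h1.1

/-- A choice of orientations. -/
def orientation (σ : Finset Plane) : ℤ :=
  if h : σ ∈ Δ.triangles then (Δ.exists_orientation h).choose else 1

theorem orientation_mul_self (σ : Finset Plane) : Δ.orientation σ * Δ.orientation σ = 1 := by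
  rw [orientation]
  split_ifs with h
  · exact (Δ.exists_orientation h).choose_spec.1
  · rfl

theorem incidence_eq_orientation {a b c : Plane} (h : {a, b, c} ∈ Δ.triangles) (hab : LexLT a b) :
    incidence {a, b, c} {a, b} =
      Δ.orientation {a, b, c} * (if 0 < orient a b c then 1 else -1) := by
  rw [orientation, dif_pos h]
  exact (Δ.exists_orientation h).choose_spec.2 a b c rfl hab

theorem incidence_eq_zero_of_not_subset {σ τ : Finset Plane} (h : ¬ τ ⊆ σ) : incidence σ τ = 0 :=
  Finset.sum_eq_zero fun u _ => if_neg fun hu => h (by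
    rw [← hu]; exact Finset.erase_subset u σ)

theorem boundary₂_apply (p : Δ.triangles → R) (τ : Δ.interiorEdges) :
    Δ.boundary₂ p τ = ∑ σ : Δ.triangles, incidence σ.1 τ.1 • p σ := by
  simp [boundary₂]

theorem boundary₁_apply (c : Δ.interiorEdges → R) (γ : Δ.interiorVertices) :
    Δ.boundary₁ c γ = ∑ τ : Δ.interiorEdges, incidence τ.1 {γ.1} • c τ := by
  simp [boundary₁]

/-- The boundary at an interior edge. -/
theorem exists_boundary₂_eq (τ : Δ.interiorEdges) :
    ∃ (a b c c' : Plane) (h : {a, b, c} ∈ Δ.triangles) (h' : {a, b, c'} ∈ Δ.triangles),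
      LexLT a b ∧ τ.1 = {a, b} ∧ 0 < orient a b c ∧ orient a b c' < 0 ∧
      (∀ σ ∈ Δ.triangles, {a, b} ⊆ σ → σ = {a, b, c} ∨ σ = {a, b, c'}) ∧
      ∀ p : Δ.triangles → R, Δ.boundary₂ p τ = Δ.orientation {a, b, c} • p ⟨_, h⟩ -
        Δ.orientation {a, b, c'} • p ⟨_, h'⟩ := by
  obtain ⟨τ, hτ⟩ := τ
  obtain ⟨a, b, hab, rfl⟩ := exists_lexLT_of_card_eq_two
    (Δ.mem_edges.1 (Finset.mem_filter.1 hτ).1).2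
  obtain ⟨c, c', h, h', ho, ho', hall⟩ := Δ.exists_triangles_of_mem_interiorEdges hτ
  refine ⟨a, b, c, c', h, h', hab, rfl, ho, ho', hall, fun p => ?_⟩
  have hne : (⟨_, h⟩ : Δ.triangles) ≠ ⟨_, h'⟩ := by
    intro he
    have he : ({a, b, c} : Finset Plane) = {a, b, c'} := congrArg Subtype.val he
    have hc : c ∈ ({a, b, c'} : Finset Plane) := by rw [← he]; simp
    obtain ⟨_, n2, n3⟩ := Δ.ne_of_mem_triangles h
    simp only [Finset.mem_insert, Finset.mem_singleton] at hc
    rcases hc with rfl | rfl | rfl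
    · exact n2 rfl
    · exact n3 rfl
    · linarith
  rw [boundary₂_apply, ← Finset.sum_subset (Finset.subset_univ {⟨_, h⟩, ⟨_, h'⟩}),
    Finset.sum_pair hne]
  · dsimp only
    rw [Δ.incidence_eq_orientation h hab, Δ.incidence_eq_orientation h' hab, if_pos ho,
      if_neg ho'.not_gt, mul_one, mul_neg_one, neg_smul, sub_eq_add_neg]
  · rintro ⟨σ, hσ⟩ _ hn
    dsimp only
    rw [incidence_eq_zero_of_not_subset, zero_smul]
    intro hs
    refine hn ?_
    rcases hall σ hσ hs with rfl | rfl <;> simp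

/-- Exactness of the complex `𝓡` at the interior edges. -/
theorem exists_boundary₂_eq_of_boundary₁_eq_zero {c : Δ.interiorEdges → R}
    (hc : Δ.boundary₁ c = 0) : ∃ p, Δ.boundary₂ p = c := by
  obtain ⟨z, hz1, hz⟩ := Δ.exists_cycle
    (z₀ := fun τ => if h : τ ∈ Δ.interiorEdges then c ⟨τ, h⟩ else 0)
    fun v hv => by
      rw [← Finset.sum_subset (s₁ := Δ.interiorEdges) (Finset.filter_subset _ _),
        ← Finset.sum_coe_sort]
      · have := congrFun hc ⟨v, hv⟩
        rw [boundary₁_apply] at this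
        simpa using this
      · intro τ _ hτ
        rw [dif_neg hτ, smul_zero]
  choose x hx using fun σ : Δ.triangles => Δ.exists_inner σ.2
  refine ⟨fun σ => -(Δ.orientation σ.1 • Δ.winding z (x σ)), funext fun τ => ?_⟩
  obtain ⟨a, b, c₁, c₂, h, h', hab, he, ho, ho', -, hb⟩ := Δ.exists_boundary₂_eq τ
  rw [hb, smul_neg, smul_neg, smul_smul, smul_smul, orientation_mul_self, orientation_mul_self,
    one_smul, one_smul, neg_sub_neg,
    Δ.winding_sub_winding_across hz hab h h' ho ho' (hx ⟨_, h⟩) (hx ⟨_, h'⟩), ← he, hz1 _ τ.2, dif_pos τ.2]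

theorem triangles_nonempty : Δ.triangles.Nonempty := by
  obtain ⟨x, hx⟩ := Δ.polygonal.2.1.nonempty
  obtain ⟨σ, hσ, _⟩ := Δ.mem_domain.1 (interior_subset hx)
  exact ⟨σ, hσ⟩

/-- The kernel of the boundary operator on triangles. -/
theorem boundary₂_eq_zero_iff (p : Δ.triangles → R) :
    Δ.boundary₂ p = 0 ↔ ∃ f : R, ∀ σ, p σ = Δ.orientation σ.1 • f := by
  constructor
  · intro hp
    obtain ⟨σ₀, hσ₀⟩ := Δ.triangles_nonempty
    set f := Δ.orientation σ₀ • p ⟨σ₀, hσ₀⟩ with hf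
    have key : ∀ σ (h : σ ∈ Δ.triangles),
        σ ∈ Δ.triangles.filter fun σ => ∀ h : σ ∈ Δ.triangles, Δ.orientation σ • p ⟨σ, h⟩ = f := by
      intro σ hσ
      refine Δ.mem_of_closed_under_adjacent (Finset.filter_subset _ _)
        ⟨σ₀, Finset.mem_filter.2 ⟨hσ₀, fun _ => rfl⟩⟩ ?_ hσ
      intro σ hσ y σ' hadj
      obtain ⟨h1, h2, a, b, hab, hs, hs', -⟩ := hadj
      refine Finset.mem_filter.2 ⟨h2, fun _ => ?_⟩
      by_cases heq : σ' = σ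
      · subst heq; exact (Finset.mem_filter.1 hσ).2 h2
      have hi : {a, b} ∈ Δ.interiorEdges :=
        Finset.mem_filter.2 ⟨hab, σ, h1, σ', h2, Ne.symm heq, hs, hs'⟩
      obtain ⟨a', b', c₁, c₂, h, h', -, he, -, -, hall, hb⟩ := Δ.exists_boundary₂_eq ⟨_, hi⟩
      have hz := hb p
      rw [hp, Pi.zero_apply, eq_comm, sub_eq_zero] at hz
      have hσf := (Finset.mem_filter.1 hσ).2
      dsimp only at he
      rw [he] at hs hs'
      rcases hall σ h1 hs with rfl | rfl <;> rcases hall σ' h2 hs' with rfl | rfl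
      · exact absurd rfl heq
      · rw [← hz]; exact hσf h1
      · rw [hz]; exact hσf h1
      · exact absurd rfl heq
    refine ⟨f, fun σ => ?_⟩
    rw [← (Finset.mem_filter.1 (key σ.1 σ.2)).2 σ.2, smul_smul, orientation_mul_self, one_smul]
  · rintro ⟨f, hf⟩
    funext τ
    obtain ⟨a, b, c₁, c₂, h, h', hab, he, ho, ho', -, hb⟩ := Δ.exists_boundary₂_eq τ
    rw [hb, hf, hf, smul_smul, smul_smul, orientation_mul_self, orientation_mul_self, sub_self]
    rfl

end PlanarTriangulation
end SplineTriangulation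

end

noncomputable section

namespace SplineTriangulation

theorem exists_eq_linForm {ℓ : R} (h : ℓ.IsHomogeneous 1) : ∃ c, ℓ = linForm c := by
  have h' : ℓ ∈ MvPolynomial.homogeneousSubmodule (Fin 3) ℝ 1 := h
  rw [MvPolynomial.homogeneousSubmodule_one_eq_span_X] at h'
  obtain ⟨c, hc⟩ := (Submodule.mem_span_range_iff_exists_fun ℝ).1 h'
  exact ⟨c, hc.symm⟩

/-- The points of the plane as points of the projective plane. -/
def pt (p : Plane) : Fin 3 → ℝ := ![p 0, p 1, 1]

/-- The coefficients of a linear form that vanishes on the line through `a` and `b`. -/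
def lineCoeff (a b : Plane) : Fin 3 → ℝ := ![a 1 - b 1, b 0 - a 0, a 0 * b 1 - a 1 * b 0]

theorem eval_lineCoeff (a b p : Plane) :
    MvPolynomial.eval (pt p) (linForm (lineCoeff a b)) = orient a b p := by
  simp [eval_linForm, Fin.sum_univ_three, pt, lineCoeff, orient]
  ring

theorem exists_eq_smul_lineCoeff {a b : Plane} (hab : a ≠ b) {c : Fin 3 → ℝ}
    (ha : MvPolynomial.eval (pt a) (linForm c) = 0)
    (hb : MvPolynomial.eval (pt b) (linForm c) = 0) : ∃ k : ℝ, c = k • lineCoeff a b := by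
  simp [eval_linForm, Fin.sum_univ_three, pt] at ha hb
  by_cases h0 : b 0 - a 0 = 0
  · have h1 : a 1 - b 1 ≠ 0 := fun h1 => hab (by
      ext i; fin_cases i
      · simp; linarith
      · simp; linarith)
    have e : a 0 = b 0 := by linarith
    refine ⟨c 0 / (a 1 - b 1), ?_⟩
    have hc : c 1 = 0 := by
      have : c 1 * (a 1 - b 1) = 0 := by rw [e] at ha; linarith
      simpa [h1] using this
    ext i
    fin_cases i
    · simp [lineCoeff]; field_simp
    · simp [lineCoeff, h0, hc]
    · simp [lineCoeff]; field_simp; rw [hc] at ha; rw [e] at ha ⊢; linear_combination (a 1 - b 1) * ha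
  · refine ⟨c 1 / (b 0 - a 0), ?_⟩
    ext i
    fin_cases i
    · simp [lineCoeff]; field_simp; linear_combination hb - ha
    · simp [lineCoeff]; field_simp
    · simp [lineCoeff]; field_simp; linear_combination b 0 * ha - a 0 * hb

theorem linForm_smul (k : ℝ) (c : Fin 3 → ℝ) : linForm (k • c) = MvPolynomial.C k * linForm c := by
  simp [linForm, MvPolynomial.smul_eq_C_mul, Finset.mul_sum, mul_assoc]

theorem edgeIdeal_eq {r : ℕ} {a b : Plane} (hab : a ≠ b) {c : Fin 3 → ℝ} (hc : c ≠ 0)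
    (ha : MvPolynomial.eval (pt a) (linForm c) = 0)
    (hb : MvPolynomial.eval (pt b) (linForm c) = 0) :
    edgeIdeal r {a, b} = Ideal.span {linForm c ^ (r + 1)} := by
  obtain ⟨k, rfl⟩ := exists_eq_smul_lineCoeff hab ha hb
  have hk : k ≠ 0 := by rintro rfl; simp at hc
  refine le_antisymm (Ideal.span_le.2 ?_) (Ideal.span_mono ?_)
  · rintro _ ⟨ℓ, hℓ, hv, rfl⟩
    obtain ⟨c', rfl⟩ := exists_eq_linForm hℓ
    obtain ⟨k', rfl⟩ := exists_eq_smul_lineCoeff hab (hv a (by simp)) (hv b (by simp))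
    refine Ideal.mem_span_singleton.2 ⟨MvPolynomial.C ((k' / k) ^ (r + 1)), ?_⟩
    rw [linForm_smul, linForm_smul, mul_pow, mul_pow, ← map_pow, ← map_pow, mul_right_comm, ← map_mul,
      ← mul_pow, mul_div_cancel₀ _ hk]
  · rintro _ rfl
    refine ⟨_, linForm_isHomogeneous _, fun v hv => ?_, rfl⟩
    simp only [Finset.mem_insert, Finset.mem_singleton] at hv
    rcases hv with rfl | rfl
    exacts [ha, hb]

theorem lineCoeff_ne_zero {a b : Plane} (hab : a ≠ b) : lineCoeff a b ≠ 0 := by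
  intro h
  have h0 := congrFun h 0
  have h1 := congrFun h 1
  simp [lineCoeff] at h0 h1
  refine hab ?_
  ext i
  fin_cases i
  · simp; linarith
  · simp; linarith

theorem edgeIdeal_eq_lineCoeff (r : ℕ) {a b : Plane} (hab : a ≠ b) :
    edgeIdeal r {a, b} = Ideal.span {linForm (lineCoeff a b) ^ (r + 1)} :=
  edgeIdeal_eq hab (lineCoeff_ne_zero hab) (by rw [eval_lineCoeff]; exact orient_self_left a b)
    (by rw [eval_lineCoeff]; exact orient_self_right a b)

theorem ncard_image_eq_of_eq_iff {α β γ : Type*} {W : Set α} {f : α → β} {g : α → γ}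
    (h : ∀ x ∈ W, ∀ y ∈ W, f x = f y ↔ g x = g y) : (f '' W).ncard = (g '' W).ncard := by
  refine Set.ncard_congr (fun b hb => g hb.choose) (fun b hb => ⟨_, hb.choose_spec.1, rfl⟩) ?_ ?_
  · intro b b' hb hb' he
    rw [← hb.choose_spec.2, ← hb'.choose_spec.2]
    exact (h _ hb.choose_spec.1 _ hb'.choose_spec.1).2 he
  · rintro _ ⟨x, hx, rfl⟩
    have hb : f x ∈ f '' W := ⟨x, hx, rfl⟩
    exact ⟨f x, hb, (h _ hb.choose_spec.1 _ hx).1 hb.choose_spec.2⟩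

/-- A coordinate system whose coordinate points are `v'`, `v` and a third point. -/
structure IsFrame (M M' : Matrix (Fin 3) (Fin 3) ℝ) (v v' : Plane) : Prop where
  mul : M' * M = 1
  left : M'.mulVec (pt v') = Pi.single 0 1
  right : M'.mulVec (pt v) = Pi.single 1 1
  span : ∃ u : Plane, ∀ p, p - v = M'.mulVec (pt p) 0 • (v' - v) + M'.mulVec (pt p) 2 • (u - v)

theorem exists_isFrame {v v' : Plane} (h : v ≠ v') :
    ∃ M M' : Matrix (Fin 3) (Fin 3) ℝ, IsFrame M M' v v' ∧
      IsFrame (M.submatrix id (Equiv.swap 0 1)) (flip M') v' v := by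
  obtain ⟨u, hu⟩ : ∃ u, orient v v' u ≠ 0 := by
    by_contra hcon
    push Not at hcon
    have h1 := hcon ![v 0, v 1 + 1]
    have h2 := hcon ![v 0 + 1, v 1]
    simp [orient] at h1 h2
    refine h ?_
    ext i
    fin_cases i
    · simp; linarith
    · simp; linarith
  set M : Matrix (Fin 3) (Fin 3) ℝ := !![v' 0, v 0, u 0; v' 1, v 1, u 1; 1, 1, 1] with hM
  have hdet : M.det = - orient v v' u := by
    rw [hM, Matrix.det_fin_three]
    simp [orient]
    ring
  have hunit : IsUnit M.det := by rw [hdet]; exact (neg_ne_zero.2 hu).isUnit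
  have hmul : M⁻¹ * M = 1 := Matrix.nonsing_inv_mul _ hunit
  have hmul' : M * M⁻¹ = 1 := Matrix.mul_nonsing_inv _ hunit
  have hl : M⁻¹.mulVec (pt v') = Pi.single 0 1 := by
    have : pt v' = M.mulVec (Pi.single 0 1) := by
      ext i; fin_cases i <;> simp [pt, hM]
    rw [this, Matrix.mulVec_mulVec, hmul, Matrix.one_mulVec]
  have hr : M⁻¹.mulVec (pt v) = Pi.single 1 1 := by
    have : pt v = M.mulVec (Pi.single 1 1) := by
      ext i; fin_cases i <;> simp [pt, hM]
    rw [this, Matrix.mulVec_mulVec, hmul, Matrix.one_mulVec]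
  have key : ∀ p, pt p = M.mulVec (M⁻¹.mulVec (pt p)) := by
    intro p
    rw [Matrix.mulVec_mulVec, hmul', Matrix.one_mulVec]
  have h0 : ∀ p, p 0 = v' 0 * M⁻¹.mulVec (pt p) 0 + v 0 * M⁻¹.mulVec (pt p) 1 +
      u 0 * M⁻¹.mulVec (pt p) 2 := by
    intro p
    have := congrFun (key p) 0
    rw [Matrix.mulVec, dotProduct, Fin.sum_univ_three] at this
    simpa [pt, hM] using this
  have h1 : ∀ p, p 1 = v' 1 * M⁻¹.mulVec (pt p) 0 + v 1 * M⁻¹.mulVec (pt p) 1 +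
      u 1 * M⁻¹.mulVec (pt p) 2 := by
    intro p
    have := congrFun (key p) 1
    rw [Matrix.mulVec, dotProduct, Fin.sum_univ_three] at this
    simpa [pt, hM] using this
  have h2 : ∀ p, 1 = M⁻¹.mulVec (pt p) 0 + M⁻¹.mulVec (pt p) 1 + M⁻¹.mulVec (pt p) 2 := by
    intro p
    have := congrFun (key p) 2
    rw [Matrix.mulVec, dotProduct, Fin.sum_univ_three] at this
    simpa [pt, hM] using this
  have hflip : ∀ p, (flip M⁻¹).mulVec (pt p) = M⁻¹.mulVec (pt p) ∘ Equiv.swap 0 1 := fun p => rfl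
  refine ⟨M, M⁻¹, ⟨hmul, hl, hr, u, fun p => ?_⟩, ⟨flip_mul hmul, ?_, ?_, u, fun p => ?_⟩⟩
  · have a0 := h0 p
    have a1 := h1 p
    have a2 := h2 p
    generalize M⁻¹.mulVec (pt p) = q at a0 a1 a2
    ext i
    fin_cases i
    · simp; linear_combination a0 - v 0 * a2
    · simp; linear_combination a1 - v 1 * a2
  · rw [hflip, hr]; ext i; fin_cases i <;> rfl
  · rw [hflip, hl]; ext i; fin_cases i <;> rfl
  · have a0 := h0 p
    have a1 := h1 p
    have a2 := h2 p
    rw [hflip]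
    generalize M⁻¹.mulVec (pt p) = q at a0 a1 a2
    have s2 : (Equiv.swap 0 1 : Equiv.Perm (Fin 3)) 2 = 2 := rfl
    ext i
    fin_cases i
    · simp [s2]; linear_combination a0 - v' 0 * a2
    · simp [s2]; linear_combination a1 - v' 1 * a2

theorem eval_linForm_row (M' : Matrix (Fin 3) (Fin 3) ℝ) (k : Fin 3) (p : Plane) :
    MvPolynomial.eval (pt p) (linForm (M' k)) = M'.mulVec (pt p) k := by
  rw [eval_linForm]; rfl

theorem linForm_sub (c c' : Fin 3 → ℝ) : linForm (c - c') = linForm c - linForm c' := by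
  simp [linForm, sub_smul]

namespace IsFrame

variable {M M' : Matrix (Fin 3) (Fin 3) ℝ} {v v' : Plane}

theorem slope_eq_of_eq_zero (hF : IsFrame M M' v v') {w : Plane} (hw : w ≠ v)
    (h : M'.mulVec (pt w) 2 = 0) : slope v w = slope v v' := by
  obtain ⟨u, hu⟩ := hF.span
  have h1 := hu w
  rw [h, zero_smul, add_zero] at h1
  have h2 : M'.mulVec (pt w) 0 ≠ 0 := by
    intro h0
    rw [h0, zero_smul, sub_eq_zero] at h1
    exact hw h1
  rw [slope, slope, h1]
  exact Submodule.span_singleton_smul_eq h2.isUnit _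

theorem slope_eq_iff (hF : IsFrame M M' v v') {w w' : Plane} (h : M'.mulVec (pt w) 2 ≠ 0)
    (h' : M'.mulVec (pt w') 2 ≠ 0) : slope v w = slope v w' ↔
      M'.mulVec (pt w) 0 / M'.mulVec (pt w) 2 = M'.mulVec (pt w') 0 / M'.mulVec (pt w') 2 := by
  constructor
  · intro he
    have hmem : w' - v ∈ slope v w := by rw [he]; exact Submodule.mem_span_singleton_self _
    obtain ⟨z, hz⟩ := Submodule.mem_span_singleton.1 hmem
    have hp : pt w' = z • pt w + (1 - z) • pt v := by
      have h0 := congrFun hz 0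
      have h1 := congrFun hz 1
      simp at h0 h1
      ext i
      fin_cases i
      · simp [pt]; linarith
      · simp [pt]; linarith
      · simp [pt]
    have hm : M'.mulVec (pt w') = z • M'.mulVec (pt w) + (1 - z) • Pi.single 1 1 := by
      rw [hp, Matrix.mulVec_add, Matrix.mulVec_smul, Matrix.mulVec_smul, hF.right]
    have e0 := congrFun hm 0
    have e2 := congrFun hm 2
    simp at e0 e2
    rw [e2] at h' ⊢
    rw [e0, mul_div_mul_left _ _ (left_ne_zero_of_mul h')]
  · intro he
    obtain ⟨u, hu⟩ := hF.span
    rw [div_eq_div_iff h h'] at he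
    have : w' - v = (M'.mulVec (pt w') 2 / M'.mulVec (pt w) 2) • (w - v) := by
      rw [hu w, hu w', smul_add, smul_smul, smul_smul, div_mul_cancel₀ _ h]
      congr 2
      field_simp
      linarith
    rw [slope, slope, this]
    exact (Submodule.span_singleton_smul_eq (div_ne_zero h' h).isUnit _).symm

theorem edgeIdeal_eq_some (hF : IsFrame M M' v v') (r : ℕ) {w : Plane}
    (h : M'.mulVec (pt w) 2 ≠ 0) : edgeIdeal r {v, w} =
      Ideal.span {pencilForm M' (some (M'.mulVec (pt w) 0 / M'.mulVec (pt w) 2)) ^ (r + 1)} := by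
  have e : ∀ p, MvPolynomial.eval (pt p)
      (linForm (M' 0 - (M'.mulVec (pt w) 0 / M'.mulVec (pt w) 2) • M' 2)) =
      M'.mulVec (pt p) 0 - M'.mulVec (pt w) 0 / M'.mulVec (pt w) 2 * M'.mulVec (pt p) 2 := by
    intro p
    rw [linForm_sub, linForm_smul, map_sub, map_mul, MvPolynomial.eval_C, eval_linForm_row,
      eval_linForm_row]
  refine edgeIdeal_eq ?_ ?_ ?_ ?_
  · rintro rfl
    rw [hF.right] at h
    simp at h
  · intro h0
    have := e v'
    rw [h0, hF.left] at this
    simp [linForm] at this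
  · rw [e, hF.right]; simp
  · rw [e, div_mul_cancel₀ _ h, sub_self]

theorem edgeIdeal_eq_none (hF : IsFrame M M' v v') (r : ℕ) :
    edgeIdeal r {v, v'} = Ideal.span {pencilForm M' none ^ (r + 1)} := by
  refine edgeIdeal_eq ?_ ?_ ?_ ?_
  · rintro rfl
    have := congrFun (hF.left.symm.trans hF.right) 0
    simp at this
  · intro h0
    have := congrFun (congrFun hF.mul 2) 2
    rw [Matrix.mul_apply, h0] at this
    simp at this
  · rw [eval_linForm_row, hF.right]; simp
  · rw [eval_linForm_row, hF.left]; simp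

end IsFrame

namespace PlanarTriangulation

variable (Δ : PlanarTriangulation)

/-- The sum of the ideals of the edges other than `τ` at the vertex `γ`. -/
def outerIdeal (r : ℕ) (τ : Finset Plane) (γ : Plane) : Ideal R :=
  ⨆ ε ∈ (Δ.interiorEdges.filter fun ε => γ ∈ ε).erase τ, edgeIdeal r ε

theorem mem_interiorEdges_of_mem_edges {τ : Finset Plane} {γ : Plane} (hγ : γ ∈ Δ.interiorVertices)
    (hτ : τ ∈ Δ.edges) (hγτ : γ ∈ τ) : τ ∈ Δ.interiorEdges := by
  obtain ⟨σ, hσ, hs⟩ := Δ.exists_triangle_of_mem_edges hτ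
  exact Δ.mem_interiorEdges_of_mem hγ hσ hs (Δ.mem_edges.1 hτ).2 hγτ

theorem vertexIdeal_eq_sup (r : ℕ) {τ : Finset Plane} {γ : Plane} (hγ : γ ∈ Δ.interiorVertices)
    (hτ : τ ∈ Δ.edges) (hγτ : γ ∈ τ) :
    Δ.vertexIdeal r γ = edgeIdeal r τ ⊔ Δ.outerIdeal r τ γ := by
  rw [vertexIdeal, outerIdeal, ← Finset.iSup_insert, Finset.insert_erase]
  exact Finset.mem_filter.2 ⟨Δ.mem_interiorEdges_of_mem_edges hγ hτ hγτ, hγτ⟩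

theorem exists_eq_pair_of_mem {τ : Finset Plane} (hτ : τ ∈ Δ.edges) {v : Plane} (hv : v ∈ τ) :
    ∃ w, w ≠ v ∧ τ = {v, w} := by
  obtain ⟨a, b, hab, rfl⟩ := Finset.card_eq_two.1 (Δ.mem_edges.1 hτ).2
  simp only [Finset.mem_insert, Finset.mem_singleton] at hv
  rcases hv with rfl | rfl
  · exact ⟨b, hab.symm, rfl⟩
  · exact ⟨a, hab, Finset.pair_comm _ _⟩

theorem pair_eq_pair_iff {v w w' : Plane} : ({v, w} : Finset Plane) = {v, w'} ↔ w = w' := by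
  constructor
  · intro h
    have h1 : w ∈ ({v, w'} : Finset Plane) := by rw [← h]; simp
    have h2 : w' ∈ ({v, w} : Finset Plane) := by rw [h]; simp
    simp only [Finset.mem_insert, Finset.mem_singleton] at h1 h2
    rcases h1 with rfl | h1
    · rcases h2 with h2 | h2 <;> exact h2.symm
    · exact h1
  · rintro rfl; rfl

/-- The link of a vertex. -/
def link (v : Plane) : Set Plane := {w | {v, w} ∈ Δ.edges}

theorem finite_link (v : Plane) : (Δ.link v).Finite :=
  Δ.vertexSet.finite_toSet.subset fun _ hw => Δ.mem_vertexSet hw (by simp)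

theorem slopes_erase {v v' : Plane} :
    slopes (Δ.edges.erase {v, v'}) v = slope v '' (Δ.link v \ {v'}) := by
  ext L
  constructor
  · rintro ⟨w, hw, rfl⟩
    rw [Finset.mem_erase, ne_eq, pair_eq_pair_iff] at hw
    exact ⟨w, ⟨hw.2, hw.1⟩, rfl⟩
  · rintro ⟨w, ⟨hw, hne⟩, rfl⟩
    exact ⟨w, Finset.mem_erase.2 ⟨fun h => hne (pair_eq_pair_iff.1 h), hw⟩, rfl⟩

theorem numSlopes_eq {v v' : Plane} (hedge : {v, v'} ∈ Δ.edges)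
    (hslope : ∀ w, {v, w} ∈ Δ.edges → w ≠ v' → slope v w ≠ slope v v') :
    Δ.numSlopes v = (slopes (Δ.edges.erase {v, v'}) v).ncard + 1 := by
  have h : slopes Δ.edges v = insert (slope v v') (slopes (Δ.edges.erase {v, v'}) v) := by
    have h1 : slopes Δ.edges v = slope v '' Δ.link v := by
      ext L
      exact ⟨fun ⟨w, hw, he⟩ => ⟨w, hw, he.symm⟩, fun ⟨w, hw, he⟩ => ⟨w, hw, he.symm⟩⟩
    rw [h1, slopes_erase, ← Set.image_insert_eq, Set.insert_sdiff_singleton, Set.insert_eq_of_mem]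
    exact hedge
  rw [numSlopes, h, Set.ncard_insert_of_notMem _ (by
    rw [slopes_erase]; exact ((Δ.finite_link v).subset Set.sdiff_subset).image _)]
  rw [slopes_erase]
  rintro ⟨w, ⟨hw, hne⟩, he⟩
  exact hslope w hw hne he

/-- The ideals at a vertex in the coordinates of a frame. -/
theorem exists_slopes {M M' : Matrix (Fin 3) (Fin 3) ℝ} {v v' : Plane} (hF : IsFrame M M' v v')
    (hv : v ∈ Δ.interiorVertices) (hedge : {v, v'} ∈ Δ.edges)
    (hslope : ∀ w, {v, w} ∈ Δ.edges → w ≠ v' → slope v w ≠ slope v v') (r : ℕ) :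
    ∃ S : Finset ℝ, S.card = (slopes (Δ.edges.erase {v, v'}) v).ncard ∧
      Δ.outerIdeal r {v, v'} v = pencilIdeal M' (r + 1) (S.map Function.Embedding.some) ∧
      Δ.vertexIdeal r v =
        pencilIdeal M' (r + 1) (insert none (S.map Function.Embedding.some)) := by
  have hne : ∀ w ∈ Δ.link v \ {v'}, M'.mulVec (pt w) 2 ≠ 0 := fun w hw h0 =>
    hslope w hw.1 hw.2 (hF.slope_eq_of_eq_zero (Δ.ne_of_mem_edges hw.1).symm h0)
  have hfin := ((Δ.finite_link v).subset (Set.sdiff_subset (t := {v'})))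
  set a : Plane → ℝ := fun w => M'.mulVec (pt w) 0 / M'.mulVec (pt w) 2 with ha
  have hS : ∀ x, x ∈ (hfin.image a).toFinset ↔ ∃ w ∈ Δ.link v \ {v'}, a w = x := by simp
  have hout : Δ.outerIdeal r {v, v'} v =
      pencilIdeal M' (r + 1) ((hfin.image a).toFinset.map Function.Embedding.some) := by
    refine le_antisymm (iSup₂_le fun ε hε => ?_) (iSup₂_le fun i hi => ?_)
    · obtain ⟨h1, h2⟩ := Finset.mem_erase.1 hε
      obtain ⟨h2, h3⟩ := Finset.mem_filter.1 h2
      have h2 := (Finset.mem_filter.1 h2).1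
      obtain ⟨w, hw, rfl⟩ := Δ.exists_eq_pair_of_mem h2 h3
      have hw' : w ∈ Δ.link v \ {v'} := ⟨h2, fun h => h1 (pair_eq_pair_iff.2 h)⟩
      rw [hF.edgeIdeal_eq_some r (hne w hw')]
      refine le_iSup₂_of_le (some (a w)) ?_ le_rfl
      exact Finset.mem_map.2 ⟨a w, (hS _).2 ⟨w, hw', rfl⟩, rfl⟩
    · obtain ⟨x, hx, rfl⟩ := Finset.mem_map.1 hi
      obtain ⟨w, hw, rfl⟩ := (hS x).1 hx
      have := hF.edgeIdeal_eq_some r (hne w hw)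
      refine this.ge.trans (le_iSup₂_of_le {v, w} ?_ le_rfl)
      exact Finset.mem_erase.2 ⟨fun h => hw.2 (pair_eq_pair_iff.1 h), Finset.mem_filter.2
        ⟨Δ.mem_interiorEdges_of_mem_edges hv hw.1 (by simp), by simp⟩⟩
  refine ⟨_, ?_, hout, ?_⟩
  · rw [slopes_erase, ← Set.ncard_eq_toFinset_card _ (hfin.image a)]
    exact ncard_image_eq_of_eq_iff fun w hw w' hw' => (hF.slope_eq_iff (hne w hw) (hne w' hw')).symm
  · rw [Δ.vertexIdeal_eq_sup r hv hedge (by simp), hout, pencilIdeal, pencilIdeal, Finset.iSup_insert,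
      hF.edgeIdeal_eq_none]

end PlanarTriangulation
end SplineTriangulation

end

noncomputable section

namespace SplineTriangulation

open MvPolynomial (homogeneousComponent homogeneousSubmodule)

/-- The ideal contains the homogeneous components of its elements. -/
def ClosedUnderComponents (I : Ideal R) : Prop :=
  ∀ (d : ℕ) (f : R), f ∈ I → homogeneousComponent d f ∈ I

theorem closedUnderComponents_iff (I : Ideal R) : ClosedUnderComponents I ↔
    letI := MvPolynomial.gradedAlgebra (σ := Fin 3) (R := ℝ)
    Ideal.IsHomogeneous (homogeneousSubmodule (Fin 3) ℝ) I := by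
  let _ := MvPolynomial.gradedAlgebra (σ := Fin 3) (R := ℝ)
  have e : ∀ (f : R) (d : ℕ),
      (DirectSum.decompose (homogeneousSubmodule (Fin 3) ℝ) f d : R) = homogeneousComponent d f :=
    fun f d => MvPolynomial.decomposition.decompose'_apply f d
  constructor
  · intro h d f hf
    rw [e]; exact h d f hf
  · intro h d f hf
    rw [← e]; exact h d hf

theorem closedUnderComponents_edgeIdeal (r : ℕ) (τ : Finset Plane) :
    ClosedUnderComponents (edgeIdeal r τ) := by
  rw [closedUnderComponents_iff]
  let _ := MvPolynomial.gradedAlgebra (σ := Fin 3) (R := ℝ)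
  refine Ideal.homogeneous_span _ _ ?_
  rintro _ ⟨ℓ, hℓ, -, rfl⟩
  exact ⟨1 * (r + 1), hℓ.pow (r + 1)⟩

theorem ClosedUnderComponents.iSup₂ {κ : Sort*} {κ' : κ → Sort*} {f : ∀ i, κ' i → Ideal R}
    (h : ∀ i j, ClosedUnderComponents (f i j)) : ClosedUnderComponents (⨆ (i) (j), f i j) := by
  simp only [closedUnderComponents_iff] at h ⊢
  let _ := MvPolynomial.gradedAlgebra (σ := Fin 3) (R := ℝ)
  exact Ideal.IsHomogeneous.iSup₂ h

namespace PlanarTriangulation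

variable (Δ : PlanarTriangulation) (r d : ℕ)

theorem closedUnderComponents_vertexIdeal (γ : Plane) :
    ClosedUnderComponents (Δ.vertexIdeal r γ) :=
  .iSup₂ fun _ _ => closedUnderComponents_edgeIdeal _ _

theorem closedUnderComponents_outerIdeal (τ : Finset Plane) (γ : Plane) :
    ClosedUnderComponents (Δ.outerIdeal r τ γ) :=
  .iSup₂ fun _ _ => closedUnderComponents_edgeIdeal _ _

theorem mem_edgeSub {c : Δ.interiorEdges → R} :
    c ∈ Δ.edgeSub r ↔ ∀ τ, c τ ∈ edgeIdeal r τ.1 := by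
  simp [edgeSub, Submodule.mem_pi]

theorem mem_vertexSub {c : Δ.interiorVertices → R} :
    c ∈ Δ.vertexSub r ↔ ∀ γ, c γ ∈ Δ.vertexIdeal r γ.1 := by
  simp [vertexSub, Submodule.mem_pi]

theorem mem_edgeDegree {c : Δ.interiorEdges → R} :
    c ∈ Δ.edgeDegree d ↔ ∀ τ, (c τ).IsHomogeneous d := by
  simp only [edgeDegree, Submodule.mem_pi, Set.mem_univ, true_implies]
  exact Iff.rfl

/-- The class of a relative cycle. -/
def homologyClass (c : Δ.interiorEdges → R) (hc : Δ.boundary₁ c ∈ Δ.vertexSub r) : Δ.H1 r :=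
  Submodule.Quotient.mk ⟨(Δ.edgeSub r).mkQ c, by
    rw [LinearMap.mem_ker, quotBoundary₁, Submodule.mkQ_apply, Submodule.mapQ_apply,
      Submodule.Quotient.mk_eq_zero]
    exact hc⟩

theorem exists_eq_homologyClass (x : Δ.H1 r) : ∃ c hc, x = Δ.homologyClass r c hc := by
  obtain ⟨⟨y, hy⟩, rfl⟩ := Submodule.Quotient.mk_surjective _ x
  obtain ⟨c, rfl⟩ := Submodule.mkQ_surjective _ y
  refine ⟨c, ?_, rfl⟩
  rw [LinearMap.mem_ker, quotBoundary₁, Submodule.mkQ_apply, Submodule.mapQ_apply,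
      Submodule.Quotient.mk_eq_zero] at hy
  exact hy

theorem homologyClass_eq_zero_iff (c : Δ.interiorEdges → R)
    (hc : Δ.boundary₁ c ∈ Δ.vertexSub r) : Δ.homologyClass r c hc = 0 ↔
      ∃ e ∈ Δ.edgeSub r, Δ.boundary₁ e = Δ.boundary₁ c := by
  rw [homologyClass, Submodule.Quotient.mk_eq_zero]
  change (Δ.edgeSub r).mkQ c ∈ LinearMap.range (Δ.quotBoundary₂ r) ↔ _
  constructor
  · rintro ⟨p, hp⟩
    have hp : (Δ.edgeSub r).mkQ (Δ.boundary₂ p) = (Δ.edgeSub r).mkQ c := hp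
    rw [Submodule.mkQ_apply, Submodule.mkQ_apply, Submodule.Quotient.eq] at hp
    refine ⟨-(Δ.boundary₂ p - c), neg_mem hp, ?_⟩
    have := LinearMap.congr_fun Δ.boundary₁_comp_boundary₂ p
    simp only [LinearMap.comp_apply, LinearMap.zero_apply] at this
    rw [map_neg, map_sub, this, zero_sub, neg_neg]
  · rintro ⟨e, he, hb⟩
    obtain ⟨p, hp⟩ := Δ.exists_boundary₂_eq_of_boundary₁_eq_zero (c := c - e)
      (by rw [map_sub, hb, sub_self])
    refine ⟨p, ?_⟩
    change (Δ.edgeSub r).mkQ (Δ.boundary₂ p) = (Δ.edgeSub r).mkQ c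
    rw [hp, Submodule.mkQ_apply, Submodule.mkQ_apply, Submodule.Quotient.eq, sub_sub_cancel_left]
    exact neg_mem he

theorem mem_H1Degree_iff (x : Δ.H1 r) :
    x ∈ Δ.H1Degree r d ↔ ∃ c ∈ Δ.edgeDegree d, ∃ hc, x = Δ.homologyClass r c hc := by
  constructor
  · rintro ⟨⟨y, hy⟩, ⟨c, hc, he⟩, rfl⟩
    have he : (Δ.edgeSub r).mkQ c = y := he
    subst he
    refine ⟨c, hc, ?_, rfl⟩
    rw [LinearMap.mem_ker, quotBoundary₁, Submodule.mkQ_apply, Submodule.mapQ_apply,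
      Submodule.Quotient.mk_eq_zero] at hy
    exact hy
  · rintro ⟨c, hc, hc', rfl⟩
    exact ⟨_, ⟨c, hc, rfl⟩, rfl⟩

theorem H1Degree_eq_bot_iff : Δ.H1Degree r d = ⊥ ↔
    ∀ c ∈ Δ.edgeDegree d, Δ.boundary₁ c ∈ Δ.vertexSub r →
      ∃ e ∈ Δ.edgeSub r, Δ.boundary₁ e = Δ.boundary₁ c := by
  rw [Submodule.eq_bot_iff]
  constructor
  · intro h c hc hb
    exact (Δ.homologyClass_eq_zero_iff r c hb).1
      (h _ ((Δ.mem_H1Degree_iff r d _).2 ⟨c, hc, hb, rfl⟩))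
  · intro h x hx
    obtain ⟨c, hc, hb, rfl⟩ := (Δ.mem_H1Degree_iff r d _).1 hx
    exact (Δ.homologyClass_eq_zero_iff r c hb).2 (h c hc hb)

theorem boundary₁_homogeneousComponent (c : Δ.interiorEdges → R) (γ : Δ.interiorVertices) :
    Δ.boundary₁ (fun τ => homogeneousComponent d (c τ)) γ =
      homogeneousComponent d (Δ.boundary₁ c γ) := by
  simp only [boundary₁_apply, map_sum, map_zsmul]

theorem homologyClass_add {c c' : Δ.interiorEdges → R} (hc : Δ.boundary₁ c ∈ Δ.vertexSub r)
    (hc' : Δ.boundary₁ c' ∈ Δ.vertexSub r) (h : Δ.boundary₁ (c + c') ∈ Δ.vertexSub r) :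
    Δ.homologyClass r (c + c') h = Δ.homologyClass r c hc + Δ.homologyClass r c' hc' := rfl

instance : Module.Finite ℝ (Δ.edgeDegree d) := by
  let f : Δ.edgeDegree d →ₗ[ℝ] (Δ.interiorEdges → homogeneousSubmodule (Fin 3) ℝ d) :=
    { toFun := fun c τ => ⟨c.1 τ, (Δ.mem_edgeDegree d).1 c.2 τ⟩
      map_add' := fun _ _ => rfl
      map_smul' := fun _ _ => rfl }
  refine Module.Finite.of_injective f fun c c' h => Subtype.ext (funext fun τ => ?_)
  exact congrArg Subtype.val (congrFun h τ)

instance : Module.Finite ℝ (Δ.H1Degree r d) := by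
  have h1 : Module.Finite ℝ ((Δ.edgeDegree d).map ((Δ.edgeSub r).mkQ.restrictScalars ℝ)) :=
    inferInstance
  have h2 : Module.Finite ℝ
      (((Δ.edgeDegree d).map ((Δ.edgeSub r).mkQ.restrictScalars ℝ)).comap
        ((LinearMap.ker (Δ.quotBoundary₁ r)).subtype.restrictScalars ℝ)) :=
    Module.Finite.of_injective
      (((LinearMap.ker (Δ.quotBoundary₁ r)).subtype.restrictScalars ℝ).restrict
        (p := (((Δ.edgeDegree d).map ((Δ.edgeSub r).mkQ.restrictScalars ℝ)).comap
        ((LinearMap.ker (Δ.quotBoundary₁ r)).subtype.restrictScalars ℝ)))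
        (q := ((Δ.edgeDegree d).map ((Δ.edgeSub r).mkQ.restrictScalars ℝ))) fun _ h => h)
      fun x y h => Subtype.ext (Subtype.ext (by
        have h' := congrArg Subtype.val h
        exact h'))
  exact Module.Finite.map _ _

theorem iSup_H1Degree : ⨆ d, Δ.H1Degree r d = ⊤ := by
  rw [eq_top_iff]
  rintro x -
  obtain ⟨c, hc, rfl⟩ := Δ.exists_eq_homologyClass r x
  have hcomp : ∀ d, Δ.boundary₁ (fun τ => homogeneousComponent d (c τ)) ∈ Δ.vertexSub r := by
    intro d
    rw [mem_vertexSub] at hc ⊢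
    intro γ
    rw [boundary₁_homogeneousComponent]
    exact Δ.closedUnderComponents_vertexIdeal r γ d _ (hc γ)
  obtain ⟨n, hn⟩ : ∃ n, ∀ τ, (c τ).totalDegree < n := by
    refine ⟨(Finset.univ.sup fun τ => (c τ).totalDegree) + 1, fun τ => Nat.lt_succ_of_le ?_⟩
    exact Finset.le_sup (f := fun τ => (c τ).totalDegree) (Finset.mem_univ τ)
  have key : ∀ n, ∃ h : Δ.boundary₁ (∑ d ∈ Finset.range n,
      fun τ => homogeneousComponent d (c τ)) ∈ Δ.vertexSub r,
      Δ.homologyClass r _ h ∈ ⨆ d, Δ.H1Degree r d := by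
    intro n
    induction n with
    | zero =>
      refine ⟨by simp, ?_⟩
      have : Δ.homologyClass r (∑ d ∈ Finset.range 0, fun τ => homogeneousComponent d (c τ))
          (by simp) = 0 := (Δ.homologyClass_eq_zero_iff r _ _).2 ⟨0, zero_mem _, by simp⟩
      rw [this]; exact zero_mem _
    | succ n ih =>
      obtain ⟨h, hm⟩ := ih
      have h' : Δ.boundary₁ (∑ d ∈ Finset.range (n + 1),
          fun τ => homogeneousComponent d (c τ)) ∈ Δ.vertexSub r := by
        rw [Finset.sum_range_succ, map_add]
        exact add_mem h (hcomp n)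
      refine ⟨h', ?_⟩
      have e : Δ.homologyClass r _ h' = Δ.homologyClass r _ h + Δ.homologyClass r _ (hcomp n) := by
        rw [← homologyClass_add _ _ _ _ (by rw [map_add]; exact add_mem h (hcomp n))]
        congr 1
        rw [Finset.sum_range_succ]
      rw [e]
      refine add_mem hm (Submodule.mem_iSup_of_mem n ((Δ.mem_H1Degree_iff r n _).2
        ⟨_, (Δ.mem_edgeDegree n).2 fun τ => ?_, hcomp n, rfl⟩))
      exact MvPolynomial.homogeneousComponent_isHomogeneous _ _
  obtain ⟨h, hm⟩ := key n
  convert hm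
  ext1 τ
  rw [Finset.sum_apply]
  conv_lhs => rw [← MvPolynomial.sum_homogeneousComponent (c τ)]
  refine Finset.sum_subset (fun i hi => ?_) fun i _ hi => ?_
  · simp only [Finset.mem_range] at hi ⊢
    have := hn τ
    omega
  · exact MvPolynomial.homogeneousComponent_eq_zero _ _ (by simpa using hi)

theorem isFiniteLength_H1 {m : ℕ} (h : ∀ d, m < d → Δ.H1Degree r d = ⊥) :
    IsFiniteLength R (Δ.H1 r) := by
  have hfin : Module.Finite ℝ (Δ.H1 r) := by
    have e : (⨆ d : Fin (m + 1), Δ.H1Degree r d) = ⊤ := by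
      rw [← Δ.iSup_H1Degree r]
      refine le_antisymm (iSup_le fun d => le_iSup (Δ.H1Degree r) d) (iSup_le fun d => ?_)
      rcases Nat.lt_or_ge m d with hd | hd
      · rw [h d hd]; exact bot_le
      · exact le_iSup (fun d : Fin (m + 1) => Δ.H1Degree r d) ⟨d, Nat.lt_succ_of_le hd⟩
    have h1 : Module.Finite ℝ (⨆ d : Fin (m + 1), Δ.H1Degree r d : Submodule ℝ (Δ.H1 r)) :=
      inferInstance
    rw [e] at h1
    exact Module.Finite.of_surjective (⊤ : Submodule ℝ (Δ.H1 r)).subtype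
      fun x => ⟨⟨x, trivial⟩, rfl⟩
  rw [isFiniteLength_iff_isNoetherian_isArtinian]
  exact ⟨isNoetherian_of_tower ℝ inferInstance, isArtinian_of_tower ℝ inferInstance⟩

end PlanarTriangulation
end SplineTriangulation

end

noncomputable section

namespace SplineTriangulation

open MvPolynomial (homogeneousComponent homogeneousSubmodule)

namespace PlanarTriangulation

variable (Δ : PlanarTriangulation)

theorem isHomogeneous_zsmul {d : ℕ} {f : R} (hf : f.IsHomogeneous d) (n : ℤ) :
    (n • f).IsHomogeneous d :=
  zsmul_mem (show f ∈ homogeneousSubmodule (Fin 3) ℝ d from hf) n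

theorem isHomogeneous_boundary₁ {d : ℕ} {c : Δ.interiorEdges → R} (hc : ∀ τ, (c τ).IsHomogeneous d)
    (γ : Δ.interiorVertices) : (Δ.boundary₁ c γ).IsHomogeneous d := by
  rw [boundary₁_apply]
  exact MvPolynomial.IsHomogeneous.sum _ _ _ fun τ _ => isHomogeneous_zsmul (hc τ) _

/-- The interior vertices are the two ends of an edge. -/
structure HasTwoInteriorVertices (v₁ v₂ : Plane) : Prop where
  ne : v₁ ≠ v₂
  eq : Δ.interiorVertices = {v₁, v₂}
  edge : {v₁, v₂} ∈ Δ.edges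

variable {Δ} {r d : ℕ} {v₁ v₂ : Plane}

theorem incidence_mul_self {τ : Finset Plane} (hτ : τ ∈ Δ.edges) {γ : Plane} (hγ : γ ∈ τ) :
    incidence τ {γ} * incidence τ {γ} = 1 := by
  obtain ⟨w, hw, rfl⟩ := Δ.exists_eq_pair_of_mem hτ hγ
  rw [incidence_pair hw.symm]
  split_ifs <;> rfl

theorem boundary₁_single (ε : Δ.interiorEdges) (x : R) (γ : Δ.interiorVertices) :
    Δ.boundary₁ (Pi.single ε x) γ = incidence ε.1 {γ.1} • x := by
  rw [boundary₁_apply, Finset.sum_eq_single ε, Pi.single_eq_same]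
  · intro ε' _ h
    rw [Pi.single_eq_of_ne h, smul_zero]
  · intro h; exact absurd (Finset.mem_univ _) h

theorem boundary₁_single_of_unique {ε : Δ.interiorEdges} {γ : Δ.interiorVertices}
    (h : ∀ γ' : Δ.interiorVertices, γ'.1 ∈ ε.1 → γ' = γ) (x : R) :
    Δ.boundary₁ (Pi.single ε x) = Pi.single γ (incidence ε.1 {γ.1} • x) := by
  funext γ'
  rw [boundary₁_single]
  by_cases hγ : γ' = γ
  · subst hγ; rw [Pi.single_eq_same]
  · rw [Pi.single_eq_of_ne hγ, incidence_eq_zero_of_notMem fun hm => hγ (h _ hm), zero_smul]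

namespace HasTwoInteriorVertices

theorem symm (h : Δ.HasTwoInteriorVertices v₁ v₂) : Δ.HasTwoInteriorVertices v₂ v₁ :=
  ⟨h.ne.symm, by rw [h.eq, Finset.pair_comm], by rw [Finset.pair_comm]; exact h.edge⟩

theorem mem (h : Δ.HasTwoInteriorVertices v₁ v₂) : v₁ ∈ Δ.interiorVertices := by simp [h.eq]

theorem eq_or (h : Δ.HasTwoInteriorVertices v₁ v₂) (γ : Δ.interiorVertices) :
    γ = ⟨v₁, h.mem⟩ ∨ γ = ⟨v₂, h.symm.mem⟩ := by
  have : γ.1 ∈ ({v₁, v₂} : Finset Plane) := by rw [← h.eq]; exact γ.2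
  simp only [Finset.mem_insert, Finset.mem_singleton] at this
  rcases this with h' | h'
  · exact Or.inl (Subtype.ext h')
  · exact Or.inr (Subtype.ext h')

theorem unique (h : Δ.HasTwoInteriorVertices v₁ v₂) {ε : Finset Plane} (hε : ε ∈ Δ.edges)
    (hm : v₁ ∈ ε) (hne : ε ≠ {v₁, v₂}) (γ : Δ.interiorVertices) (hγ : γ.1 ∈ ε) :
    γ = ⟨v₁, h.mem⟩ := by
  rcases h.eq_or γ with h' | h'
  · exact h'
  · exfalso
    rw [h'] at hγ
    refine hne (Finset.eq_of_subset_of_card_le ?_ ?_).symm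
    · intro x hx
      simp only [Finset.mem_insert, Finset.mem_singleton] at hx
      rcases hx with rfl | rfl
      exacts [hm, hγ]
    · rw [(Δ.mem_edges.1 hε).2, Finset.card_pair h.ne]

theorem edge_mem (h : Δ.HasTwoInteriorVertices v₁ v₂) : {v₁, v₂} ∈ Δ.interiorEdges :=
  Δ.mem_interiorEdges_of_mem_edges h.mem h.edge (by simp)

theorem incidence_right (h : Δ.HasTwoInteriorVertices v₁ v₂) :
    incidence {v₁, v₂} {v₂} = -incidence {v₁, v₂} {v₁} := by
  rw [incidence_pair h.ne, Finset.pair_comm, incidence_pair h.ne.symm]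
  rcases lexLT_trichotomy h.ne with h' | h'
  · rw [if_neg h'.2, if_pos h'.1]; rfl
  · rw [if_neg h'.2, if_pos h'.1]

theorem boundary₁_single_edge (h : Δ.HasTwoInteriorVertices v₁ v₂) (x : R) :
    Δ.boundary₁ (Pi.single ⟨_, h.edge_mem⟩ (incidence {v₁, v₂} {v₁} • x)) =
      Pi.single ⟨v₁, h.mem⟩ x - Pi.single ⟨v₂, h.symm.mem⟩ x := by
  have hne : (⟨v₁, h.mem⟩ : Δ.interiorVertices) ≠ ⟨v₂, h.symm.mem⟩ := fun he =>
    h.ne (congrArg Subtype.val he)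
  have hsq := incidence_mul_self h.edge (γ := v₁) (by simp)
  funext γ
  rw [boundary₁_single, Pi.sub_apply, smul_smul]
  rcases h.eq_or γ with rfl | rfl
  · rw [Pi.single_eq_same, Pi.single_eq_of_ne hne, hsq, one_smul, sub_zero]
  · rw [Pi.single_eq_same, Pi.single_eq_of_ne hne.symm, h.incidence_right, neg_mul, hsq, neg_one_smul,
      zero_sub]

theorem single_mem_map (h : Δ.HasTwoInteriorVertices v₁ v₂) {x : R}
    (hx : x ∈ Δ.outerIdeal r {v₁, v₂} v₁) :
    Pi.single ⟨v₁, h.mem⟩ x ∈ (Δ.edgeSub r).map Δ.boundary₁ := by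
  suffices hle : Δ.outerIdeal r {v₁, v₂} v₁ ≤ ((Δ.edgeSub r).map Δ.boundary₁).comap
      (LinearMap.single R (fun _ : Δ.interiorVertices => R) ⟨v₁, h.mem⟩) from hle hx
  refine iSup₂_le fun ε hε y hy => ?_
  obtain ⟨hne, hm⟩ := Finset.mem_erase.1 hε
  obtain ⟨hi, hm⟩ := Finset.mem_filter.1 hm
  have he := (Finset.mem_filter.1 hi).1
  refine ⟨Pi.single ⟨ε, hi⟩ (incidence ε {v₁} • y), (Δ.mem_edgeSub r).2 fun τ => ?_, ?_⟩
  · by_cases hτ : τ = ⟨ε, hi⟩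
    · subst hτ; rw [Pi.single_eq_same]; exact zsmul_mem hy _
    · rw [Pi.single_eq_of_ne hτ]; exact zero_mem _
  · rw [boundary₁_single_of_unique (γ := ⟨v₁, h.mem⟩) (h.unique he hm hne), smul_smul,
      incidence_mul_self he hm, one_smul]
    rfl

theorem boundary₁_sub_mem (h : Δ.HasTwoInteriorVertices v₁ v₂) {e : Δ.interiorEdges → R}
    (he : e ∈ Δ.edgeSub r) :
    Δ.boundary₁ e ⟨v₁, h.mem⟩ - incidence {v₁, v₂} {v₁} • e ⟨_, h.edge_mem⟩ ∈
      Δ.outerIdeal r {v₁, v₂} v₁ := by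
  rw [boundary₁_apply, ← Finset.add_sum_erase _ _ (Finset.mem_univ ⟨_, h.edge_mem⟩),
    add_sub_cancel_left]
  refine sum_mem fun ε hε => ?_
  by_cases hm : v₁ ∈ ε.1
  · refine zsmul_mem ?_ _
    have hle : edgeIdeal r ε.1 ≤ Δ.outerIdeal r {v₁, v₂} v₁ :=
      le_iSup₂_of_le (f := fun ε _ => edgeIdeal r ε) ε.1 (Finset.mem_erase.2
        ⟨fun h' => Finset.ne_of_mem_erase hε (Subtype.ext h'), Finset.mem_filter.2 ⟨ε.2, hm⟩⟩) le_rfl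
    exact hle ((Δ.mem_edgeSub r).1 he ε)
  · rw [incidence_eq_zero_of_notMem hm, zero_smul]
    exact zero_mem _

/-- Any homogeneous element over a vertex is a boundary, if the vertex is joined to a boundary
vertex. -/
theorem exists_boundary₁_eq_single (h : Δ.HasTwoInteriorVertices v₁ v₂)
    (hw : (Δ.link v₁ \ {v₂}).Nonempty) {f : R} (hf : f.IsHomogeneous d) :
    ∃ c ∈ Δ.edgeDegree d, Δ.boundary₁ c = Pi.single ⟨v₁, h.mem⟩ f := by
  obtain ⟨w, hw, hne⟩ := hw
  have hw : {v₁, w} ∈ Δ.edges := hw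
  have hi := Δ.mem_interiorEdges_of_mem_edges h.mem hw (γ := v₁) (by simp)
  refine ⟨Pi.single ⟨_, hi⟩ (incidence {v₁, w} {v₁} • f), (Δ.mem_edgeDegree d).2 fun τ => ?_, ?_⟩
  · by_cases hτ : τ = ⟨_, hi⟩
    · subst hτ; rw [Pi.single_eq_same]
      exact isHomogeneous_zsmul hf _
    · rw [Pi.single_eq_of_ne hτ]; exact MvPolynomial.isHomogeneous_zero _ _ _
  · rw [boundary₁_single_of_unique (γ := ⟨v₁, h.mem⟩) (h.unique hw (by simp)
      fun he => hne (pair_eq_pair_iff.1 he)), smul_smul, incidence_mul_self hw (by simp), one_smul]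

theorem eq_single_add_single (h : Δ.HasTwoInteriorVertices v₁ v₂) (f : Δ.interiorVertices → R) :
    f = Pi.single ⟨v₁, h.mem⟩ (f ⟨v₁, h.mem⟩) + Pi.single ⟨v₂, h.symm.mem⟩ (f ⟨v₂, h.symm.mem⟩) := by
  have hne : (⟨v₁, h.mem⟩ : Δ.interiorVertices) ≠ ⟨v₂, h.symm.mem⟩ := fun he =>
    h.ne (congrArg Subtype.val he)
  funext γ
  rcases h.eq_or γ with rfl | rfl
  · rw [Pi.add_apply, Pi.single_eq_same, Pi.single_eq_of_ne hne, add_zero]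
  · rw [Pi.add_apply, Pi.single_eq_same, Pi.single_eq_of_ne hne.symm, zero_add]

theorem exists_boundary₁_eq (h : Δ.HasTwoInteriorVertices v₁ v₂)
    (hw : (Δ.link v₁ \ {v₂}).Nonempty) (hw' : (Δ.link v₂ \ {v₁}).Nonempty)
    {f : Δ.interiorVertices → R} (hf : ∀ γ, (f γ).IsHomogeneous d) :
    ∃ c ∈ Δ.edgeDegree d, Δ.boundary₁ c = f := by
  obtain ⟨c, hc, e⟩ := h.exists_boundary₁_eq_single hw (hf ⟨v₁, h.mem⟩)
  obtain ⟨c', hc', e'⟩ := h.symm.exists_boundary₁_eq_single hw' (hf ⟨v₂, h.symm.mem⟩)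
  exact ⟨c + c', add_mem hc hc', by rw [map_add, e, e', ← h.eq_single_add_single]⟩

/-- The homology in degree `d` vanishes if and only if every form of degree `d` in the ideal of the
edge that joins the interior vertices is a sum of two elements of the intersections of that ideal
with the ideals of the other edges. -/
theorem H1Degree_eq_bot_iff (h : Δ.HasTwoInteriorVertices v₁ v₂)
    (hw : (Δ.link v₁ \ {v₂}).Nonempty) :
    Δ.H1Degree r d = ⊥ ↔ ∀ k ∈ edgeIdeal r {v₁, v₂}, k.IsHomogeneous d →
      ∃ g ∈ edgeIdeal r {v₁, v₂}, k - g ∈ Δ.outerIdeal r {v₁, v₂} v₁ ∧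
        g ∈ Δ.outerIdeal r {v₁, v₂} v₂ := by
  have hp : ({v₂, v₁} : Finset Plane) = {v₁, v₂} := Finset.pair_comm _ _
  have hne : (⟨v₁, h.mem⟩ : Δ.interiorVertices) ≠ ⟨v₂, h.symm.mem⟩ := fun he =>
    h.ne (congrArg Subtype.val he)
  have hV₁ := Δ.vertexIdeal_eq_sup r h.mem h.edge (by simp)
  have hV₂ := Δ.vertexIdeal_eq_sup r h.symm.mem h.edge (by simp)
  rw [PlanarTriangulation.H1Degree_eq_bot_iff]
  constructor
  · intro H k hk hkd
    obtain ⟨c, hc, hb⟩ := h.exists_boundary₁_eq_single hw hkd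
    obtain ⟨e, he, hbe⟩ := H c hc ((Δ.mem_vertexSub r).2 fun γ => by
      rw [hb]
      rcases h.eq_or γ with rfl | rfl
      · rw [Pi.single_eq_same, hV₁]
        exact Ideal.mem_sup_left hk
      · rw [Pi.single_eq_of_ne hne.symm]; exact zero_mem _)
    have h1 := h.boundary₁_sub_mem he
    have h2 := h.symm.boundary₁_sub_mem he
    rw [hbe, hb, Pi.single_eq_same] at h1
    simp only [hp] at h2
    rw [hbe, hb, Pi.single_eq_of_ne hne.symm, h.incidence_right, neg_smul, zero_sub, neg_neg] at h2
    have hτ : e ⟨_, h.edge_mem⟩ ∈ edgeIdeal r {v₁, v₂} := (Δ.mem_edgeSub r).1 he ⟨_, h.edge_mem⟩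
    exact ⟨incidence {v₁, v₂} {v₁} • e ⟨_, h.edge_mem⟩, zsmul_mem hτ _, h1, h2⟩
  · intro H c hc hb
    rw [mem_edgeDegree] at hc
    have hdeg := Δ.isHomogeneous_boundary₁ hc
    have split : ∀ {O : Ideal R}, ClosedUnderComponents O → ∀ γ,
        Δ.boundary₁ c γ ∈ edgeIdeal r {v₁, v₂} ⊔ O →
        ∃ k ∈ edgeIdeal r {v₁, v₂}, k.IsHomogeneous d ∧ Δ.boundary₁ c γ - k ∈ O := by
      intro O hO γ hm
      obtain ⟨k, hk, o, ho, he⟩ := Submodule.mem_sup.1 hm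
      refine ⟨_, closedUnderComponents_edgeIdeal _ _ d k hk,
        MvPolynomial.homogeneousComponent_isHomogeneous _ _, ?_⟩
      have := MvPolynomial.homogeneousComponent_of_mem (m := d) (hdeg γ)
      rw [if_pos rfl] at this
      rw [← this, ← map_sub, ← he, add_sub_cancel_left]
      exact hO d o ho
    obtain ⟨h₁, hh₁, hd₁, ho₁⟩ := split (Δ.closedUnderComponents_outerIdeal r {v₁, v₂} v₁)
      ⟨v₁, h.mem⟩ (hV₁.le ((Δ.mem_vertexSub r).1 hb ⟨v₁, h.mem⟩))
    obtain ⟨h₂, hh₂, hd₂, ho₂⟩ := split (Δ.closedUnderComponents_outerIdeal r {v₁, v₂} v₂)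
      ⟨v₂, h.symm.mem⟩ (hV₂.le ((Δ.mem_vertexSub r).1 hb ⟨v₂, h.symm.mem⟩))
    obtain ⟨g, hg, hg₁, hg₂⟩ := H (h₁ + h₂) (add_mem hh₁ hh₂) (hd₁.add hd₂)
    suffices hmem : Δ.boundary₁ c ∈ (Δ.edgeSub r).map Δ.boundary₁ from hmem
    have e1 := h.single_mem_map (add_mem ho₁ hg₁)
    have e2 := h.symm.single_mem_map (r := r) (x := Δ.boundary₁ c ⟨v₂, h.symm.mem⟩ - h₂ + g)
      (by rw [hp]; exact add_mem ho₂ hg₂)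
    have e3 : Pi.single ⟨v₁, h.mem⟩ (g - h₂) - Pi.single ⟨v₂, h.symm.mem⟩ (g - h₂) ∈
        (Δ.edgeSub r).map Δ.boundary₁ := by
      rw [← h.boundary₁_single_edge]
      refine Submodule.mem_map_of_mem ((Δ.mem_edgeSub r).2 fun τ => ?_)
      by_cases hτ : τ = ⟨_, h.edge_mem⟩
      · subst hτ; rw [Pi.single_eq_same]; exact zsmul_mem (sub_mem hg hh₂) _
      · rw [Pi.single_eq_of_ne hτ]; exact zero_mem _
    convert add_mem (add_mem e1 e2) e3 using 1
    funext γ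
    rcases h.eq_or γ with rfl | rfl
    · simp only [Pi.add_apply, Pi.sub_apply, Pi.single_eq_same, Pi.single_eq_of_ne hne]
      ring
    · simp only [Pi.add_apply, Pi.sub_apply, Pi.single_eq_same, Pi.single_eq_of_ne hne.symm]
      ring

/-- The vanishing of the homology in the coordinates of a frame. -/
theorem exists_H1Degree_eq_bot_iff (h : Δ.HasTwoInteriorVertices v₁ v₂)
    (hw : (Δ.link v₁ \ {v₂}).Nonempty)
    (hslope₁ : ∀ w, {v₁, w} ∈ Δ.edges → w ≠ v₂ → slope v₁ w ≠ slope v₁ v₂)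
    (hslope₂ : ∀ w, {v₂, w} ∈ Δ.edges → w ≠ v₁ → slope v₂ w ≠ slope v₂ v₁) (r : ℕ) :
    ∃ S T : Finset ℝ, S.card = (slopes (Δ.edges.erase {v₁, v₂}) v₁).ncard ∧
      T.card = (slopes (Δ.edges.erase {v₁, v₂}) v₂).ncard ∧
      (∀ e, Δ.H1Degree r (r + 1 + e) = ⊥ ↔ bidegLE e ≤ bicolonSum (r + 1) S T e) ∧
      (∃ M M', M' * M = 1 ∧ Δ.vertexIdeal r v₁ =
        pencilIdeal M' (r + 1) (insert none (S.map Function.Embedding.some))) ∧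
      (∃ M M', M' * M = 1 ∧ Δ.vertexIdeal r v₂ =
        pencilIdeal M' (r + 1) (insert none (T.map Function.Embedding.some))) := by
  have hp : ({v₂, v₁} : Finset Plane) = {v₁, v₂} := Finset.pair_comm _ _
  obtain ⟨M, M', hF, hF'⟩ := exists_isFrame h.ne
  obtain ⟨S, hS, hO₁, hV₁⟩ := Δ.exists_slopes hF h.mem h.edge hslope₁ r
  obtain ⟨T, hT, hO₂, hV₂⟩ := Δ.exists_slopes hF' h.symm.mem h.symm.edge hslope₂ r
  rw [hp] at hT hO₂
  refine ⟨S, T, hS, hT, fun e => ?_, ⟨_, _, hF.mul, hV₁⟩, ⟨_, _, hF'.mul, hV₂⟩⟩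
  rw [h.H1Degree_eq_bot_iff hw, ← forall_mem_colon_iff hF.mul, hO₁, hO₂, hF.edgeIdeal_eq_none]
  have hℓ : (linForm (M' 2) ^ (r + 1)).IsHomogeneous (r + 1) := by
    have := (linForm_isHomogeneous (M' 2)).pow (r + 1)
    rwa [one_mul] at this
  constructor
  · intro H f hf
    obtain ⟨g, hg, h1, h2⟩ := H (linForm (M' 2) ^ (r + 1) * f)
      (Ideal.mem_span_singleton.2 (dvd_mul_right _ _)) (hℓ.mul hf)
    obtain ⟨g, rfl⟩ := Ideal.mem_span_singleton.1 hg
    refine ⟨g, ?_, h2⟩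
    rw [mul_sub]; exact h1
  · intro H k hk hkd
    obtain ⟨q, rfl⟩ := Ideal.mem_span_singleton.1 hk
    have e1 : linForm (M' 2) ^ (r + 1) * q =
        linForm (M' 2) ^ (r + 1) * homogeneousComponent e q := by
      have := MvPolynomial.homogeneousComponent_of_mem (m := r + 1 + e) hkd
      rw [if_pos rfl] at this
      rw [← homogeneousComponent_mul_of_isHomogeneous hℓ]
      exact this.symm
    obtain ⟨g, h1, h2⟩ := H _ (MvPolynomial.homogeneousComponent_isHomogeneous e q)
    refine ⟨linForm (M' 2) ^ (r + 1) * g, Ideal.mem_span_singleton.2 (dvd_mul_right _ _), ?_, h2⟩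
    rw [mul_sub] at h1
    change linForm (M' 2) ^ (r + 1) * q - _ ∈ _
    rw [e1]
    exact h1

end HasTwoInteriorVertices
end PlanarTriangulation
end SplineTriangulation

end

noncomputable section

namespace SplineTriangulation

open MvPolynomial (homogeneousComponent homogeneousSubmodule pderiv)

theorem hasFDerivAt_eval_pt (f : R) (x : Plane) :
    HasFDerivAt (fun x : Plane => MvPolynomial.eval (pt x) f)
      (MvPolynomial.eval (pt x) (pderiv 0 f) • ContinuousLinearMap.proj (R := ℝ) 0 +
        MvPolynomial.eval (pt x) (pderiv 1 f) • ContinuousLinearMap.proj (R := ℝ) 1 :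
          Plane →L[ℝ] ℝ) x := by
  induction f using MvPolynomial.induction_on with
  | C a => simpa using hasFDerivAt_const a x
  | add p q hp hq =>
    refine ((hp.add hq).congr_of_eventuallyEq
      (Filter.Eventually.of_forall fun y => by simp)).congr_fderiv ?_
    ext v
    simp
    ring
  | mul_X p i hp =>
    have hX : HasFDerivAt (fun x : Plane => pt x i)
        ((if i = 0 then 1 else 0 : ℝ) • ContinuousLinearMap.proj (R := ℝ) 0 +
          (if i = 1 then 1 else 0 : ℝ) • ContinuousLinearMap.proj (R := ℝ) 1 : Plane →L[ℝ] ℝ) x := by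
      fin_cases i
      · simpa [pt] using hasFDerivAt_apply (𝕜 := ℝ) (0 : Fin 2) x
      · simpa [pt] using hasFDerivAt_apply (𝕜 := ℝ) (1 : Fin 2) x
      · simpa [pt] using hasFDerivAt_const (1 : ℝ) x
    refine ((hp.mul hX).congr_of_eventuallyEq
      (Filter.Eventually.of_forall fun y => by simp)).congr_fderiv ?_
    ext v
    simp only [Derivation.leibniz, smul_eq_mul, map_add, map_mul, MvPolynomial.pderiv_X,
      MvPolynomial.eval_X, add_apply, smul_apply, ContinuousLinearMap.proj_apply, Pi.single_apply]
    fin_cases i <;> simp <;> ring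

theorem pow_dvd_pderiv {ℓ q : R} {n : ℕ} (h : ℓ ^ (n + 1) ∣ q) (i : Fin 3) : ℓ ^ n ∣ pderiv i q := by
  obtain ⟨g, rfl⟩ := h
  rw [Derivation.leibniz, Derivation.leibniz_pow]
  refine dvd_add (Dvd.dvd.mul_right (pow_dvd_pow _ n.le_succ) _) ?_
  simp only [Nat.add_sub_cancel, smul_eq_mul, nsmul_eq_mul]
  exact ⟨g * (((n + 1 : ℕ) : R) * pderiv i ℓ), by ring⟩

theorem pderiv_linForm (c : Fin 3 → ℝ) (i : Fin 3) :
    pderiv i (linForm c) = MvPolynomial.C (c i) := by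
  simp [linForm, map_sum, MvPolynomial.pderiv_X, Pi.single_apply, MvPolynomial.smul_eq_C_mul]

theorem pow_succ_dvd_of_pderiv {c : Fin 3 → ℝ} (hc : c 0 ≠ 0 ∨ c 1 ≠ 0) {q : R} {m : ℕ}
    (h : linForm c ∣ q) (h0 : linForm c ^ m ∣ pderiv 0 q) (h1 : linForm c ^ m ∣ pderiv 1 q) :
    linForm c ^ (m + 1) ∣ q := by
  have key : ∀ i : Fin 3, c i ≠ 0 → linForm c ^ m ∣ pderiv i q → linForm c ^ (m + 1) ∣ q := by
    intro i hi hd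
    have hne : linForm c ≠ 0 := by
      intro h0
      have := pderiv_linForm c i
      rw [h0, map_zero, eq_comm, MvPolynomial.C_eq_zero] at this
      exact hi this
    have step : ∀ k ≤ m, linForm c ^ (k + 1) ∣ q := by
      intro k
      induction k with
      | zero => intro _; simpa using h
      | succ k ih =>
        intro hk
        obtain ⟨g, rfl⟩ := ih (by omega)
        have hd' := (pow_dvd_pow (linForm c) hk).trans hd
        rw [Derivation.leibniz, Derivation.leibniz_pow, pderiv_linForm] at hd'
        have h2 : linForm c ^ (k + 1) ∣ linForm c ^ (k + 1) • pderiv i g :=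
          ⟨pderiv i g, by rw [smul_eq_mul]⟩
        have h3 := (dvd_add_right h2).1 hd'
        simp only [Nat.add_sub_cancel, smul_eq_mul, nsmul_eq_mul] at h3
        have e : g * (((k + 1 : ℕ) : R) * (linForm c ^ k * MvPolynomial.C (c i))) =
            linForm c ^ k * (MvPolynomial.C (((k + 1 : ℕ) : ℝ) * c i) * g) := by
          rw [map_mul, map_natCast]; ring
        rw [e, pow_succ] at h3
        have h4 := (mul_dvd_mul_iff_left (pow_ne_zero k hne)).1 h3
        have hu : IsUnit (MvPolynomial.C (((k + 1 : ℕ) : ℝ) * c i) : R) :=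
          (mul_ne_zero (Nat.cast_ne_zero.2 k.succ_ne_zero) hi).isUnit.map MvPolynomial.C
        rw [pow_succ]
        exact mul_dvd_mul_left _ ((hu.dvd_mul_left).1 h4)
    exact step m le_rfl
  rcases hc with h | h
  exacts [key 0 h h0, key 1 h h1]

/-- A form that vanishes on a segment is divisible by the linear form of the line. -/
theorem linForm_dvd_of_eval_eq_zero {a b : Plane} (hab : a ≠ b) {q : R} {d : ℕ}
    (hq : q.IsHomogeneous d)
    (h : ∀ x ∈ PlanarTriangulation.hull {a, b}, MvPolynomial.eval (pt x) q = 0) :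
    linForm (lineCoeff a b) ∣ q := by
  obtain ⟨M, M', hF, -⟩ := exists_isFrame hab
  have hmul' : M * M' = 1 := mul_eq_one_comm.1 hF.mul
  have hMa : ∀ i, M i 1 = pt a i := by
    intro i
    have := congrArg (fun w => M.mulVec w i) hF.right
    simp only [Matrix.mulVec_mulVec, hmul', Matrix.one_mulVec] at this
    rw [this]; simp
  have hMb : ∀ i, M i 0 = pt b i := by
    intro i
    have := congrArg (fun w => M.mulVec w i) hF.left
    simp only [Matrix.mulVec_mulVec, hmul', Matrix.one_mulVec] at this
    rw [this]; simp
  set ψ : R →ₐ[ℝ] MvPolynomial (Fin 2) ℝ := MvPolynomial.aeval fun i =>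
    MvPolynomial.C (pt b i) * MvPolynomial.X 0 + MvPolynomial.C (pt a i) * MvPolynomial.X 1 with hψ
  have e1 : ∀ (y : Fin 2 → ℝ) (f : R),
      MvPolynomial.eval y (ψ f) = MvPolynomial.eval (y 0 • pt b + y 1 • pt a) f := by
    intro y f
    induction f using MvPolynomial.induction_on with
    | C c => simp
    | add p q hp hq => rw [map_add, map_add, map_add, hp, hq]
    | mul_X p i hp => rw [map_mul, map_mul, map_mul, hp]; simp [hψ, mul_comm]
  have h0 : ψ q = 0 := by
    refine MvPolynomial.funext_set (fun _ => Set.Ioi (0 : ℝ)) (fun _ => Set.Ioi_infinite _)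
      fun y hy => ?_
    have hy0 : 0 < y 0 := hy 0 trivial
    have hy1 : 0 < y 1 := hy 1 trivial
    have hs : y 0 + y 1 ≠ 0 := by positivity
    rw [e1, map_zero]
    have hx := h ((y 1 / (y 0 + y 1)) • a + (y 0 / (y 0 + y 1)) • b)
      (mem_convexHull_pair.2 ⟨_, _, by positivity, by positivity, by field_simp; ring, rfl⟩)
    have hp : y 0 • pt b + y 1 • pt a =
        (y 0 + y 1) • pt ((y 1 / (y 0 + y 1)) • a + (y 0 / (y 0 + y 1)) • b) := by
      ext i
      fin_cases i
      · simp [pt]; field_simp; ring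
      · simp [pt]; field_simp; ring
      · simp [pt]
    rw [hp, eval_smul_of_isHomogeneous hq, hx, mul_zero]
  have e2 : ∀ f : R, linForm (M' 2) ∣ f - MvPolynomial.aeval
      (fun k : Fin 2 => (![linForm (M' 0), linForm (M' 1)] k : R)) (ψ f) := by
    intro f
    induction f using MvPolynomial.induction_on with
    | C c => simp
    | add p q hp hq =>
      rw [map_add, map_add, add_sub_add_comm]
      exact dvd_add hp hq
    | mul_X p i hp =>
      have hX : (MvPolynomial.X i : R) = MvPolynomial.C (M i 0) * linForm (M' 0) +
          MvPolynomial.C (M i 1) * linForm (M' 1) + MvPolynomial.C (M i 2) * linForm (M' 2) := by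
        rw [← linForm_smul, ← linForm_smul, ← linForm_smul]
        have : ∀ c c' : Fin 3 → ℝ, linForm c + linForm c' = linForm (c + c') := by
          intro c c'
          simp [linForm, add_smul, Finset.sum_add_distrib]
        rw [this, this]
        have hrow : M i 0 • M' 0 + M i 1 • M' 1 + M i 2 • M' 2 = Pi.single i 1 := by
          ext j
          have := congrFun (congrFun hmul' i) j
          rw [Matrix.mul_apply, Fin.sum_univ_three] at this
          simpa [Matrix.one_apply, Pi.single_apply, eq_comm] using this
        rw [hrow]
        simp [linForm, Pi.single_apply]
      rw [map_mul, map_mul]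
      have h2 : MvPolynomial.aeval (fun k : Fin 2 => (![linForm (M' 0), linForm (M' 1)] k : R))
          (ψ (MvPolynomial.X i)) = MvPolynomial.X i - MvPolynomial.C (M i 2) * linForm (M' 2) := by
        rw [hX, hψ]
        rw [← hX]
        simp only [MvPolynomial.aeval_X, map_add, map_mul, MvPolynomial.aeval_C, ← hMa, ← hMb,
          MvPolynomial.algebraMap_eq, Matrix.cons_val_zero, Matrix.cons_val_one]
        rw [hX]; ring
      rw [h2]
      have h5 : ∀ A : R, p * MvPolynomial.X i -
          A * (MvPolynomial.X i - MvPolynomial.C (M i 2) * linForm (M' 2)) =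
          (p - A) * MvPolynomial.X i + linForm (M' 2) * (A * MvPolynomial.C (M i 2)) := by
        intro A; ring
      rw [h5]
      exact dvd_add (hp.mul_right _) (dvd_mul_right _ _)
  have h3 := e2 q
  rw [h0, map_zero, sub_zero] at h3
  have h4 : ∃ k : ℝ, k ≠ 0 ∧ linForm (M' 2) = MvPolynomial.C k * linForm (lineCoeff a b) := by
    obtain ⟨k, hk⟩ := exists_eq_smul_lineCoeff hab (c := M' 2)
      (by rw [eval_linForm_row, hF.right]; simp) (by rw [eval_linForm_row, hF.left]; simp)
    refine ⟨k, ?_, by rw [← linForm_smul, ← hk]⟩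
    rintro rfl
    have := congrFun (congrFun hF.mul 2) 2
    rw [Matrix.mul_apply, hk] at this
    simp at this
  obtain ⟨k, hk, he⟩ := h4
  rw [he] at h3
  exact (dvd_mul_left _ _).trans h3

theorem exists_eval_eq_of_totalDegree_le {d : ℕ} {p : MvPolynomial (Fin 2) ℝ}
    (hp : p.totalDegree ≤ d) : ∃ h : R, h.IsHomogeneous d ∧
      ∀ x : Plane, MvPolynomial.eval (pt x) h = MvPolynomial.eval x p := by
  refine ⟨∑ m ∈ p.support, MvPolynomial.C (p.coeff m) * (MvPolynomial.X 0 ^ m 0 *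
    MvPolynomial.X 1 ^ m 1 * MvPolynomial.X 2 ^ (d - m 0 - m 1)), ?_, fun x => ?_⟩
  · refine MvPolynomial.IsHomogeneous.sum _ _ _ fun m hm => ?_
    have hle := (MvPolynomial.le_totalDegree hm).trans hp
    rw [Finsupp.sum_fintype _ _ (fun _ => rfl), Fin.sum_univ_two] at hle
    have := (((MvPolynomial.isHomogeneous_X ℝ (0 : Fin 3)).pow (m 0)).mul
      ((MvPolynomial.isHomogeneous_X ℝ (1 : Fin 3)).pow (m 1))).mul
      ((MvPolynomial.isHomogeneous_X ℝ (2 : Fin 3)).pow (d - m 0 - m 1))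
    have h2 := (MvPolynomial.isHomogeneous_C (Fin 3) (p.coeff m)).mul this
    convert h2 using 1
    omega
  · rw [map_sum, MvPolynomial.eval_eq' x p]
    refine Finset.sum_congr rfl fun m _ => ?_
    simp [pt, Fin.prod_univ_two]

theorem exists_totalDegree_le_of_isHomogeneous {d : ℕ} {h : R} (hh : h.IsHomogeneous d) :
    ∃ p : MvPolynomial (Fin 2) ℝ, p.totalDegree ≤ d ∧
      ∀ x : Plane, MvPolynomial.eval x p = MvPolynomial.eval (pt x) h := by
  refine ⟨∑ m ∈ h.support, MvPolynomial.C (h.coeff m) * (MvPolynomial.X 0 ^ m 0 *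
    MvPolynomial.X 1 ^ m 1), ?_, fun x => ?_⟩
  · refine MvPolynomial.totalDegree_finsetSum_le fun m hm => ?_
    have hd : m.degree = d := by
      rw [Finsupp.degree_eq_weight_one]
      exact hh (MvPolynomial.mem_support_iff.1 hm)
    have hd' : m 0 + m 1 + m 2 = d := by
      rw [← hd, Finsupp.degree_eq_sum, Fin.sum_univ_three]
    have h1 := (((MvPolynomial.isHomogeneous_X ℝ (0 : Fin 2)).pow (m 0)).mul
      ((MvPolynomial.isHomogeneous_X ℝ (1 : Fin 2)).pow (m 1)))
    have h2 := (MvPolynomial.isHomogeneous_C (Fin 2) (h.coeff m)).mul h1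
    refine h2.totalDegree_le.trans ?_
    omega
  · rw [map_sum, MvPolynomial.eval_eq']
    refine Finset.sum_congr rfl fun m _ => ?_
    simp [pt, Fin.prod_univ_three]

/-- A form that vanishes on a triangle is zero. -/
theorem eq_zero_of_eval_hull_eq_zero {a b c : Plane}
    (h0 : orient a b c ≠ 0) {q : R} {d : ℕ} (hq : q.IsHomogeneous d)
    (h : ∀ x ∈ PlanarTriangulation.hull {a, b, c}, MvPolynomial.eval (pt x) q = 0) : q = 0 := by
  set M : Matrix (Fin 3) (Fin 3) ℝ := !![a 0, b 0, c 0; a 1, b 1, c 1; 1, 1, 1] with hM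
  have hdet : M.det = orient a b c := by
    rw [hM, Matrix.det_fin_three]
    simp [orient]
    ring
  have hmul : M * M⁻¹ = 1 := Matrix.mul_nonsing_inv _ (by rw [hdet]; exact h0.isUnit)
  set ψ : R →ₐ[ℝ] R := MvPolynomial.aeval fun i => linForm (M i) with hψ
  have e1 : ∀ (y : Fin 3 → ℝ) (f : R),
      MvPolynomial.eval y (ψ f) = MvPolynomial.eval (M.mulVec y) f := by
    intro y f
    induction f using MvPolynomial.induction_on with
    | C c => simp
    | add p q hp hq => rw [map_add, map_add, map_add, hp, hq]
    | mul_X p i hp =>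
      rw [map_mul, map_mul, map_mul, hp, hψ, MvPolynomial.aeval_X, eval_linForm, MvPolynomial.eval_X]
      rfl
  have hψ0 : ψ q = 0 := by
    refine MvPolynomial.funext_set (fun _ => Set.Ioi (0 : ℝ)) (fun _ => Set.Ioi_infinite _)
      fun y hy => ?_
    have hy0 : 0 < y 0 := hy 0 trivial
    have hy1 : 0 < y 1 := hy 1 trivial
    have hy2 : 0 < y 2 := hy 2 trivial
    set s := y 0 + y 1 + y 2 with hs
    have hs0 : s ≠ 0 := by positivity
    rw [e1, map_zero]
    have hx := h ((y 0 / s) • a + (y 1 / s) • b + (y 2 / s) • c)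
      (mem_convexHull_triple.2 ⟨_, _, _, by positivity, by positivity, by positivity,
        by rw [← add_div, ← add_div, ← hs, div_self hs0], rfl⟩)
    have hp : M.mulVec y = s • pt ((y 0 / s) • a + (y 1 / s) • b + (y 2 / s) • c) := by
      ext i
      fin_cases i
      · simp [pt, hM, Matrix.mulVec, dotProduct, Fin.sum_univ_three]; field_simp
      · simp [pt, hM, Matrix.mulVec, dotProduct, Fin.sum_univ_three]; field_simp
      · simp [pt, hM, Matrix.mulVec, dotProduct, Fin.sum_univ_three, hs]
    rw [hp, eval_smul_of_isHomogeneous hq, hx, mul_zero]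
  refine MvPolynomial.funext fun y => ?_
  have := e1 (M⁻¹.mulVec y) q
  rw [hψ0, Matrix.mulVec_mulVec, hmul, Matrix.one_mulVec] at this
  rw [← this, map_zero, map_zero]

end SplineTriangulation

end

noncomputable section

open Topology

namespace SplineTriangulation

open MvPolynomial (pderiv)

namespace PlanarTriangulation

variable (Δ : PlanarTriangulation)

/-- The forms on adjacent triangles agree up to order `n` along the common edge. -/
def Compatible (n : ℕ) (h : Finset Plane → R) : Prop :=
  ∀ σ ∈ Δ.triangles, ∀ σ' ∈ Δ.triangles, ∀ a b, {a, b} ∈ Δ.edges → {a, b} ⊆ σ → {a, b} ⊆ σ' →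
    linForm (lineCoeff a b) ^ n ∣ h σ - h σ'

variable {Δ} {n : ℕ} {h : Finset Plane → R}

theorem Compatible.mono {m : ℕ} (hmn : m ≤ n) (hh : Δ.Compatible n h) : Δ.Compatible m h :=
  fun σ hσ σ' hσ' a b he hs hs' => (pow_dvd_pow _ hmn).trans (hh σ hσ σ' hσ' a b he hs hs')

theorem Compatible.pderiv (hh : Δ.Compatible (n + 1) h) (i : Fin 3) :
    Δ.Compatible n fun σ => MvPolynomial.pderiv i (h σ) :=
  fun σ hσ σ' hσ' a b he hs hs' => by
    dsimp only
    rw [← map_sub]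
    exact pow_dvd_pderiv (hh σ hσ σ' hσ' a b he hs hs') i

variable (Δ) in
/-- The function that is given by the form `h σ` on each triangle `σ`. -/
def glue (h : Finset Plane → R) (x : Plane) : ℝ :=
  if H : ∃ σ ∈ Δ.triangles, x ∈ hull σ then MvPolynomial.eval (pt x) (h H.choose) else 0

theorem Compatible.eval_eq (hh : Δ.Compatible 1 h) {σ σ' : Finset Plane} (hσ : σ ∈ Δ.triangles)
    (hσ' : σ' ∈ Δ.triangles) {x : Plane} (hx : x ∈ hull σ) (hx' : x ∈ hull σ') :
    MvPolynomial.eval (pt x) (h σ) = MvPolynomial.eval (pt x) (h σ') := by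
  have := Δ.reflTransGen_adjacent hσ hσ' hx hx'
  clear hσ' hx'
  induction this with
  | refl => rfl
  | tail _ hadj ih =>
    rw [ih]
    obtain ⟨h1, h2, a, b, he, hs, hs', hxe⟩ := hadj
    obtain ⟨g, hg⟩ := hh _ h1 _ h2 a b he hs hs'
    rw [← sub_eq_zero, ← map_sub, hg, map_mul, pow_one, eval_lineCoeff, hull_subset_zero hxe,
      zero_mul]

theorem Compatible.glue_eq (hh : Δ.Compatible 1 h) {σ : Finset Plane} (hσ : σ ∈ Δ.triangles)
    {x : Plane} (hx : x ∈ hull σ) : Δ.glue h x = MvPolynomial.eval (pt x) (h σ) := by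
  have H : ∃ σ ∈ Δ.triangles, x ∈ hull σ := ⟨σ, hσ, hx⟩
  rw [glue, dif_pos H]
  exact hh.eval_eq H.choose_spec.1 hσ H.choose_spec.2 hx

theorem domain_eq_biUnion : Δ.domain = ⋃ σ ∈ Δ.triangles, hull σ := by
  ext x
  simp [Δ.mem_domain]

theorem Compatible.hasFDerivWithinAt_glue (hh : Δ.Compatible 2 h) (x : Plane) :
    HasFDerivWithinAt (Δ.glue h)
      (Δ.glue (fun σ => MvPolynomial.pderiv 0 (h σ)) x • ContinuousLinearMap.proj (R := ℝ) 0 +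
        Δ.glue (fun σ => MvPolynomial.pderiv 1 (h σ)) x • ContinuousLinearMap.proj (R := ℝ) 1 :
          Plane →L[ℝ] ℝ) Δ.domain x := by
  have key : ∀ T ⊆ Δ.triangles, HasFDerivWithinAt (Δ.glue h)
      (Δ.glue (fun σ => MvPolynomial.pderiv 0 (h σ)) x • ContinuousLinearMap.proj (R := ℝ) 0 +
        Δ.glue (fun σ => MvPolynomial.pderiv 1 (h σ)) x • ContinuousLinearMap.proj (R := ℝ) 1 :
          Plane →L[ℝ] ℝ) (⋃ σ ∈ T, hull σ) x := by
    intro T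
    induction T using Finset.induction_on with
    | empty =>
      intro _
      refine HasFDerivWithinAt.of_notMem_closure ?_
      simp
    | insert σ T _ ih =>
      intro hT
      rw [Finset.set_biUnion_insert]
      refine HasFDerivWithinAt.union ?_ (ih ((Finset.subset_insert σ T).trans hT))
      have hσ := hT (Finset.mem_insert_self σ T)
      by_cases hxσ : x ∈ hull σ
      · rw [(hh.pderiv 0).glue_eq hσ hxσ, (hh.pderiv 1).glue_eq hσ hxσ]
        exact (hasFDerivAt_eval_pt (h σ) x).hasFDerivWithinAt.congr
          (fun y hy => (hh.mono one_le_two).glue_eq hσ hy) ((hh.mono one_le_two).glue_eq hσ hxσ)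
      · exact HasFDerivWithinAt.of_notMem_closure (by rwa [(isClosed_hull σ).closure_eq])
  rw [domain_eq_biUnion]
  exact key _ subset_rfl

theorem continuous_eval_pt (f : R) : Continuous fun x : Plane => MvPolynomial.eval (pt x) f :=
  continuous_iff_continuousAt.2 fun x => (hasFDerivAt_eval_pt f x).continuousAt

theorem Compatible.continuousOn_glue (hh : Δ.Compatible 1 h) : ContinuousOn (Δ.glue h) Δ.domain := by
  have key : ∀ T ⊆ Δ.triangles, ∀ x, ContinuousWithinAt (Δ.glue h) (⋃ σ ∈ T, hull σ) x := by
    intro T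
    induction T using Finset.induction_on with
    | empty => intro _ x; exact continuousWithinAt_of_notMem_closure (by simp)
    | insert σ T _ ih =>
      intro hT x
      rw [Finset.set_biUnion_insert]
      refine ContinuousWithinAt.union ?_ (ih ((Finset.subset_insert σ T).trans hT) x)
      have hσ := hT (Finset.mem_insert_self σ T)
      by_cases hxσ : x ∈ hull σ
      · exact (continuous_eval_pt (h σ)).continuousWithinAt.congr (fun y hy => hh.glue_eq hσ hy)
          (hh.glue_eq hσ hxσ)
      · exact continuousWithinAt_of_notMem_closure (by rwa [(isClosed_hull σ).closure_eq])
  rw [domain_eq_biUnion]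
  exact fun x _ => key _ subset_rfl x

theorem Compatible.contDiffOn_glue {n : ℕ} {h : Finset Plane → R} (hh : Δ.Compatible (n + 1) h) :
    ContDiffOn ℝ n (Δ.glue h) Δ.domain := by
  induction n generalizing h with
  | zero => exact contDiffOn_zero.2 hh.continuousOn_glue
  | succ n ih =>
    rw [Nat.cast_succ, contDiffOn_succ_iff_hasFDerivWithinAt (by simp)]
    intro x hx
    refine ⟨Δ.domain, ?_, by simp, _,
      fun y _ => (hh.mono (by omega)).hasFDerivWithinAt_glue y, ?_⟩
    · rw [Set.insert_eq_of_mem hx]; exact self_mem_nhdsWithin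
    · exact ((ih (hh.pderiv 0)).smul contDiffOn_const).add ((ih (hh.pderiv 1)).smul contDiffOn_const)

theorem uniqueDiffWithinAt_hull {σ : Finset Plane} (hσ : σ ∈ Δ.triangles) {x : Plane}
    (hx : x ∈ hull σ) : UniqueDiffWithinAt ℝ (hull σ) x := by
  obtain ⟨y, -, hy⟩ := Δ.exists_mem_interior hσ
  exact uniqueDiffWithinAt_convex (convex_convexHull ℝ _) ⟨y, mem_interior_iff_mem_nhds.2 hy⟩
    (subset_closure hx)

theorem hull_subset_domain {σ : Finset Plane} (hσ : σ ∈ Δ.triangles) : hull σ ⊆ Δ.domain :=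
  fun _ hx => Δ.mem_domain.2 ⟨σ, hσ, hx⟩

theorem uniqueDiffOn_domain : UniqueDiffOn ℝ Δ.domain := by
  intro x hx
  obtain ⟨σ, hσ, hxσ⟩ := Δ.mem_domain.1 hx
  exact (uniqueDiffWithinAt_hull hσ hxσ).mono (hull_subset_domain hσ)

theorem lineCoeff_ne_zero_or {a b : Plane} (hab : a ≠ b) :
    lineCoeff a b 0 ≠ 0 ∨ lineCoeff a b 1 ≠ 0 := by
  by_contra hcon
  push Not at hcon
  simp [lineCoeff] at hcon
  refine hab ?_
  ext i
  fin_cases i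
  · simp; linarith
  · simp; linarith

theorem compatible_one {d : ℕ} {h : Finset Plane → R} {F : Plane → ℝ}
    (hd : ∀ σ ∈ Δ.triangles, (h σ).IsHomogeneous d)
    (hFh : ∀ σ ∈ Δ.triangles, ∀ x ∈ hull σ, F x = MvPolynomial.eval (pt x) (h σ)) :
    Δ.Compatible 1 h := by
  intro σ hσ σ' hσ' a b he hs hs'
  rw [pow_one]
  refine linForm_dvd_of_eval_eq_zero (Δ.ne_of_mem_edges he) ((hd σ hσ).sub (hd σ' hσ'))
    fun x hx => ?_
  rw [map_sub, ← hFh σ hσ x (convexHull_mono (Finset.coe_subset.2 hs) hx),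
    ← hFh σ' hσ' x (convexHull_mono (Finset.coe_subset.2 hs') hx), sub_self]

/-- A piecewise polynomial function of class `C^n` satisfies the divisibility conditions. -/
theorem compatible_of_contDiffOn {n d : ℕ} {h : Finset Plane → R} {F : Plane → ℝ}
    (hd : ∀ σ ∈ Δ.triangles, (h σ).IsHomogeneous d) (hF : ContDiffOn ℝ n F Δ.domain)
    (hFh : ∀ σ ∈ Δ.triangles, ∀ x ∈ hull σ, F x = MvPolynomial.eval (pt x) (h σ)) :
    Δ.Compatible (n + 1) h := by
  induction n generalizing d h F with
  | zero => exact compatible_one hd hFh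
  | succ n ih =>
    rw [Nat.cast_succ, contDiffOn_succ_iff_fderivWithin uniqueDiffOn_domain] at hF
    obtain ⟨hdiff, -, hF'⟩ := hF
    have hder : ∀ σ ∈ Δ.triangles, ∀ x ∈ hull σ, fderivWithin ℝ F Δ.domain x =
        MvPolynomial.eval (pt x) (MvPolynomial.pderiv 0 (h σ)) • ContinuousLinearMap.proj (R := ℝ) 0 +
        MvPolynomial.eval (pt x) (MvPolynomial.pderiv 1 (h σ)) •
          ContinuousLinearMap.proj (R := ℝ) 1 := by
      intro σ hσ x hx
      have h1 := (hdiff x (hull_subset_domain hσ hx)).hasFDerivWithinAt.mono (hull_subset_domain hσ)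
      have h2 := (hasFDerivAt_eval_pt (h σ) x).hasFDerivWithinAt.congr (hFh σ hσ) (hFh σ hσ x hx)
      exact (uniqueDiffWithinAt_hull hσ hx).eq h1 h2
    have c0 := ih (h := fun σ => MvPolynomial.pderiv 0 (h σ)) (fun σ hσ => (hd σ hσ).pderiv)
      (hF'.clm_apply (contDiffOn_const (c := (Pi.single 0 1 : Plane))))
      (fun σ hσ x hx => by rw [hder σ hσ x hx]; simp)
    have c1 := ih (h := fun σ => MvPolynomial.pderiv 1 (h σ)) (fun σ hσ => (hd σ hσ).pderiv)
      (hF'.clm_apply (contDiffOn_const (c := (Pi.single 1 1 : Plane))))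
      (fun σ hσ x hx => by rw [hder σ hσ x hx]; simp)
    intro σ hσ σ' hσ' a b he hs hs'
    have d1 := compatible_one hd hFh σ hσ σ' hσ' a b he hs hs'
    rw [pow_one] at d1
    refine pow_succ_dvd_of_pderiv (lineCoeff_ne_zero_or (Δ.ne_of_mem_edges he)) d1 ?_ ?_
    · rw [map_sub]; exact c0 σ hσ σ' hσ' a b he hs hs'
    · rw [map_sub]; exact c1 σ hσ σ' hσ' a b he hs hs'

variable (Δ) (r d : ℕ)

/-- The forms on the triangles that belong to a chain of triangles. -/
def toForms (p : Δ.triangles → R) (σ : Finset Plane) : R :=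
  if hσ : σ ∈ Δ.triangles then Δ.orientation σ • p ⟨σ, hσ⟩ else 0

theorem compatible_toForms_iff (p : Δ.triangles → R) :
    Δ.Compatible (r + 1) (Δ.toForms p) ↔ Δ.boundary₂ p ∈ Δ.edgeSub r := by
  rw [mem_edgeSub]
  constructor
  · intro hp τ
    obtain ⟨a, b, c, c', h, h', -, he, -, -, -, hb⟩ := Δ.exists_boundary₂_eq τ
    have hab := Δ.pair_mem_edges h
    have := hp _ h _ h' a b hab (by intro v; simp; tauto) (by intro v; simp; tauto)
    rw [he, edgeIdeal_eq_lineCoeff r (Δ.ne_of_mem_edges hab), Ideal.mem_span_singleton, hb]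
    rwa [toForms, toForms, dif_pos h, dif_pos h'] at this
  · intro hp σ hσ σ' hσ' a b hab hs hs'
    by_cases heq : σ = σ'
    · rw [heq, sub_self]; exact dvd_zero _
    have hi : {a, b} ∈ Δ.interiorEdges :=
      Finset.mem_filter.2 ⟨hab, σ, hσ, σ', hσ', heq, hs, hs'⟩
    obtain ⟨a', b', c, c', h, h', -, he, -, -, hall, hb⟩ := Δ.exists_boundary₂_eq ⟨_, hi⟩
    have hm := hp ⟨_, hi⟩
    rw [hb] at hm
    rw [← Ideal.mem_span_singleton, ← edgeIdeal_eq_lineCoeff r (Δ.ne_of_mem_edges hab), toForms,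
      toForms, dif_pos hσ, dif_pos hσ']
    dsimp only at he
    rw [he] at hs hs'
    rcases hall σ hσ hs with rfl | rfl <;> rcases hall σ' hσ' hs' with rfl | rfl
    · exact absurd rfl heq
    · exact hm
    · rw [← neg_sub]; exact neg_mem hm
    · exact absurd rfl heq

/-- The function on `|Δ|` that belongs to a chain of triangles. -/
def toFunction : (Δ.triangles → R) →ₗ[ℝ] (Δ.domain → ℝ) where
  toFun p x := Δ.glue (Δ.toForms p) x
  map_add' p q := by
    funext x
    simp only [glue, toForms, Pi.add_apply]
    split_ifs <;> simp
  map_smul' c p := by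
    funext x
    simp only [glue, toForms, Pi.smul_apply, RingHom.id_apply]
    split_ifs <;> simp [MvPolynomial.smul_eval]

/-- The chains of triangles of degree `d` whose boundary lies in the edge ideals. -/
def smoothChains : Submodule ℝ (Δ.triangles → R) :=
  Submodule.pi Set.univ (fun _ => MvPolynomial.homogeneousSubmodule (Fin 3) ℝ d) ⊓
    ((Δ.edgeSub r).restrictScalars ℝ).comap (Δ.boundary₂.restrictScalars ℝ)

theorem mem_smoothChains {p : Δ.triangles → R} : p ∈ Δ.smoothChains r d ↔
    (∀ σ, (p σ).IsHomogeneous d) ∧ Δ.boundary₂ p ∈ Δ.edgeSub r := by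
  simp only [smoothChains, Submodule.mem_inf, Submodule.mem_pi, Set.mem_univ, true_implies]
  exact Iff.rfl

variable {Δ r d}

theorem isHomogeneous_toForms {p : Δ.triangles → R} (hp : ∀ σ, (p σ).IsHomogeneous d)
    (σ : Finset Plane) : (Δ.toForms p σ).IsHomogeneous d := by
  rw [toForms]
  split_ifs with hσ
  · exact isHomogeneous_zsmul (hp _) _
  · exact MvPolynomial.isHomogeneous_zero _ _ _

theorem splines_eq_map : Δ.splines r d = (Δ.smoothChains r d).map Δ.toFunction := by
  ext F
  constructor
  · rintro ⟨⟨G, hG, hGc⟩, hF⟩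
    have hex : ∀ σ : Δ.triangles, ∃ h : R, h.IsHomogeneous d ∧
        ∀ x ∈ hull σ.1, G x = MvPolynomial.eval (pt x) h := by
      intro σ
      obtain ⟨p, hp, hFp⟩ := hF σ.1 σ.2
      obtain ⟨h, hh, he⟩ := exists_eval_eq_of_totalDegree_le hp
      exact ⟨h, hh, fun x hx => by
        rw [he, ← hFp ⟨x, hull_subset_domain σ.2 hx⟩ hx, ← hG]⟩
    choose h hh he using hex
    set p : Δ.triangles → R := fun σ => Δ.orientation σ.1 • h σ with hp
    have hf : ∀ σ (hσ : σ ∈ Δ.triangles), Δ.toForms p σ = h ⟨σ, hσ⟩ := by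
      intro σ hσ
      rw [toForms, dif_pos hσ, hp]
      dsimp only
      rw [smul_smul, orientation_mul_self, one_smul]
    have hGf : ∀ σ ∈ Δ.triangles, ∀ x ∈ hull σ, G x = MvPolynomial.eval (pt x) (Δ.toForms p σ) := by
      intro σ hσ x hx
      rw [hf σ hσ]; exact he ⟨σ, hσ⟩ x hx
    have hpd : ∀ σ, (p σ).IsHomogeneous d := fun σ => isHomogeneous_zsmul (hh σ) _
    have hc : Δ.Compatible (r + 1) (Δ.toForms p) :=
      compatible_of_contDiffOn (fun σ _ => isHomogeneous_toForms hpd σ) hGc hGf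
    refine ⟨p, (Δ.mem_smoothChains r d).2 ⟨hpd, (Δ.compatible_toForms_iff r p).1 hc⟩, funext ?_⟩
    intro x
    obtain ⟨σ, hσ, hx⟩ := Δ.mem_domain.1 x.2
    change Δ.glue (Δ.toForms p) x = F x
    rw [(hc.mono (by omega)).glue_eq hσ hx, ← hG, hGf σ hσ x hx]
  · rintro ⟨p, hp, rfl⟩
    obtain ⟨hpd, hpb⟩ := (Δ.mem_smoothChains r d).1 hp
    have hc := (Δ.compatible_toForms_iff r p).2 hpb
    refine ⟨⟨Δ.glue (Δ.toForms p), fun _ => rfl, hc.contDiffOn_glue⟩, fun σ hσ => ?_⟩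
    obtain ⟨q, hq, hqe⟩ := exists_totalDegree_le_of_isHomogeneous (isHomogeneous_toForms hpd σ)
    refine ⟨q, hq, fun x hx => ?_⟩
    rw [hqe]
    exact (hc.mono (by omega)).glue_eq hσ hx

theorem injOn_toFunction : Set.InjOn Δ.toFunction (Δ.smoothChains r d) := by
  intro p hp q hq he
  have hpq := sub_mem hp hq
  obtain ⟨hd, hb⟩ := (Δ.mem_smoothChains r d).1 hpq
  have hc := (Δ.compatible_toForms_iff r _).2 hb
  have h0 : Δ.toFunction (p - q) = 0 := by rw [map_sub, he, sub_self]
  rw [← sub_eq_zero]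
  funext σ
  obtain ⟨σ, hσ⟩ := σ
  obtain ⟨a, b, c, rfl⟩ := Δ.exists_eq_triple hσ
  have hz := eq_zero_of_eval_hull_eq_zero (Δ.orient_ne_zero hσ)
    (isHomogeneous_toForms hd {a, b, c}) fun x hx => by
      rw [← (hc.mono (by omega)).glue_eq hσ hx]
      exact congrFun h0 ⟨x, hull_subset_domain hσ hx⟩
  rw [toForms, dif_pos hσ] at hz
  have := congrArg (fun f => Δ.orientation {a, b, c} • f) hz
  rw [Pi.zero_apply]
  simpa only [smul_smul, orientation_mul_self, one_smul, smul_zero] using this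

/-- The space of splines is isomorphic to the space of smooth chains of triangles. -/
def splinesEquiv : Δ.smoothChains r d ≃ₗ[ℝ] Δ.splines r d :=
  (LinearEquiv.ofBijective
    ((Δ.toFunction.domRestrict (Δ.smoothChains r d)).codRestrict (Δ.splines r d) fun p => by
      rw [splines_eq_map]; exact ⟨p, p.2, rfl⟩)
    ⟨fun p q h => Subtype.ext (injOn_toFunction p.2 q.2 (congrArg Subtype.val h)), fun F => by
      obtain ⟨p, hp, he⟩ := splines_eq_map.le F.2
      exact ⟨⟨p, hp⟩, Subtype.ext he⟩⟩)

end PlanarTriangulation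
end SplineTriangulation

end

noncomputable section

namespace SplineTriangulation

open MvPolynomial (homogeneousComponent homogeneousSubmodule)

theorem finrank_map_add_finrank_inf_ker {V W : Type*} [AddCommGroup V] [Module ℝ V] [AddCommGroup W]
    [Module ℝ W] (f : V →ₗ[ℝ] W) (K : Submodule ℝ V) [Module.Finite ℝ K] :
    Module.finrank ℝ (K.map f) + Module.finrank ℝ (K ⊓ LinearMap.ker f : Submodule ℝ V) =
      Module.finrank ℝ K := by
  have h := LinearMap.finrank_range_add_finrank_ker (f.domRestrict K)
  rw [LinearMap.range_domRestrict, LinearMap.ker_domRestrict] at h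
  rw [← h, ← Submodule.map_comap_subtype, Submodule.finrank_map_subtype_eq]

/-- A product of submodules is the product of the underlying modules. -/
def submodulePiEquiv {ι : Type*} {M : ι → Type*} [∀ i, AddCommGroup (M i)] [∀ i, Module ℝ (M i)]
    (p : ∀ i, Submodule ℝ (M i)) : Submodule.pi Set.univ p ≃ₗ[ℝ] ∀ i, p i where
  toFun x i := ⟨x.1 i, x.2 i trivial⟩
  invFun y := ⟨fun i => y i, fun i _ => (y i).2⟩
  map_add' _ _ := rfl
  map_smul' _ _ := rfl
  left_inv _ := rfl
  right_inv _ := rfl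

theorem finrank_submodulePi {ι : Type*} [Fintype ι] {M : ι → Type*} [∀ i, AddCommGroup (M i)]
    [∀ i, Module ℝ (M i)] (p : ∀ i, Submodule ℝ (M i)) [∀ i, Module.Finite ℝ (p i)] :
    Module.finrank ℝ (Submodule.pi Set.univ p) = ∑ i, Module.finrank ℝ (p i) := by
  rw [(submodulePiEquiv p).finrank_eq, Module.finrank_pi_fintype]

/-- The forms of degree `d` in an ideal. -/
def idealDegree (I : Ideal R) (d : ℕ) : Submodule ℝ R :=
  homogeneousSubmodule (Fin 3) ℝ d ⊓ I.restrictScalars ℝ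

theorem mem_idealDegree {I : Ideal R} {d : ℕ} {f : R} :
    f ∈ idealDegree I d ↔ f.IsHomogeneous d ∧ f ∈ I := Iff.rfl

instance (I : Ideal R) (d : ℕ) : Module.Finite ℝ (idealDegree I d) :=
  Submodule.finiteDimensional_of_le (S₂ := homogeneousSubmodule (Fin 3) ℝ d) inf_le_left

theorem sum_range_succ_eq_choose (e : ℕ) : ∑ n ∈ Finset.range (e + 1), (n + 1) = (e + 2).choose 2 := by
  induction e with
  | zero => rfl
  | succ e ih =>
    rw [Finset.sum_range_succ, ih, Nat.choose_succ_succ' (e + 2) 1, Nat.choose_one_right]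
    ring

theorem finrank_idealDegree_edgeIdeal (r e : ℕ) {a b : Plane} (hab : a ≠ b) :
    Module.finrank ℝ (idealDegree (edgeIdeal r {a, b}) (r + 1 + e)) = (e + 2).choose 2 := by
  obtain ⟨M, M', hF, -⟩ := exists_isFrame hab
  have h : edgeIdeal r {a, b} = pencilIdeal M' (r + 1) {none} := by
    rw [hF.edgeIdeal_eq_none, pencilIdeal]; simp
  rw [h, idealDegree, finrank_pencilIdeal hF.mul, ← sum_range_succ_eq_choose]
  refine Finset.sum_congr rfl fun n _ => ?_
  rw [Finset.card_singleton, one_mul]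
  exact min_eq_right (by omega)

namespace PlanarTriangulation

variable {Δ : PlanarTriangulation} {r d : ℕ}

theorem boundary₂_homogeneousComponent (p : Δ.triangles → R) (τ : Δ.interiorEdges) :
    Δ.boundary₂ (fun σ => homogeneousComponent d (p σ)) τ =
      homogeneousComponent d (Δ.boundary₂ p τ) := by
  simp only [boundary₂_apply, map_sum, map_zsmul]

theorem homogeneousComponent_eq_self {f : R} (hf : f.IsHomogeneous d) :
    homogeneousComponent d f = f := by
  rw [MvPolynomial.homogeneousComponent_of_mem (n := d) hf, if_pos rfl]

variable (Δ) in
/-- The constant chains of triangles. -/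
def constChain : R →ₗ[ℝ] (Δ.triangles → R) :=
  LinearMap.pi fun σ => (Δ.orientation σ.1) • (LinearMap.id : R →ₗ[ℝ] R)

theorem constChain_apply (f : R) (σ : Δ.triangles) : Δ.constChain f σ = Δ.orientation σ.1 • f := by
  simp [constChain]

theorem constChain_injective : Function.Injective Δ.constChain := by
  intro f g h
  obtain ⟨σ, hσ⟩ := Δ.triangles_nonempty
  have := congrArg (fun f => Δ.orientation σ • f) (congrFun h ⟨σ, hσ⟩)
  simpa only [constChain_apply, smul_smul, orientation_mul_self, one_smul] using this

instance : Module.Finite ℝ (Δ.smoothChains r d) := by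
  have : Module.Finite ℝ (Submodule.pi Set.univ
      (fun _ : Δ.triangles => homogeneousSubmodule (Fin 3) ℝ d)) :=
    Module.Finite.equiv (submodulePiEquiv _).symm
  exact Submodule.finiteDimensional_of_le inf_le_left

theorem smoothChains_inf_ker : (Δ.smoothChains r d ⊓
    LinearMap.ker (Δ.boundary₂.restrictScalars ℝ) : Submodule ℝ (Δ.triangles → R)) =
      (homogeneousSubmodule (Fin 3) ℝ d).map Δ.constChain := by
  ext p
  rw [Submodule.mem_inf, mem_smoothChains, LinearMap.mem_ker, LinearMap.restrictScalars_apply]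
  constructor
  · rintro ⟨⟨hd, -⟩, hp⟩
    obtain ⟨f, hf⟩ := (Δ.boundary₂_eq_zero_iff p).1 hp
    obtain ⟨σ, hσ⟩ := Δ.triangles_nonempty
    refine ⟨f, ?_, funext fun σ => by rw [constChain_apply, hf]⟩
    have h1 := hf ⟨σ, hσ⟩
    have h2 : f = Δ.orientation σ • p ⟨σ, hσ⟩ := by
      rw [h1, smul_smul, orientation_mul_self, one_smul]
    rw [h2]
    exact isHomogeneous_zsmul (hd _) _
  · rintro ⟨f, hf, rfl⟩
    have h0 : Δ.boundary₂ (Δ.constChain f) = 0 :=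
      (Δ.boundary₂_eq_zero_iff _).2 ⟨f, constChain_apply f⟩
    refine ⟨⟨fun σ => ?_, by rw [h0]; exact zero_mem _⟩, h0⟩
    rw [constChain_apply]
    exact isHomogeneous_zsmul hf _

variable (Δ r d) in
/-- The families of forms of degree `d` in the edge ideals. -/
def edgeForms : Submodule ℝ (Δ.interiorEdges → R) :=
  Submodule.pi Set.univ fun τ => idealDegree (edgeIdeal r τ.1) d

theorem mem_edgeForms {c : Δ.interiorEdges → R} :
    c ∈ Δ.edgeForms r d ↔ ∀ τ, (c τ).IsHomogeneous d ∧ c τ ∈ edgeIdeal r τ.1 := by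
  simp [edgeForms, Submodule.mem_pi, mem_idealDegree]

instance : Module.Finite ℝ (Δ.edgeForms r d) := Module.Finite.equiv (submodulePiEquiv _).symm

theorem smoothChains_map : (Δ.smoothChains r d).map (Δ.boundary₂.restrictScalars ℝ) =
    Δ.edgeForms r d ⊓ LinearMap.ker (Δ.boundary₁.restrictScalars ℝ) := by
  ext c
  rw [Submodule.mem_inf, LinearMap.mem_ker, LinearMap.restrictScalars_apply, mem_edgeForms]
  constructor
  · rintro ⟨p, hp, rfl⟩
    obtain ⟨hd, hb⟩ := (Δ.mem_smoothChains r d).1 hp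
    refine ⟨fun τ => ⟨?_, (Δ.mem_edgeSub r).1 hb τ⟩, ?_⟩
    · change (Δ.boundary₂ p τ).IsHomogeneous d
      rw [boundary₂_apply]
      exact MvPolynomial.IsHomogeneous.sum _ _ _ fun σ _ => isHomogeneous_zsmul (hd σ) _
    · exact LinearMap.congr_fun Δ.boundary₁_comp_boundary₂ p
  · rintro ⟨hc, h0⟩
    obtain ⟨p, hp⟩ := Δ.exists_boundary₂_eq_of_boundary₁_eq_zero h0
    have he : Δ.boundary₂ (fun σ => homogeneousComponent d (p σ)) = c := by
      funext τ
      rw [boundary₂_homogeneousComponent, hp, homogeneousComponent_eq_self (hc τ).1]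
    refine ⟨_, (Δ.mem_smoothChains r d).2
      ⟨fun σ => MvPolynomial.homogeneousComponent_isHomogeneous _ _, ?_⟩, he⟩
    rw [he, mem_edgeSub]
    exact fun τ => (hc τ).2

variable (Δ r d) in
/-- The families of forms of degree `d` in the vertex ideals. -/
def vertexForms : Submodule ℝ (Δ.interiorVertices → R) :=
  Submodule.pi Set.univ fun γ => idealDegree (Δ.vertexIdeal r γ.1) d

theorem mem_vertexForms {c : Δ.interiorVertices → R} :
    c ∈ Δ.vertexForms r d ↔ ∀ γ, (c γ).IsHomogeneous d ∧ c γ ∈ Δ.vertexIdeal r γ.1 := by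
  simp [vertexForms, Submodule.mem_pi, mem_idealDegree]

theorem edgeForms_map (hH : Δ.H1Degree r d = ⊥)
    (hsurj : ∀ f : Δ.interiorVertices → R, (∀ γ, (f γ).IsHomogeneous d) →
      ∃ c ∈ Δ.edgeDegree d, Δ.boundary₁ c = f) :
    (Δ.edgeForms r d).map (Δ.boundary₁.restrictScalars ℝ) = Δ.vertexForms r d := by
  ext f
  rw [mem_vertexForms]
  constructor
  · rintro ⟨c, hc, rfl⟩ γ
    have hc := mem_edgeForms.1 hc
    exact ⟨Δ.isHomogeneous_boundary₁ (fun τ => (hc τ).1) γ, (Δ.mem_vertexSub r).1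
      (Δ.edgeSub_le r ((Δ.mem_edgeSub r).2 fun τ => (hc τ).2)) γ⟩
  · intro hf
    obtain ⟨c, hc, rfl⟩ := hsurj f fun γ => (hf γ).1
    obtain ⟨e, he, heb⟩ := (Δ.H1Degree_eq_bot_iff r d).1 hH c hc
      ((Δ.mem_vertexSub r).2 fun γ => (hf γ).2)
    refine ⟨fun τ => homogeneousComponent d (e τ), mem_edgeForms.2 fun τ =>
      ⟨MvPolynomial.homogeneousComponent_isHomogeneous _ _,
        closedUnderComponents_edgeIdeal _ _ _ _ ((Δ.mem_edgeSub r).1 he τ)⟩, funext fun γ => ?_⟩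
    change Δ.boundary₁ (fun τ => homogeneousComponent d (e τ)) γ = _
    rw [boundary₁_homogeneousComponent, heb, homogeneousComponent_eq_self (hf γ).1]

/-- The dimension of the space of splines in a degree in which the homology vanishes. -/
theorem finrank_splines {e : ℕ} (hH : Δ.H1Degree r (r + 1 + e) = ⊥)
    (hsurj : ∀ f : Δ.interiorVertices → R, (∀ γ, (f γ).IsHomogeneous (r + 1 + e)) →
      ∃ c ∈ Δ.edgeDegree (r + 1 + e), Δ.boundary₁ c = f) :
    Module.finrank ℝ (Δ.splines r (r + 1 + e)) +
      ∑ γ ∈ Δ.interiorVertices, Module.finrank ℝ (idealDegree (Δ.vertexIdeal r γ) (r + 1 + e)) =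
      (r + 1 + e + 2).choose 2 + Δ.interiorEdges.card * (e + 2).choose 2 := by
  have h1 := finrank_map_add_finrank_inf_ker (Δ.boundary₂.restrictScalars ℝ)
    (Δ.smoothChains r (r + 1 + e))
  have h2 := finrank_map_add_finrank_inf_ker (Δ.boundary₁.restrictScalars ℝ)
    (Δ.edgeForms r (r + 1 + e))
  rw [smoothChains_map, smoothChains_inf_ker,
    ← (Submodule.equivMapOfInjective _ constChain_injective _).finrank_eq,
    finrank_homogeneousSubmodule] at h1
  rw [edgeForms_map hH hsurj, vertexForms, finrank_submodulePi] at h2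
  have h3 : Module.finrank ℝ (Δ.edgeForms r (r + 1 + e)) =
      Δ.interiorEdges.card * (e + 2).choose 2 := by
    rw [edgeForms, finrank_submodulePi, Finset.sum_congr rfl (g := fun _ => (e + 2).choose 2)]
    · rw [Finset.sum_const, Finset.card_univ, Fintype.card_coe, smul_eq_mul]
    · rintro ⟨τ, hτ⟩ -
      obtain ⟨a, b, hab, rfl⟩ := exists_lexLT_of_card_eq_two
        (Δ.mem_edges.1 (Finset.mem_filter.1 hτ).1).2
      exact finrank_idealDegree_edgeIdeal r e (lexLT_ne hab)
  rw [h3, Finset.sum_coe_sort Δ.interiorVertices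
    fun γ => Module.finrank ℝ (idealDegree (Δ.vertexIdeal r γ) (r + 1 + e))] at h2
  rw [← splinesEquiv.finrank_eq]
  omega

/-- Schumaker's lower bound in terms of the dimensions of the vertex ideals. -/
theorem schumakerBound_eq {e : ℕ} (hγ : ∀ γ ∈ Δ.interiorVertices, 2 ≤ Δ.numSlopes γ ∧
      Module.finrank ℝ (idealDegree (Δ.vertexIdeal r γ) (r + 1 + e)) =
        ∑ n ∈ Finset.range (e + 1), min (r + 1 + (n + 1)) (Δ.numSlopes γ * (n + 1))) :
    Δ.schumakerBound r (r + 1 + e) = ((r + 1 + e + 2).choose 2 : ℤ) +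
      Δ.interiorEdges.card * ((e + 2).choose 2 : ℤ) - ∑ γ ∈ Δ.interiorVertices,
        (Module.finrank ℝ (idealDegree (Δ.vertexIdeal r γ) (r + 1 + e)) : ℤ) := by
  have h : ∀ γ ∈ Δ.interiorVertices,
      (Module.finrank ℝ (idealDegree (Δ.vertexIdeal r γ) (r + 1 + e)) : ℤ) =
        Δ.numSlopes γ * ((e + 2).choose 2 : ℤ) -
          ((Δ.mu r γ : ℤ) * ((r + 1 + e + 2 - Δ.alpha r γ).choose 2 : ℤ)
          + (Δ.nu r γ : ℤ) * ((r + 1 + e + 1 - Δ.alpha r γ).choose 2 : ℤ)) := by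
    intro γ hγ'
    obtain ⟨h2, hf⟩ := hγ γ hγ'
    obtain ⟨k, hk⟩ : ∃ k, Δ.numSlopes γ = k + 2 := ⟨_, (Nat.sub_add_cancel h2).symm⟩
    have hmul : Δ.numSlopes γ * (r + 1) = (r + 1) + (k + 1) * (r + 1) := by rw [hk]; ring
    have hα : Δ.alpha r γ = (r + 1) + (r + 1) / (k + 1) := by
      rw [alpha, hmul, hk, show k + 2 - 1 = k + 1 by omega, Nat.add_mul_div_left _ _ k.succ_pos,
        add_comm]
    have hν : Δ.nu r γ = (r + 1) % (k + 1) := by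
      rw [nu, hmul, hk, show k + 2 - 1 = k + 1 by omega, Nat.add_mul_mod_self_left]
    rw [hf, sum_min_eq h2, mu, hν, hα, hk, show k + 2 - 1 = k + 1 by omega,
      show r + 1 + e + 2 - (r + 1 + (r + 1) / (k + 1)) = e + 1 + 1 - (r + 1) / (k + 1) by omega,
      show r + 1 + e + 1 - (r + 1 + (r + 1) / (k + 1)) = e + 1 - (r + 1) / (k + 1) by omega]
  rw [Finset.sum_congr rfl h, schumakerBound, Finset.sum_sub_distrib, ← Finset.sum_mul,
    show r + 1 + e + 1 - r = e + 2 by omega]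
  ring

end PlanarTriangulation
end SplineTriangulation

end

noncomputable section

namespace SplineTriangulation

/-- The floor of a quotient of natural numbers. -/
theorem floor_div_eq {r s A ρ : ℕ} (h : r + 1 = s * A + ρ) (hρ : ρ < s) :
    ⌊((r : ℚ) + 1) / s⌋ = A := by
  have hs : (0 : ℚ) < s := by exact_mod_cast (Nat.zero_le ρ).trans_lt hρ
  have hq : (r : ℚ) + 1 = s * A + ρ := by exact_mod_cast h
  have hρ' : (ρ : ℚ) < s := by exact_mod_cast hρ
  rw [Int.floor_eq_iff, le_div_iff₀ hs, div_lt_iff₀ hs, hq]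
  push_cast
  constructor
  · nlinarith [(Nat.cast_nonneg ρ : (0 : ℚ) ≤ ρ)]
  · nlinarith

theorem modEq_sub_one_iff {r s A ρ : ℕ} (h : r + 1 = s * A + ρ) (hρ : ρ < s) :
    (r : ℤ) + 1 ≡ s - 1 [ZMOD s] ↔ ρ = s - 1 := by
  have hq : (r : ℤ) + 1 = s * A + ρ := by exact_mod_cast h
  have h1 : ((s : ℤ) * A + ρ) % s = ρ := by
    rw [Int.mul_add_emod_self_left]
    exact Int.emod_eq_of_lt (by omega) (by omega)
  rw [Int.ModEq, hq, h1, Int.emod_eq_of_lt (by omega) (by omega)]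
  omega

theorem cast_div_eq {r s A ρ : ℕ} (h : r + 1 = s * A + ρ) (hρ : ρ < s) :
    ((r : ℚ) + 1) / s = A + (ρ : ℚ) / s := by
  have hs : (s : ℚ) ≠ 0 := by exact_mod_cast ((Nat.zero_le ρ).trans_lt hρ).ne'
  have hq : (r : ℚ) + 1 = s * A + ρ := by exact_mod_cast h
  rw [hq]
  field_simp

theorem half_le_div {s ρ : ℕ} (hs : 2 ≤ s) (hρ : ρ = s - 1) : (1 : ℚ) / 2 ≤ (ρ : ℚ) / s := by
  have hs' : (0 : ℚ) < s := by exact_mod_cast (by omega : 0 < s)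
  rw [div_le_div_iff₀ two_pos hs']
  exact_mod_cast (by omega : 1 * s ≤ ρ * 2)

namespace PlanarTriangulation
variable {Δ : PlanarTriangulation} {r : ℕ} {v₁ v₂ : Plane}

/-- The top nonzero degree of `H₁`, when the star of `vᵢ` has `s`, `t` slopes besides the common
edge. -/
theorem H1Degree_eq_bot_and_ne_bot {S T : Finset ℝ} {s t A B ρ ρ' m : ℕ}
    (hH : ∀ e, Δ.H1Degree r (r + 1 + e) = ⊥ ↔ bidegLE e ≤ bicolonSum (r + 1) S T e)
    (hS : S.card = s) (hs : 2 ≤ s) (hN : r + 1 = s * A + ρ) (hρ : ρ < s) (hA : 1 ≤ A)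
    (hT : T.card = t) (ht : 2 ≤ t) (hN' : r + 1 = t * B + ρ') (hρ' : ρ' < t) (hB : 1 ≤ B)
    (hm : m + 1 = r + A + B + if ρ = s - 1 ∧ ρ' = t - 1 then 1 else 0) :
    (∀ d, m < d → Δ.H1Degree r d = ⊥) ∧ Δ.H1Degree r m ≠ ⊥ := by
  constructor
  · intro d hd
    obtain ⟨e, rfl⟩ : ∃ e, d = r + 1 + e := Nat.exists_eq_add_of_le (by split_ifs at hm <;> omega)
    rw [hH]
    refine bidegLE_le_bicolonSum (δ := if ρ = s - 1 then 1 else 0)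
      (δ' := if ρ' = t - 1 then 1 else 0) hS hs hN hρ (fun h => if_pos h) hT ht hN' hρ'
      (fun h => if_pos h) ?_
    split_ifs at hm ⊢ <;> omega
  · split_ifs at hm with h
    · rw [show m = r + 1 + (A + B - 1) by omega, Ne, hH]
      exact not_bidegLE_le_bicolonSum_of_remainder hS hs hN h.1 hA hT ht hN' h.2 hB
    · rw [show m = r + 1 + (A + B - 2) by omega, Ne, hH]
      exact not_bidegLE_le_bicolonSum hS hN hA hT hN' hB

/-- The dimension of the vertex ideal of a vertex with all its slopes in one pencil. -/
theorem finrank_idealDegree_vertexIdeal {γ : Plane} {S : Finset ℝ}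
    (hM : ∃ M M' : Matrix (Fin 3) (Fin 3) ℝ, M' * M = 1 ∧ Δ.vertexIdeal r γ =
      pencilIdeal M' (r + 1) (insert none (S.map Function.Embedding.some)))
    (hγ : Δ.numSlopes γ = S.card + 1) (e : ℕ) :
    Module.finrank ℝ (idealDegree (Δ.vertexIdeal r γ) (r + 1 + e)) =
      ∑ n ∈ Finset.range (e + 1), min (r + 1 + (n + 1)) (Δ.numSlopes γ * (n + 1)) := by
  obtain ⟨M, M', hMM, hI⟩ := hM
  have hc : (insert none (S.map Function.Embedding.some)).card = Δ.numSlopes γ := by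
    rw [Finset.card_insert_of_notMem (by simp), Finset.card_map, hγ]
  rw [hI, ← hc]
  exact finrank_pencilIdeal hMM (r + 1) e _

theorem link_diff_nonempty (h : 2 ≤ (slopes (Δ.edges.erase {v₁, v₂}) v₁).ncard) :
    (Δ.link v₁ \ {v₂}).Nonempty := by
  by_contra hc
  rw [Set.not_nonempty_iff_eq_empty] at hc
  rw [slopes_erase, hc, Set.image_empty, Set.ncard_empty] at h
  omega

end PlanarTriangulation
end SplineTriangulation

end

theorem mainTheorem6
    (Δ : SplineTriangulation.PlanarTriangulation) (r s t : ℕ)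
    (v₁ v₂ : SplineTriangulation.Plane) (hv : v₁ ≠ v₂)
    (hvertices : Δ.interiorVertices = {v₁, v₂})
    (hedge : {v₁, v₂} ∈ Δ.edges)
    (hslope₁ : ∀ w, {v₁, w} ∈ Δ.edges → w ≠ v₂ →
      SplineTriangulation.slope v₁ w ≠ SplineTriangulation.slope v₁ v₂)
    (hslope₂ : ∀ w, {v₂, w} ∈ Δ.edges → w ≠ v₁ →
      SplineTriangulation.slope v₂ w ≠ SplineTriangulation.slope v₂ v₁)
    (hs : (SplineTriangulation.slopes (Δ.edges.erase {v₁, v₂}) v₁).ncard = s)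
    (ht : (SplineTriangulation.slopes (Δ.edges.erase {v₁, v₂}) v₂).ncard = t)
    (h2s : 2 ≤ s) (hst : s ≤ t) (htr : t ≤ r + 1) :
    (∃ m : ℕ, Δ.HasRegularityH1 r m ∧
      ⌊((r : ℚ) + 1) / s⌋ + ⌊((r : ℚ) + 1) / t⌋ + r - 1 ≤ (m : ℤ) ∧
      (m : ℤ) ≤ ⌊((r : ℚ) + 1) / s + ((r : ℚ) + 1) / t⌋ + r - 1 ∧
      (((r : ℤ) + 1 ≡ s - 1 [ZMOD s] ∧ (r : ℤ) + 1 ≡ t - 1 [ZMOD t]) →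
        (m : ℤ) = ⌊((r : ℚ) + 1) / s⌋ + ⌊((r : ℚ) + 1) / t⌋ + r) ∧
      (¬ ((r : ℤ) + 1 ≡ s - 1 [ZMOD s] ∧ (r : ℤ) + 1 ≡ t - 1 [ZMOD t]) →
        (m : ℤ) = ⌊((r : ℚ) + 1) / s⌋ + ⌊((r : ℚ) + 1) / t⌋ + r - 1)) ∧
    (∀ d : ℕ, ((r : ℚ) + 1) / s + ((r : ℚ) + 1) / t + r - 1 < (d : ℚ) →
      Module.Finite ℝ (Δ.splines r d) ∧
        (Module.finrank ℝ (Δ.splines r d) : ℤ) = Δ.schumakerBound r d) := by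
  have h2t := h2s.trans hst
  have h : Δ.HasTwoInteriorVertices v₁ v₂ := ⟨hv, hvertices, hedge⟩
  have hpair : ({v₂, v₁} : Finset SplineTriangulation.Plane) = {v₁, v₂} := Finset.pair_comm _ _
  have hw : (Δ.link v₁ \ {v₂}).Nonempty := Δ.link_diff_nonempty (by rw [hs]; exact h2s)
  have hw' : (Δ.link v₂ \ {v₁}).Nonempty := Δ.link_diff_nonempty (by rw [hpair, ht]; exact h2t)
  obtain ⟨S, T, hS, hT, hH, hM₁, hM₂⟩ := h.exists_H1Degree_eq_bot_iff hw hslope₁ hslope₂ r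
  have hn₁ : Δ.numSlopes v₁ = S.card + 1 := by rw [hS, Δ.numSlopes_eq hedge hslope₁]
  have hn₂ : Δ.numSlopes v₂ = T.card + 1 := by
    rw [hT, ← hpair, Δ.numSlopes_eq (hpair ▸ hedge) hslope₂]
  rw [hs] at hS
  rw [ht] at hT
  have hN := (Nat.div_add_mod (r + 1) s).symm
  have hN' := (Nat.div_add_mod (r + 1) t).symm
  have hρ := Nat.mod_lt (r + 1) (show 0 < s by omega)
  have hρ' := Nat.mod_lt (r + 1) (show 0 < t by omega)
  have hA : 1 ≤ (r + 1) / s := Nat.div_pos (hst.trans htr) (by omega)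
  have hB : 1 ≤ (r + 1) / t := Nat.div_pos htr (by omega)
  rw [SplineTriangulation.floor_div_eq hN hρ, SplineTriangulation.floor_div_eq hN' hρ',
    SplineTriangulation.modEq_sub_one_iff hN hρ, SplineTriangulation.modEq_sub_one_iff hN' hρ',
    SplineTriangulation.cast_div_eq hN hρ, SplineTriangulation.cast_div_eq hN' hρ']
  set A := (r + 1) / s
  set B := (r + 1) / t
  set ρ := (r + 1) % s
  set ρ' := (r + 1) % t
  obtain ⟨m, hm⟩ : ∃ m, m + 1 = r + A + B + if ρ = s - 1 ∧ ρ' = t - 1 then 1 else 0 :=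
    ⟨_, Nat.sub_add_cancel (by omega)⟩
  obtain ⟨hbot, hne⟩ := SplineTriangulation.PlanarTriangulation.H1Degree_eq_bot_and_ne_bot hH hS h2s
    hN hρ hA hT h2t hN' hρ' hB hm
  have hfrac : (A : ℚ) + B + (if ρ = s - 1 ∧ ρ' = t - 1 then 1 else 0 : ℕ) ≤
      A + (ρ : ℚ) / s + (B + (ρ' : ℚ) / t) := by
    split_ifs with hmax
    · have := SplineTriangulation.half_le_div h2s hmax.1
      have := SplineTriangulation.half_le_div h2t hmax.2
      push_cast
      linarith
    · have : 0 ≤ (ρ : ℚ) / s := by positivity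
      have : 0 ≤ (ρ' : ℚ) / t := by positivity
      push_cast
      linarith
  have hmq : (m : ℚ) + 1 = r + A + B + (if ρ = s - 1 ∧ ρ' = t - 1 then 1 else 0 : ℕ) := by
    exact_mod_cast hm
  refine ⟨⟨m, ⟨Δ.isFiniteLength_H1 r hbot, hne, fun d hd => ?_⟩, ?_, ?_, ?_, ?_⟩, fun d hd => ?_⟩
  · by_contra hlt
    exact hd (hbot d (not_le.1 hlt))
  · split_ifs at hm <;> omega
  · have : (m : ℤ) - r + 1 ≤ ⌊(A : ℚ) + (ρ : ℚ) / s + (B + (ρ' : ℚ) / t)⌋ := by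
      rw [Int.le_floor]
      push_cast
      linarith
    omega
  · intro hmax
    rw [if_pos hmax] at hm
    omega
  · intro hmax
    rw [if_neg hmax] at hm
    omega
  · have hmd : m < d := by exact_mod_cast (by linarith : (m : ℚ) < d)
    have hd' := hbot d hmd
    obtain ⟨e, rfl⟩ : ∃ e, d = r + 1 + e := Nat.exists_eq_add_of_le (by split_ifs at hm <;> omega)
    refine ⟨Module.Finite.equiv SplineTriangulation.PlanarTriangulation.splinesEquiv, ?_⟩
    have hdim := SplineTriangulation.PlanarTriangulation.finrank_splines hd'
      fun f hf => h.exists_boundary₁_eq hw hw' hf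
    have h1 := SplineTriangulation.PlanarTriangulation.finrank_idealDegree_vertexIdeal hM₁ hn₁ e
    have h2 := SplineTriangulation.PlanarTriangulation.finrank_idealDegree_vertexIdeal hM₂ hn₂ e
    rw [SplineTriangulation.PlanarTriangulation.schumakerBound_eq]
    · zify at hdim
      linarith
    · intro γ hγ
      rw [hvertices] at hγ
      rcases Finset.mem_insert.1 hγ with rfl | hγ
      · exact ⟨by omega, h1⟩
      · rw [Finset.mem_singleton.1 hγ]
        exact ⟨by omega, h2⟩
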